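/- Let $Z$ and $Y$ be complex manifolds, $p\colon Z\to Y$ a holomorphic submersion and $\mathcal L$ a holomorphic line bundle on $Y$ with transition functions $g_{ij}$ (in the analytic topology throughout). Let $\mathcal D_Y,\mathcal D_Z$ be the sheaves of holomorphic differential operators, $\Theta_{Z/Y}$ the sheaf of vertical holomorphic vector fields on $Z$, and $\mathcal D_{Z\to Y}:=\mathcal D_Z/(\mathcal D_Z\cdot\Theta_{Z/Y})$. It is a $(\mathcal D_Z,p^{-1}\mathcal D_Y)$-bimodule, where a local section $Q$ of $p^{-1}\mathcal D_Y$ acts on the right by $[R]\cdot Q=[R\,\widetilde Q]$ for any local holomorphic differential operator $\widetilde Q$ on $Z$ with $\widetilde Q(f\circ p)=(Qf)\circ p$ for all local holomorphic functions $f$ on $Y$; this is well defined. Put $\mathcal D_{Y,\mathcal L}:=\mathcal L\otimes_{\mathcal O_Y}\mathcal D_Y\otimes_{\mathcal O_Y}\mathcal L^{-1}$, define $\mathcal D_{Z,p^*\mathcal L}$ likewise, and let $$\mathcal D_{Z\to Y,\mathcal L}:=p^*\mathcal L\otimes_{\mathcal O_Z}\mathcal D_{Z\to Y}\otimes_{p^{-1}\mathcal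 O_Y}p^{-1}\mathcal L^{-1},$$ which is a $(\mathcal D_{Z,p^*\mathcal L},p^{-1}\mathcal D_{Y,\mathcal L})$-bimodule with a global section $1_{Z\to Y,\mathcal L}$ induced by $1\in\mathcal D_Y$. Let $|\mathcal L|^2$ be the $C^\infty$ complex line bundle on $Y$ with transition functions $|g_{ij}|^2$, define $|p^*\mathcal L|^2$ on $Z$ likewise, and let $\mathcal C^\infty_{Y,|\mathcal L|^2}$ and $\mathcal C^\infty_{Z,|p^*\mathcal L|^2}$ be their sheaves of smooth sections, on which $\mathcal D_{Y,\mathcal L}$ and $\mathcal D_{Z,p^*\mathcal L}$ act. The sheaf $\mathcal Hom(p^{-1}\mathcal C^\infty_{Y,|\mathcal L|^2},\mathcal C^\infty_{Z,|p^*\mathcal L|^2})$ of homomorphisms of sheaves of complex vector spaces is a $(\mathcal D_{Z,p^*\mathcal L},p^{-1}\mathcal D_{Y,\mathcal L})$-bimodule through $\phi\mapsto P\circ\phi\circ Q$, and it has a global section $\mathbf p^{-1}_{\mathcal L}$, the pull-back of smooth sections. Then there is a unique homomorphism of $(\mathcal D_{Z,p^*\mathcal L},p^{-1}\mathcal D_{Y,\mathcal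 L})$-bimodules $$\mathcal D_{Z\to Y,\mathcal L}\longrightarrow\mathcal Hom\bigl(p^{-1}\mathcal C^\infty_{Y,|\mathcal L|^2},\mathcal C^\infty_{Z,|p^*\mathcal L|^2}\bigr)$$ that sends $1_{Z\to Y,\mathcal L}$ to $\mathbf p^{-1}_{\mathcal L}$, and this homomorphism is injective. -/

import Mathlib

open scoped Manifold ContDiff Topology
open TopologicalSpace (Opens)
open Bundle Manifold

noncomputable section

namespace HolDiff

/-! ### Holomorphic and smooth functions on the open subsets of a complex manifold -/

section Functions

variable (E : Type*) [NormedAddCommGroup E] [NormedSpace ℂ E]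
  {X : Type*} [TopologicalSpace X] [ChartedSpace E X]

/-- A holomorphic map is smooth for the underlying real structures. -/
theorem contMDiff_real_of_complex {E} [NormedAddCommGroup E] [NormedSpace ℂ E]
    {X : Type*} [TopologicalSpace X] [ChartedSpace E X]
    {E' : Type*} [NormedAddCommGroup E'] [NormedSpace ℂ E']
    {X' : Type*} [TopologicalSpace X'] [ChartedSpace E' X'] {f : X → X'}
    (hf : ContMDiff 𝓘(ℂ, E) 𝓘(ℂ, E') ω f) : ContMDiff 𝓘(ℝ, E) 𝓘(ℝ, E') ∞ f := by
  intro x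
  have h := contMDiffAt_iff.1 (hf x)
  refine contMDiffAt_iff.2 ⟨h.1, ?_⟩
  exact (h.2.restrict_scalars ℝ).of_le le_top

/-- `O_X(V)`: the holomorphic functions on `V`. -/
def holFun (V : Opens X) : Subalgebra ℂ (V → ℂ) where
  carrier := {f | ContMDiff 𝓘(ℂ, E) 𝓘(ℂ, ℂ) ω f}
  mul_mem' hf hg := by
    have := (contDiff_mul (𝕜 := ℂ) (𝔸 := ℂ) (n := ω)).contMDiff.comp (hf.prodMk_space hg)
    exact this
  add_mem' hf hg := by
    have := (contDiff_add (𝕜 := ℂ) (F := ℂ) (n := ω)).contMDiff.comp (hf.prodMk_space hg)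
    exact this
  algebraMap_mem' c := contMDiff_const (c := c)

/-- The algebra of complex valued functions on `V` that are smooth for the underlying real
structure. -/
def smoothAlg (V : Opens X) : Subalgebra ℂ (V → ℂ) where
  carrier := {f | ContMDiff 𝓘(ℝ, E) 𝓘(ℝ, ℂ) ∞ f}
  mul_mem' hf hg := by
    have := (contDiff_mul (𝕜 := ℝ) (𝔸 := ℂ) (n := ∞)).contMDiff.comp (hf.prodMk_space hg)
    exact this
  add_mem' hf hg := by
    have := (contDiff_add (𝕜 := ℝ) (F := ℂ) (n := ∞)).contMDiff.comp (hf.prodMk_space hg)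
    exact this
  algebraMap_mem' c := contMDiff_const (c := c)

/-- `C^∞_X(V)`, as a type. -/
def SmoothFun (V : Opens X) : Type _ := smoothAlg E V

instance (V : Opens X) : CommRing (SmoothFun E V) := inferInstanceAs (CommRing (smoothAlg E V))

instance (V : Opens X) : Algebra ℂ (SmoothFun E V) := inferInstanceAs (Algebra ℂ (smoothAlg E V))

theorem holFun_le_smoothAlg (V : Opens X) : holFun E V ≤ smoothAlg E V :=
  fun _ hf => contMDiff_real_of_complex hf

variable {E}

/-- A holomorphic function, regarded as a smooth function. -/
def toSmooth {V : Opens X} (f : holFun E V) : SmoothFun E V :=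
  ⟨f.1, holFun_le_smoothAlg E V f.2⟩

/-- The complex conjugate of a smooth function. -/
def conjFun {V : Opens X} (f : SmoothFun E V) : SmoothFun E V :=
  ⟨fun x => starRingEnd ℂ (f.1 x),
    ((Complex.conjCLE.contDiff (n := ∞)).contMDiff.comp f.2 : _)⟩

/-- Restriction of smooth functions. -/
def res {W V : Opens X} (h : W ≤ V) : SmoothFun E V →ₐ[ℂ] SmoothFun E W where
  toFun f := ⟨fun x => f.1 (Set.inclusion h x), f.2.comp (contMDiff_inclusion h)⟩
  map_one' := rfl
  map_mul' _ _ := rfl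
  map_zero' := rfl
  map_add' _ _ := rfl
  commutes' _ := rfl

/-- Restriction of holomorphic functions. -/
def holRes {W V : Opens X} (h : W ≤ V) (f : holFun E V) : holFun E W :=
  ⟨fun x => f.1 (Set.inclusion h x), f.2.comp (contMDiff_inclusion h)⟩

end Functions

/-! ### The sheaf of holomorphic differential operators -/

section Operators

variable (E : Type*) [NormedAddCommGroup E] [NormedSpace ℂ E]
  {X : Type*} [TopologicalSpace X] [ChartedSpace E X]

/-- The algebra of `ℂ`-linear endomorphisms of the sheaf `C^∞_X|_V`: families of endomorphisms of
the spaces `C^∞_X(W)`, for `W ⊆ V` open, that commute with restriction. -/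
def sheafEndAlg (V : Opens X) :
    Subalgebra ℂ (∀ W : Set.Iic V, Module.End ℂ (SmoothFun E W.1)) where
  carrier := {T | ∀ (W W' : Set.Iic V) (h : W'.1 ≤ W.1) (f : SmoothFun E W.1),
    res h (T W f) = T W' (res h f)}
  mul_mem' {S T} hS hT W W' h f := by
    change res h (S W (T W f)) = S W' (T W' (res h f))
    rw [hS W W' h, hT W W' h]
  add_mem' {S T} hS hT W W' h f := by
    change res h (S W f + T W f) = S W' (res h f) + T W' (res h f)
    rw [map_add, hS W W' h, hT W W' h]
  algebraMap_mem' c W W' h f := rfl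

/-- The endomorphisms of the sheaf `C^∞_X|_V`, as a type. -/
def SheafEnd (V : Opens X) : Type _ := sheafEndAlg E V

instance (V : Opens X) : Ring (SheafEnd E V) := inferInstanceAs (Ring (sheafEndAlg E V))

instance (V : Opens X) : Algebra ℂ (SheafEnd E V) := inferInstanceAs (Algebra ℂ (sheafEndAlg E V))

variable {E}

/-- Restriction of sheaf endomorphisms. -/
def endRes {W V : Opens X} (h : W ≤ V) : SheafEnd E V →ₐ[ℂ] SheafEnd E W where
  toFun T := ⟨fun W' => T.1 ⟨W'.1, W'.2.trans h⟩,
    fun W₁ W₂ h' f => T.2 ⟨W₁.1, W₁.2.trans h⟩ ⟨W₂.1, W₂.2.trans h⟩ h' f⟩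
  map_one' := rfl
  map_mul' _ _ := rfl
  map_zero' := rfl
  map_add' _ _ := rfl
  commutes' _ := rfl

/-- Multiplication by a smooth function. -/
def mulEnd {V : Opens X} (f : SmoothFun E V) : SheafEnd E V :=
  ⟨fun W => LinearMap.mulLeft ℂ (res W.2 f), fun _ _ h g => map_mul (res h) _ g⟩

variable (E)

/-- `Θ_X(V)`: the holomorphic vector fields on `V`, as operators on smooth functions. They are the
derivations of `C^∞_X|_V` that map holomorphic functions to holomorphic functions and kill
antiholomorphic functions; in holomorphic coordinates, the operators `∑ aᵢ ∂/∂zᵢ` with holomorphic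
`aᵢ`. -/
def holVectorField (V : Opens X) : Set (SheafEnd E V) :=
  {ξ | (∀ (W : Set.Iic V) (f g : SmoothFun E W.1),
        ξ.1 W (f * g) = f * ξ.1 W g + ξ.1 W f * g) ∧
      (∀ (W : Set.Iic V) (f : holFun E W.1), (ξ.1 W (toSmooth f)).1 ∈ holFun E W.1) ∧
      (∀ (W : Set.Iic V) (f : holFun E W.1), ξ.1 W (conjFun (toSmooth f)) = 0)}

/-- The algebra generated by `O_X(V)` and `Θ_X(V)`. -/
def genAlg (V : Opens X) : Subalgebra ℂ (SheafEnd E V) :=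
  Algebra.adjoin ℂ ((Set.range fun f : holFun E V => mulEnd (toSmooth f)) ∪ holVectorField E V)

variable {E}

theorem endRes_mem_genAlg {W V : Opens X} (h : W ≤ V) {P : SheafEnd E V}
    (hP : P ∈ genAlg E V) : endRes h P ∈ genAlg E W := by
  have : (genAlg E V).map (endRes h) ≤ genAlg E W := by
    rw [genAlg, AlgHom.map_adjoin]
    refine Algebra.adjoin_mono ?_
    rintro _ ⟨T, hT | hT, rfl⟩
    · obtain ⟨f, rfl⟩ := hT
      exact Or.inl ⟨holRes h f, rfl⟩
    · exact Or.inr ⟨fun W' => hT.1 ⟨W'.1, W'.2.trans h⟩, fun W' => hT.2.1 ⟨W'.1, W'.2.trans h⟩,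
        fun W' => hT.2.2 ⟨W'.1, W'.2.trans h⟩⟩
  exact this ⟨P, hP, rfl⟩

variable (E)

/-- `D_X(V)`: the holomorphic differential operators on `V`, that is, the sections over `V` of the
sheaf of algebras generated by `O_X` and `Θ_X`. They are realized by their (faithful) action on
smooth functions; this action preserves `O_X`, see `diffOp_preserves_hol`. -/
def diffOpAlg (V : Opens X) : Subalgebra ℂ (SheafEnd E V) where
  carrier := {P | ∀ x ∈ V, ∃ (W : Opens X) (h : W ≤ V), x ∈ W ∧ endRes h P ∈ genAlg E W}
  mul_mem' {P Q} hP hQ x hx := by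
    obtain ⟨W₁, h₁, hx₁, hP₁⟩ := hP x hx
    obtain ⟨W₂, h₂, hx₂, hQ₂⟩ := hQ x hx
    refine ⟨W₁ ⊓ W₂, inf_le_left.trans h₁, ⟨hx₁, hx₂⟩, ?_⟩
    rw [map_mul]
    exact mul_mem (endRes_mem_genAlg (inf_le_left : W₁ ⊓ W₂ ≤ W₁) hP₁)
      (endRes_mem_genAlg (inf_le_right : W₁ ⊓ W₂ ≤ W₂) hQ₂)
  add_mem' {P Q} hP hQ x hx := by
    obtain ⟨W₁, h₁, hx₁, hP₁⟩ := hP x hx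
    obtain ⟨W₂, h₂, hx₂, hQ₂⟩ := hQ x hx
    refine ⟨W₁ ⊓ W₂, inf_le_left.trans h₁, ⟨hx₁, hx₂⟩, ?_⟩
    rw [map_add]
    exact add_mem (endRes_mem_genAlg (inf_le_left : W₁ ⊓ W₂ ≤ W₁) hP₁)
      (endRes_mem_genAlg (inf_le_right : W₁ ⊓ W₂ ≤ W₂) hQ₂)
  algebraMap_mem' c x hx := ⟨V, le_rfl, hx, (genAlg E V).algebraMap_mem c⟩

/-- `D_X(V)`, as a type. -/
def DiffOp (V : Opens X) : Type _ := diffOpAlg E V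

instance (V : Opens X) : Ring (DiffOp E V) := inferInstanceAs (Ring (diffOpAlg E V))

instance (V : Opens X) : Algebra ℂ (DiffOp E V) := inferInstanceAs (Algebra ℂ (diffOpAlg E V))

variable {E}

/-- Restriction of differential operators. -/
def opRes {W V : Opens X} (h : W ≤ V) : DiffOp E V →ₐ[ℂ] DiffOp E W where
  toFun P := ⟨endRes h P.1, by
    intro x hx
    obtain ⟨W₁, h₁, hx₁, hP₁⟩ := P.2 x (h hx)
    exact ⟨W ⊓ W₁, inf_le_left, ⟨hx, hx₁⟩,
      endRes_mem_genAlg (inf_le_right : W ⊓ W₁ ≤ W₁) hP₁⟩⟩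
  map_one' := rfl
  map_mul' _ _ := rfl
  map_zero' := rfl
  map_add' _ _ := rfl
  commutes' _ := rfl

/-- A holomorphic function, as a differential operator of order zero. -/
def mulOp {V : Opens X} (f : holFun E V) : DiffOp E V :=
  ⟨mulEnd (toSmooth f), fun _ hx =>
    ⟨V, le_rfl, hx, Algebra.subset_adjoin (Or.inl ⟨f, rfl⟩)⟩⟩

/-- The action of a differential operator on `V` on the smooth functions on `V`. -/
def opAct {V : Opens X} (P : DiffOp E V) : Module.End ℂ (SmoothFun E V) :=
  P.1.1 ⟨V, le_refl V⟩

theorem opAct_res {W V : Opens X} (h : W ≤ V) (P : DiffOp E V) (f : SmoothFun E V) :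
    res h (opAct P f) = opAct (opRes h P) (res h f) :=
  P.1.2 ⟨V, le_refl V⟩ ⟨W, h⟩ h f

/-- Holomorphic differential operators commute with antiholomorphic functions. -/
theorem opAct_conj_mul {V : Opens X} (P : DiffOp E V) (f : holFun E V) (s : SmoothFun E V) :
    opAct P (conjFun (toSmooth f) * s) = conjFun (toSmooth f) * opAct P s := by
  have key : ∀ (W : Opens X) (T : SheafEnd E W), T ∈ genAlg E W → ∀ (W' : Set.Iic W)
      (f : holFun E W'.1) (s : SmoothFun E W'.1),
      T.1 W' (conjFun (toSmooth f) * s) = conjFun (toSmooth f) * T.1 W' s := by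
    intro W T hT
    refine Algebra.adjoin_induction (p := fun T _ => ∀ (W' : Set.Iic W)
      (f : holFun E W'.1) (s : SmoothFun E W'.1),
      T.1 W' (conjFun (toSmooth f) * s) = conjFun (toSmooth f) * T.1 W' s) ?_ ?_ ?_ ?_ hT
    · rintro T (⟨g, rfl⟩ | hT) W' f s
      · exact mul_left_comm _ _ _
      · rw [hT.1, hT.2.2, zero_mul, add_zero]
    · intro c W' f s
      exact (mul_smul_comm c _ _).symm
    · intro S T _ _ hS hT W' f s
      change S.1 W' _ + T.1 W' _ = _ * (S.1 W' _ + T.1 W' _)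
      rw [hS, hT, mul_add]
    · intro S T _ _ hS hT W' f s
      change S.1 W' (T.1 W' _) = _ * (S.1 W' (T.1 W' _))
      rw [hT, hS]
  refine Subtype.ext (funext fun x => ?_)
  obtain ⟨W, h, hx, hP⟩ := P.2 x.1 x.2
  have h₁ := key W _ hP ⟨W, le_refl W⟩ (holRes h f) (res h s)
  have h₂ : res h (opAct P (conjFun (toSmooth f) * s))
      = res h (conjFun (toSmooth f) * opAct P s) := by
    rw [opAct_res, map_mul (res h), map_mul (res h), opAct_res]
    exact h₁
  exact congrFun (congrArg Subtype.val h₂) ⟨x.1, hx⟩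

/-- Holomorphic differential operators map holomorphic functions to holomorphic functions. -/
theorem diffOp_preserves_hol {V : Opens X} (P : DiffOp E V) (f : holFun E V) :
    (opAct P (toSmooth f)).1 ∈ holFun E V := by
  have key : ∀ (W : Opens X) (T : SheafEnd E W), T ∈ genAlg E W → ∀ (W' : Set.Iic W)
      (f : holFun E W'.1), (T.1 W' (toSmooth f)).1 ∈ holFun E W'.1 := by
    intro W T hT
    refine Algebra.adjoin_induction (p := fun T _ => ∀ (W' : Set.Iic W)
      (f : holFun E W'.1), (T.1 W' (toSmooth f)).1 ∈ holFun E W'.1) ?_ ?_ ?_ ?_ hT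
    · rintro T (⟨g, rfl⟩ | hT) W' f
      · exact mul_mem (holRes W'.2 g).2 f.2
      · exact hT.2.1 W' f
    · intro c W' f
      exact Subalgebra.smul_mem _ f.2 c
    · intro S T _ _ hS hT W' f
      exact add_mem (hS W' f) (hT W' f)
    · intro S T _ _ hS hT W' f
      exact hS W' ⟨_, hT W' f⟩
  intro x
  obtain ⟨W, h, hx, hP⟩ := P.2 x.1 x.2
  have h₁ := key W _ hP ⟨W, le_refl W⟩ (holRes h f)
  have h₂ : res h (opAct P (toSmooth f)) = (endRes h P.1).1 ⟨W, le_refl W⟩ (toSmooth (holRes h f)) :=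
    opAct_res h P _
  rw [← h₂] at h₁
  classical
  let F : X → ℂ := fun y => if hy : y ∈ V then (opAct P (toSmooth f)).1 ⟨y, hy⟩ else 0
  have hF : ContMDiffAt 𝓘(ℂ, E) 𝓘(ℂ, ℂ) ω F x.1 := by
    refine (contMDiffAt_subtype_iff (U := W) (x := ⟨x.1, hx⟩)).1 ?_
    have : (fun y : W => F y.1) = (res h (opAct P (toSmooth f))).1 := by
      funext y
      exact dif_pos (h y.2)
    rw [this]
    exact h₁ _
  have h₃ := (contMDiffAt_subtype_iff (U := V) (x := x)).2 hF
  have : (fun y : V => F y.1) = (opAct P (toSmooth f)).1 := by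
    funext y
    exact dif_pos y.2
  rwa [this] at h₃

end Operators

/-! ### Line bundles through their transition functions -/

/-- The transition functions of a holomorphic line bundle: nowhere vanishing holomorphic functions
`g i j` on the overlaps of an open covering, with `g i k = g i j * g j k`. The local coordinates of
a section are related by `s i = g i j * s j`. -/
structure LineCocycle (E : Type*) [NormedAddCommGroup E] [NormedSpace ℂ E]
    (X : Type*) [TopologicalSpace X] [ChartedSpace E X] (ι : Type*) where
  dom : ι → Opens X
  covers : ∀ x, ∃ i, x ∈ dom i
  g : ∀ i j, holFun E (dom i ⊓ dom j)
  g_ne_zero : ∀ i j x, (g i j).1 x ≠ 0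
  g_mul : ∀ i j k x (hi : x ∈ dom i) (hj : x ∈ dom j) (hk : x ∈ dom k),
    (g i k).1 ⟨x, hi, hk⟩ = (g i j).1 ⟨x, hi, hj⟩ * (g j k).1 ⟨x, hj, hk⟩

/-- The transition functions of a holomorphic line bundle with respect to the trivializations in
its atlas. -/
def lineCocycle {E : Type*} [NormedAddCommGroup E] [NormedSpace ℂ E]
    {X : Type*} [TopologicalSpace X] [ChartedSpace E X]
    (L : X → Type*) [∀ x, AddCommGroup (L x)] [∀ x, Module ℂ (L x)]
    [∀ x, TopologicalSpace (L x)] [TopologicalSpace (TotalSpace ℂ L)]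
    [FiberBundle ℂ L] [VectorBundle ℂ ℂ L] [ContMDiffVectorBundle ω ℂ L 𝓘(ℂ, E)] :
    LineCocycle E X {e : Trivialization ℂ (π ℂ L) // MemTrivializationAtlas e} where
  dom e := ⟨e.1.baseSet, e.1.open_baseSet⟩
  covers x := ⟨⟨trivializationAt ℂ L x, inferInstance⟩, mem_baseSet_trivializationAt ℂ L x⟩
  g e e' := by
    haveI := e.2
    haveI := e'.2
    refine ⟨fun x => e'.1.coordChangeL ℂ e.1 x.1 (1 : ℂ), fun x => ?_⟩
    have h := contMDiffOn_coordChangeL (n := ω) (F := ℂ) (E := L) (IB := 𝓘(ℂ, E)) e'.1 e.1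
    have h' := h.contMDiffAt ((e'.1.open_baseSet.inter e.1.open_baseSet).mem_nhds
      ⟨x.2.2, x.2.1⟩)
    refine (contMDiffAt_subtype_iff (x := x)
      (f := fun y : X => (e'.1.coordChangeL ℂ e.1 y : ℂ →L[ℂ] ℂ) 1)).2 ?_
    exact h'.clm_apply contMDiffAt_const
  g_ne_zero e e' x := by
    have := e.2
    have := e'.2
    simp
  g_mul e e' e'' x h h' h'' := by
    have := e.2
    have := e'.2
    have := e''.2
    have h₁ : ∀ c : ℂ, e'.1.coordChangeL ℂ e.1 x c = c * e'.1.coordChangeL ℂ e.1 x (1 : ℂ) := by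
      intro c
      rw [← smul_eq_mul, ← map_smul, smul_eq_mul, mul_one]
    change e''.1.coordChangeL ℂ e.1 x (1 : ℂ)
      = e'.1.coordChangeL ℂ e.1 x (1 : ℂ) * e''.1.coordChangeL ℂ e'.1 x (1 : ℂ)
    rw [mul_comm, ← h₁, Trivialization.coordChangeL_apply _ _ ⟨h'', h⟩,
      Trivialization.coordChangeL_apply _ _ ⟨h', h⟩, Trivialization.coordChangeL_apply _ _ ⟨h'', h'⟩]
    exact congrArg (fun v => (e.1 ⟨x, v⟩).2) (e'.1.symm_apply_apply_mk h' _).symm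

/-! ### Twisted differential operators and smooth sections of `|L|²` -/

section Twisted

variable {E : Type*} [NormedAddCommGroup E] [NormedSpace ℂ E]
  {X : Type*} [TopologicalSpace X] [ChartedSpace E X] {ι : Type*} (C : LineCocycle E X ι)

/-- The transition function `g i j`, on the part of its domain that lies in `V`. -/
def LineCocycle.gOn (V : Opens X) (i j : ι) : holFun E (V ⊓ (C.dom i ⊓ C.dom j)) :=
  holRes inf_le_right (C.g i j)

theorem inf_left_le (V A B : Opens X) : V ⊓ (A ⊓ B) ≤ V ⊓ A := inf_le_inf_left V inf_le_left

theorem inf_right_le (V A B : Opens X) : V ⊓ (A ⊓ B) ≤ V ⊓ B := inf_le_inf_left V inf_le_right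

/-- `D_{X,L}(V) = (L ⊗ D_X ⊗ L⁻¹)(V)`: in the local frames `e i` of `L`, with `e j = g i j • e i`,
its elements are `e i ⊗ P i ⊗ (e i)⁻¹` with `P i * g i j = g i j * P j`. -/
def twistedDiffOp (V : Opens X) : Subalgebra ℂ (∀ i, DiffOp E (V ⊓ C.dom i)) where
  carrier := {P | ∀ i j,
    opRes (inf_left_le V _ _) (P i) * mulOp (C.gOn V i j)
      = mulOp (C.gOn V i j) * opRes (inf_right_le V _ _) (P j)}
  mul_mem' {P Q} hP hQ i j := by
    simp only [Pi.mul_apply, map_mul]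
    rw [mul_assoc, hQ i j, ← mul_assoc, hP i j, mul_assoc]
  add_mem' {P Q} hP hQ i j := by
    simp only [Pi.add_apply, map_add]
    rw [add_mul, mul_add, hP i j, hQ i j]
  algebraMap_mem' c i j := by
    simp only [Pi.algebraMap_apply, AlgHom.commutes]
    exact Algebra.commutes c _

/-- `D_{X,L}(V)`, as a type. -/
def TwDiffOp (V : Opens X) : Type _ := twistedDiffOp C V

instance (V : Opens X) : Ring (TwDiffOp C V) := inferInstanceAs (Ring (twistedDiffOp C V))

instance (V : Opens X) : Algebra ℂ (TwDiffOp C V) := inferInstanceAs (Algebra ℂ (twistedDiffOp C V))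

/-- Smooth sections over `V` of the bundle `|L|²`, whose transition functions are `|g i j|²`, as a
submodule of the families of local coordinates. -/
def normSqSections (V : Opens X) : Submodule ℂ (∀ i, SmoothFun E (V ⊓ C.dom i)) where
  carrier := {s | ∀ i j x (hx : x ∈ V) (hi : x ∈ C.dom i) (hj : x ∈ C.dom j),
    (s i).1 ⟨x, hx, hi⟩ = ((‖(C.g i j).1 ⟨x, hi, hj⟩‖ ^ 2 : ℝ) : ℂ) * (s j).1 ⟨x, hx, hj⟩}
  add_mem' {s t} hs ht i j x hx hi hj := by
    change (s i).1 _ + (t i).1 _ = _ * ((s j).1 _ + (t j).1 _)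
    rw [hs i j x hx hi hj, ht i j x hx hi hj, mul_add]
  zero_mem' i j x hx hi hj := (mul_zero _).symm
  smul_mem' c s hs i j x hx hi hj := by
    change c * (s i).1 _ = _ * (c * (s j).1 _)
    rw [hs i j x hx hi hj, mul_left_comm]

/-- `C^∞_{X,|L|²}(V)`, as a type. -/
def NormSqSec (V : Opens X) : Type _ := normSqSections C V

instance (V : Opens X) : AddCommGroup (NormSqSec C V) :=
  inferInstanceAs (AddCommGroup (normSqSections C V))

instance (V : Opens X) : Module ℂ (NormSqSec C V) :=
  inferInstanceAs (Module ℂ (normSqSections C V))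

variable {C}

/-- Restriction of twisted differential operators. -/
def twOpRes {W V : Opens X} (h : W ≤ V) : TwDiffOp C V →ₐ[ℂ] TwDiffOp C W where
  toFun P := ⟨fun i => opRes (inf_le_inf_right _ h) (P.1 i), fun i j =>
    congrArg (opRes (inf_le_inf_right (C.dom i ⊓ C.dom j) h)) (P.2 i j)⟩
  map_one' := rfl
  map_mul' _ _ := rfl
  map_zero' := rfl
  map_add' _ _ := rfl
  commutes' _ := rfl

/-- Restriction of smooth sections of `|L|²`. -/
def secRes {W V : Opens X} (h : W ≤ V) : NormSqSec C V →ₗ[ℂ] NormSqSec C W where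
  toFun s := ⟨fun i => res (inf_le_inf_right _ h) (s.1 i),
    fun i j x hx hi hj => s.2 i j x (h hx) hi hj⟩
  map_add' _ _ := rfl
  map_smul' _ _ := rfl

/-- The action of `D_{X,L}(V)` on the smooth sections of `|L|²` over `V`: the operator `P i` acts
on the coordinate `s i`. -/
def secAct {V : Opens X} (P : TwDiffOp C V) : Module.End ℂ (NormSqSec C V) where
  toFun s := ⟨fun i => opAct (P.1 i) (s.1 i), by
    intro i j x hx hi hj
    have key : ∀ (W : Opens X) (g : holFun E W) (Pi Pj : DiffOp E W) (a b : SmoothFun E W),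
        Pi * mulOp g = mulOp g * Pj →
        a = conjFun (toSmooth g) * (toSmooth g * b) →
        opAct Pi a = conjFun (toSmooth g) * (toSmooth g * opAct Pj b) := by
      intro W g Pi Pj a b h ha
      rw [ha, opAct_conj_mul]
      exact congrArg (fun T : DiffOp E W => conjFun (toSmooth g) * opAct T b) h
    have h₁ := key _ (C.gOn V i j) _ _ (res (inf_left_le V _ _) (s.1 i))
      (res (inf_right_le V _ _) (s.1 j)) (P.2 i j) (by
        refine Subtype.ext (funext fun y => ?_)
        refine (s.2 i j y.1 y.2.1 y.2.2.1 y.2.2.2).trans ?_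
        change _ = (starRingEnd ℂ) ((C.g i j).1 ⟨y.1, y.2.2⟩) * ((C.g i j).1 ⟨y.1, y.2.2⟩ * _)
        rw [← mul_assoc, ← Complex.normSq_eq_conj_mul_self, Complex.normSq_eq_norm_sq]
        rfl)
    rw [← opAct_res, ← opAct_res] at h₁
    have h₂ := congrFun (congrArg Subtype.val h₁) ⟨x, hx, hi, hj⟩
    refine h₂.trans ?_
    change (starRingEnd ℂ) ((C.g i j).1 ⟨x, hi, hj⟩) * ((C.g i j).1 ⟨x, hi, hj⟩ * _) = _
    rw [← mul_assoc, ← Complex.normSq_eq_conj_mul_self, Complex.normSq_eq_norm_sq]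
    rfl⟩
  map_add' s t := Subtype.ext (funext fun i => map_add (opAct (P.1 i)) (s.1 i) (t.1 i))
  map_smul' c s := Subtype.ext (funext fun i => map_smul (opAct (P.1 i)) c (s.1 i))

theorem secAct_res {W V : Opens X} (h : W ≤ V) (P : TwDiffOp C V) (s : NormSqSec C V) :
    secRes h (secAct P s) = secAct (twOpRes h P) (secRes h s) :=
  Subtype.ext (funext fun i => opAct_res (inf_le_inf_right _ h) (P.1 i) (s.1 i))

end Twisted

/-! ### Submersions -/

section Submersion

variable {EZ : Type*} [NormedAddCommGroup EZ] [NormedSpace ℂ EZ]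
  {EY : Type*} [NormedAddCommGroup EY] [NormedSpace ℂ EY]
  {Z : Type*} [TopologicalSpace Z] [ChartedSpace EZ Z]
  {Y : Type*} [TopologicalSpace Y] [ChartedSpace EY Y]
  {p : Z → Y}

theorem isOpenMap_of_isSubmersion (hp : IsSubmersion 𝓘(ℂ, EZ) 𝓘(ℂ, EY) ω p) : IsOpenMap p := by
  refine fun U hU => isOpen_iff_mem_nhds.2 ?_
  rintro _ ⟨z, hz, rfl⟩
  have h := hp.isSubmersionAt z
  have hA : IsOpen (h.domChart.source ∩ U) := h.domChart.open_source.inter hU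
  have hB := h.domChart.isOpen_image_of_subset_source hA Set.inter_subset_left
  have hC : IsOpen ((Prod.fst ∘ h.equiv) '' (h.domChart '' (h.domChart.source ∩ U))) :=
    (isOpenMap_fst.comp h.equiv.toHomeomorph.isOpenMap) _ hB
  have hE : ∀ w ∈ h.domChart.source, (Prod.fst ∘ h.equiv) (h.domChart w) = h.codChart (p w) := by
    intro w hw
    have hw' : h.domChart w ∈ (h.domChart.extend 𝓘(ℂ, EZ)).target := by
      simpa using h.domChart.map_source hw
    simpa [hw] using (h.writtenInCharts hw').symm
  have hD : IsOpen (h.codChart.source ∩ h.codChart ⁻¹'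
      ((Prod.fst ∘ h.equiv) '' (h.domChart '' (h.domChart.source ∩ U)))) :=
    h.codChart.isOpen_inter_preimage hC
  refine Filter.mem_of_superset (hD.mem_nhds ⟨h.mem_codChart_source, _,
    ⟨z, ⟨h.mem_domChart_source, hz⟩, rfl⟩, hE z h.mem_domChart_source⟩) ?_
  rintro y ⟨hy, _, ⟨w, hw, rfl⟩, hwy⟩
  rw [hE w hw.1] at hwy
  exact ⟨w, hw.2, h.codChart.injOn (h.source_subset_preimage_source hw.1) hy hwy⟩

theorem contMDiff_of_isSubmersion (hp : IsSubmersion 𝓘(ℂ, EZ) 𝓘(ℂ, EY) ω p) :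
    ContMDiff 𝓘(ℂ, EZ) 𝓘(ℂ, EY) ω p :=
  hp.isSubmersionOfComplement_complement.contMDiff

variable (hp : IsSubmersion 𝓘(ℂ, EZ) 𝓘(ℂ, EY) ω p)

/-- The open set `p(U)`. -/
def img (U : Opens Z) : Opens Y := ⟨p '' U, isOpenMap_of_isSubmersion hp U U.2⟩

/-- The open set `p⁻¹(V)`. -/
def preimg (V : Opens Y) : Opens Z := ⟨p ⁻¹' V, V.2.preimage (contMDiff_of_isSubmersion hp).continuous⟩

theorem img_mono {W U : Opens Z} (h : W ≤ U) : img hp W ≤ img hp U := Set.image_mono h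

theorem img_inf_le (U : Opens Z) (V : Opens Y) : img hp (U ⊓ preimg hp V) ≤ img hp U ⊓ V := by
  rintro _ ⟨z, hz, rfl⟩
  exact ⟨⟨z, hz.1, rfl⟩, hz.2⟩

theorem contMDiff_comp_restrict {𝕜 : Type*} [NontriviallyNormedField 𝕜]
    {E₁ : Type*} [NormedAddCommGroup E₁] [NormedSpace 𝕜 E₁] [ChartedSpace E₁ Z]
    {E₂ : Type*} [NormedAddCommGroup E₂] [NormedSpace 𝕜 E₂] [ChartedSpace E₂ Y]
    {F : Type*} [NormedAddCommGroup F] [NormedSpace 𝕜 F] {n : ℕ∞ω}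
    (hp : ContMDiff 𝓘(𝕜, E₁) 𝓘(𝕜, E₂) n p) {W : Opens Z} {V : Opens Y}
    (h : ∀ z ∈ W, p z ∈ V) {f : V → F} (hf : ContMDiff 𝓘(𝕜, E₂) 𝓘(𝕜, F) n f) :
    ContMDiff 𝓘(𝕜, E₁) 𝓘(𝕜, F) n (fun z : W => f ⟨p z.1, h z.1 z.2⟩) := by
  classical
  intro z
  let G : Y → F := fun y => if hy : y ∈ V then f ⟨y, hy⟩ else 0
  have hG : ∀ (y : Y) (hy : y ∈ V), G y = f ⟨y, hy⟩ := fun y hy => dif_pos hy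
  have h₁ : ContMDiffAt 𝓘(𝕜, E₂) 𝓘(𝕜, F) n G (p z.1) := by
    refine (contMDiffAt_subtype_iff (U := V) (x := ⟨p z.1, h z.1 z.2⟩)).1 ?_
    have : (fun y : V => G y.1) = f := funext fun y => hG y.1 y.2
    rw [this]
    exact hf _
  have h₂ := (contMDiffAt_subtype_iff (U := W) (x := z)).2 (h₁.comp z.1 (hp z.1))
  have : (fun w : W => (G ∘ p) w.1) = fun w : W => f ⟨p w.1, h w.1 w.2⟩ :=
    funext fun w => hG _ _
  rwa [this] at h₂

/-- Pull-back of smooth functions along `p : W → V`. -/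
def pullFun {W : Opens Z} {V : Opens Y} (h : ∀ z ∈ W, p z ∈ V) :
    SmoothFun EY V →ₐ[ℂ] SmoothFun EZ W where
  toFun f := ⟨fun z => f.1 ⟨p z.1, h z.1 z.2⟩, 
    contMDiff_comp_restrict (contMDiff_real_of_complex (contMDiff_of_isSubmersion hp)) h f.2⟩
  map_one' := rfl
  map_mul' _ _ := rfl
  map_zero' := rfl
  map_add' _ _ := rfl
  commutes' _ := rfl

/-- Pull-back of holomorphic functions along `p : W → V`. -/
def pullHol {W : Opens Z} {V : Opens Y} (h : ∀ z ∈ W, p z ∈ V) (f : holFun EY V) : holFun EZ W :=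
  ⟨fun z => f.1 ⟨p z.1, h z.1 z.2⟩,
    contMDiff_comp_restrict (contMDiff_of_isSubmersion hp) h f.2⟩

/-- The transition functions of the pull-back `p^*L`. -/
def LineCocycle.pullback {ι : Type*} (C : LineCocycle EY Y ι) : LineCocycle EZ Z ι where
  dom i := preimg hp (C.dom i)
  covers z := C.covers (p z)
  g i j := pullHol hp (fun _ h => h) (C.g i j)
  g_ne_zero i j _ := C.g_ne_zero i j _
  g_mul i j k z hi hj hk := C.g_mul i j k (p z) hi hj hk

/-! ### The transfer bimodule -/

/-- `Θ_{Z/Y}(U)`: the vertical holomorphic vector fields, that is, those that kill `p⁻¹(O_Y)`. -/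
def vertical (U : Opens Z) : Set (DiffOp EZ U) :=
  {ξ | ξ.1 ∈ holVectorField EZ U ∧
    ∀ (W : Set.Iic U) (V : Opens Y) (h : ∀ z ∈ W.1, p z ∈ V) (f : holFun EY V),
      ξ.1.1 W (toSmooth (pullHol hp h f)) = 0}

theorem opRes_mem_span {W U : Opens Z} (h : W ≤ U) {P : DiffOp EZ U}
    (hP : P ∈ Ideal.span (vertical hp U)) : opRes h P ∈ Ideal.span (vertical hp W) := by
  have h₁ := Ideal.mem_map_of_mem (opRes (E := EZ) h) hP
  rw [Ideal.map_span] at h₁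
  refine Ideal.span_mono ?_ h₁
  rintro _ ⟨ξ, hξ, rfl⟩
  exact ⟨⟨fun W' => hξ.1.1 ⟨W'.1, W'.2.trans h⟩, fun W' => hξ.1.2.1 ⟨W'.1, W'.2.trans h⟩,
    fun W' => hξ.1.2.2 ⟨W'.1, W'.2.trans h⟩⟩, fun W' => hξ.2 ⟨W'.1, W'.2.trans h⟩⟩

/-- The sections over `U` of the sheaf of left ideals `D_Z · Θ_{Z/Y}` (for a noncommutative ring,
`Ideal` means left ideal). -/
def vertIdeal (U : Opens Z) : Ideal (DiffOp EZ U) where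
  carrier := {P | ∀ z ∈ U, ∃ (W : Opens Z) (h : W ≤ U), z ∈ W ∧
    opRes h P ∈ Ideal.span (vertical hp W)}
  add_mem' {P Q} hP hQ z hz := by
    obtain ⟨W₁, h₁, hz₁, hP₁⟩ := hP z hz
    obtain ⟨W₂, h₂, hz₂, hQ₂⟩ := hQ z hz
    refine ⟨W₁ ⊓ W₂, inf_le_left.trans h₁, ⟨hz₁, hz₂⟩, ?_⟩
    rw [map_add]
    exact add_mem (opRes_mem_span hp (inf_le_left : W₁ ⊓ W₂ ≤ W₁) hP₁)
      (opRes_mem_span hp (inf_le_right : W₁ ⊓ W₂ ≤ W₂) hQ₂)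
  zero_mem' z hz := ⟨U, le_rfl, hz, by rw [map_zero]; exact zero_mem _⟩
  smul_mem' Q P hP z hz := by
    obtain ⟨W, h, hz', hP'⟩ := hP z hz
    refine ⟨W, h, hz', ?_⟩
    rw [smul_eq_mul, map_mul]
    exact Ideal.mul_mem_left _ _ hP'

/-- Families of differential operators on the open neighbourhoods of a point. -/
abbrev NhdFam (EZ : Type*) [NormedAddCommGroup EZ] [NormedSpace ℂ EZ]
    {Z : Type*} [TopologicalSpace Z] [ChartedSpace EZ Z] (z : Z) : Type _ :=
  ∀ W : {W : Opens Z // z ∈ W}, DiffOp EZ W.1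

/-- The families that belong to `D_Z · Θ_{Z/Y}` on all sufficiently small neighbourhoods. -/
def smallVert (z : Z) : Submodule (NhdFam EZ z) (NhdFam EZ z) where
  carrier := {t | ∃ W₀ : Opens Z, z ∈ W₀ ∧
    ∀ W : {W : Opens Z // z ∈ W}, W.1 ≤ W₀ → t W ∈ vertIdeal hp W.1}
  add_mem' := by
    rintro s t ⟨W₁, hz₁, h₁⟩ ⟨W₂, hz₂, h₂⟩
    exact ⟨W₁ ⊓ W₂, ⟨hz₁, hz₂⟩, fun W hW =>
      add_mem (h₁ W (hW.trans inf_le_left)) (h₂ W (hW.trans inf_le_right))⟩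
  zero_mem' := ⟨⊤, trivial, fun W _ => zero_mem _⟩
  smul_mem' := by
    rintro r t ⟨W₁, hz₁, h₁⟩
    exact ⟨W₁, hz₁, fun W hW => Ideal.mul_mem_left _ _ (h₁ W hW)⟩

/-- A module containing the stalk at `z` of `D_Z / (D_Z · Θ_{Z/Y})`: the stalk consists of the
elements `germ hp z P`, and `germ hp z P = germ hp z P'` means that `P` and `P'` agree modulo
`D_Z · Θ_{Z/Y}` near `z`. -/
def GermMod (z : Z) : Type _ := NhdFam EZ z ⧸ smallVert hp z

instance (z : Z) : AddCommGroup (GermMod hp z) :=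
  inferInstanceAs (AddCommGroup (NhdFam EZ z ⧸ smallVert hp z))

instance (z : Z) : Module (NhdFam EZ z) (GermMod hp z) :=
  inferInstanceAs (Module (NhdFam EZ z) (NhdFam EZ z ⧸ smallVert hp z))

open Classical in
/-- The family of restrictions of `P`. -/
def nhdFam (z : Z) {U : Opens Z} (P : DiffOp EZ U) : NhdFam EZ z :=
  fun W => if h : W.1 ≤ U then opRes h P else 0

/-- The class at `z` of a differential operator, modulo `D_Z · Θ_{Z/Y}`. -/
def germ (z : Z) {U : Opens Z} (P : DiffOp EZ U) : GermMod hp z :=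
  Submodule.Quotient.mk (nhdFam z P)

theorem germ_opRes (z : Z) {W U : Opens Z} (h : W ≤ U) (hz : z ∈ W) (P : DiffOp EZ U) :
    germ hp z (opRes h P) = germ hp z P := by
  refine (Submodule.Quotient.eq _).2 ⟨W, hz, fun W' hW' => ?_⟩
  have : (nhdFam z (opRes h P) - nhdFam z P) W' = 0 := by
    simp only [Pi.sub_apply, nhdFam, dif_pos hW', dif_pos (hW'.trans h)]
    exact sub_self _
  rw [this]
  exact zero_mem _

theorem germ_zero (z : Z) {U : Opens Z} : germ hp z (0 : DiffOp EZ U) = 0 := by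
  have : nhdFam z (0 : DiffOp EZ U) = 0 := by
    funext W
    simp [nhdFam]
  rw [germ, this]
  rfl

theorem germ_add (z : Z) {U : Opens Z} (hz : z ∈ U) (P Q : DiffOp EZ U) :
    germ hp z (P + Q) = germ hp z P + germ hp z Q := by
  refine (Submodule.Quotient.eq _).2 ⟨U, hz, fun W hW => ?_⟩
  have : (nhdFam z (P + Q) - (nhdFam z P + nhdFam z Q)) W = 0 := by
    simp only [Pi.sub_apply, Pi.add_apply, nhdFam, dif_pos hW, map_add, sub_self]
  rw [this]
  exact zero_mem _

theorem germ_mul (z : Z) {U : Opens Z} (hz : z ∈ U) (P Q : DiffOp EZ U) :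
    germ hp z (P * Q) = nhdFam z P • germ hp z Q := by
  refine (Submodule.Quotient.eq _).2 ⟨U, hz, fun W hW => ?_⟩
  have : (nhdFam z (P * Q) - nhdFam z P • nhdFam z Q) W = 0 := by
    simp only [Pi.sub_apply, smul_eq_mul, Pi.mul_apply, nhdFam, dif_pos hW, map_mul, sub_self]
  rw [this]
  exact zero_mem _

/-- Two families that agree on all small neighbourhoods act in the same way. -/
theorem nhdFam_smul_congr (z : Z) {U : Opens Z} (hz : z ∈ U) {r s : NhdFam EZ z}
    (h : ∀ W : {W : Opens Z // z ∈ W}, W.1 ≤ U → r W = s W) (m : GermMod hp z) :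
    r • m = s • m := by
  obtain ⟨t, rfl⟩ := Submodule.Quotient.mk_surjective _ m
  refine (Submodule.Quotient.eq _).2 ⟨U, hz, fun W hW => ?_⟩
  have : (r • t - s • t) W = 0 := by
    simp only [Pi.sub_apply, smul_eq_mul, Pi.mul_apply, h W hW, sub_self]
  rw [this]
  exact zero_mem _

/-- `D_Z(U)` acts on the stalks at the points of `U`. -/
instance germModule {U : Opens Z} (z : U) : Module (DiffOp EZ U) (GermMod hp z.1) where
  smul P m := nhdFam z.1 P • m
  one_smul m := (nhdFam_smul_congr hp z.1 z.2 (s := 1)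
    (fun W hW => by simp only [nhdFam, dif_pos hW, map_one]; rfl) m).trans (one_smul _ m)
  mul_smul P Q m := (nhdFam_smul_congr hp z.1 z.2 (s := nhdFam z.1 P * nhdFam z.1 Q)
    (fun W hW => by simp only [nhdFam, dif_pos hW, map_mul, Pi.mul_apply]) m).trans (mul_smul _ _ m)
  smul_zero P := smul_zero (nhdFam z.1 P)
  smul_add P m n := smul_add (nhdFam z.1 P) m n
  add_smul P Q m := (nhdFam_smul_congr hp z.1 z.2 (s := nhdFam z.1 P + nhdFam z.1 Q)
    (fun W hW => by simp only [nhdFam, dif_pos hW, map_add, Pi.add_apply]) m).trans (add_smul _ _ m)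
  zero_smul m := (nhdFam_smul_congr hp z.1 z.2 (s := 0)
    (fun W hW => by simp only [nhdFam, dif_pos hW, map_zero]; rfl) m).trans (zero_smul _ m)

theorem smul_germ {U : Opens Z} (z : U) (P : DiffOp EZ U) {W : Opens Z} (h : W ≤ U)
    (hz : z.1 ∈ W) (Q : DiffOp EZ W) :
    P • germ hp z.1 Q = germ hp z.1 (opRes h P * Q) := by
  rw [germ_mul hp z.1 hz]
  exact nhdFam_smul_congr hp z.1 hz
    (fun W' hW' => by simp only [nhdFam, dif_pos hW', dif_pos (hW'.trans h)]; rfl) _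

/-- `m` is represented by the operator `R` on `W`. -/
def Represents {U W : Opens Z} (h : W ≤ U) (R : DiffOp EZ W) (m : ∀ z : U, GermMod hp z.1) :
    Prop :=
  ∀ (z : Z) (hz : z ∈ W), m ⟨z, h hz⟩ = germ hp z R

variable {hp} in
theorem Represents.mono {U W W' : Opens Z} {h : W ≤ U} {R : DiffOp EZ W}
    {m : ∀ z : U, GermMod hp z.1} (hm : Represents hp h R m) (h' : W' ≤ W) :
    Represents hp (h'.trans h) (opRes h' R) m :=
  fun z hz => (hm z (h' hz)).trans (germ_opRes hp z h' hz R).symm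

variable {hp} in
theorem Represents.add {U W : Opens Z} {h : W ≤ U} {R S : DiffOp EZ W}
    {m n : ∀ z : U, GermMod hp z.1} (hm : Represents hp h R m) (hn : Represents hp h S n) :
    Represents hp h (R + S) (m + n) := fun z hz => by
  rw [germ_add hp z hz, ← hm z hz, ← hn z hz]
  rfl

variable {hp} in
theorem Represents.smul {U W : Opens Z} {h : W ≤ U} {R : DiffOp EZ W}
    {m : ∀ z : U, GermMod hp z.1} (hm : Represents hp h R m) (P : DiffOp EZ U) :
    Represents hp h (opRes h P * R) (P • m) := fun z hz => by
  rw [← smul_germ hp ⟨z, h hz⟩ P h hz R, ← hm z hz]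
  rfl

/-- `D_{Z→Y}(U)`: the sections over `U` of the quotient sheaf `D_Z / (D_Z · Θ_{Z/Y})`, as functions
with values in the stalks that are locally represented by differential operators. It is a left
module over `D_Z(U)`. -/
def transfer (U : Opens Z) : Submodule (DiffOp EZ U) (∀ z : U, GermMod hp z.1) where
  carrier := {m | ∀ z ∈ U, ∃ (W : Opens Z) (h : W ≤ U), z ∈ W ∧
    ∃ R : DiffOp EZ W, Represents hp h R m}
  add_mem' {m n} hm hn z hz := by
    obtain ⟨W₁, h₁, hz₁, R₁, hR₁⟩ := hm z hz
    obtain ⟨W₂, h₂, hz₂, R₂, hR₂⟩ := hn z hz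
    exact ⟨W₁ ⊓ W₂, inf_le_left.trans h₁, ⟨hz₁, hz₂⟩, _,
      (hR₁.mono inf_le_left).add (hR₂.mono inf_le_right)⟩
  zero_mem' z hz := ⟨U, le_rfl, hz, 0, fun z _ => (germ_zero hp z).symm⟩
  smul_mem' P m hm z hz := by
    obtain ⟨W, h, hz', R, hR⟩ := hm z hz
    exact ⟨W, h, hz', _, hR.smul P⟩

/-- `D_{Z→Y}(U)`, as a type. -/
def Transfer (U : Opens Z) : Type _ := transfer hp U

instance (U : Opens Z) : AddCommGroup (Transfer hp U) :=
  inferInstanceAs (AddCommGroup (transfer hp U))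

instance (U : Opens Z) : Module (DiffOp EZ U) (Transfer hp U) :=
  inferInstanceAs (Module (DiffOp EZ U) (transfer hp U))

variable {hp}

/-- Restriction of sections of `D_{Z→Y}`. -/
def trRes {W U : Opens Z} (h : W ≤ U) (m : Transfer hp U) : Transfer hp W :=
  ⟨fun z => m.1 ⟨z.1, h z.2⟩, fun z hz => by
    obtain ⟨W₁, h₁, hz₁, R, hR⟩ := m.2 z (h hz)
    exact ⟨W ⊓ W₁, inf_le_left, ⟨hz, hz₁⟩, opRes inf_le_right R,
      fun w hw => hR.mono (inf_le_right : W ⊓ W₁ ≤ W₁) w hw⟩⟩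

theorem trRes_smul {W U : Opens Z} (h : W ≤ U) (P : DiffOp EZ U) (m : Transfer hp U) :
    trRes h (P • m) = opRes h P • trRes h m :=
  Subtype.ext (funext fun z => nhdFam_smul_congr hp z.1 z.2
    (fun W' hW' => by simp only [nhdFam, dif_pos hW', dif_pos (hW'.trans h)]; rfl) _)

/-- `m' = m · S`, where the differential operator `S` acts on the right by multiplication of the
representatives: locally `m = [R]` and `m' = [R * S]`. -/
def IsRightMulOp {U : Opens Z} (S : DiffOp EZ U) (m m' : Transfer hp U) : Prop :=
  ∀ z ∈ U, ∃ (W : Opens Z) (h : W ≤ U), z ∈ W ∧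
    ∃ R : DiffOp EZ W, Represents hp h R m.1 ∧ Represents hp h (R * opRes h S) m'.1

theorem IsRightMulOp.res {W U : Opens Z} (h : W ≤ U) {S P : DiffOp EZ U} {m n : Transfer hp U}
    (hm : IsRightMulOp S m (P • n)) :
    IsRightMulOp (opRes h S) (trRes h m) (opRes h P • trRes h n) := by
  rw [← trRes_smul]
  intro z hz
  obtain ⟨W₁, h₁, hz₁, R, hR, hR'⟩ := hm z (h hz)
  exact ⟨W ⊓ W₁, inf_le_left, ⟨hz, hz₁⟩, opRes inf_le_right R,
    fun w hw => hR.mono (inf_le_right : W ⊓ W₁ ≤ W₁) w hw,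
    fun w hw => hR'.mono (inf_le_right : W ⊓ W₁ ≤ W₁) w hw⟩

theorem IsRightMulOp.add {U : Opens Z} {S : DiffOp EZ U} {m m' n n' : Transfer hp U}
    (hm : IsRightMulOp S m m') (hn : IsRightMulOp S n n') :
    IsRightMulOp S (m + n) (m' + n') := by
  intro z hz
  obtain ⟨W₁, h₁, hz₁, R₁, hR₁, hR₁'⟩ := hm z hz
  obtain ⟨W₂, h₂, hz₂, R₂, hR₂, hR₂'⟩ := hn z hz
  refine ⟨W₁ ⊓ W₂, inf_le_left.trans h₁, ⟨hz₁, hz₂⟩, opRes inf_le_left R₁ + opRes inf_le_right R₂,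
    (hR₁.mono inf_le_left).add (hR₂.mono inf_le_right), ?_⟩
  rw [add_mul]
  exact (hR₁'.mono inf_le_left).add (hR₂'.mono inf_le_right)

theorem IsRightMulOp.smul {U : Opens Z} {S : DiffOp EZ U} {m m' : Transfer hp U}
    (hm : IsRightMulOp S m m') (P : DiffOp EZ U) : IsRightMulOp S (P • m) (P • m') := by
  intro z hz
  obtain ⟨W, h, hz, R, hR, hR'⟩ := hm z hz
  refine ⟨W, h, hz, opRes h P * R, hR.smul P, ?_⟩
  rw [mul_assoc]
  exact hR'.smul P

theorem isRightMulOp_zero {U : Opens Z} (S : DiffOp EZ U) : IsRightMulOp (hp := hp) S 0 0 := by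
  intro z hz
  have h0 : Represents hp (le_refl U) 0 (0 : Transfer hp U).1 := fun z _ => (germ_zero hp z).symm
  refine ⟨U, le_rfl, hz, 0, h0, ?_⟩
  rw [zero_mul]
  exact h0

variable (hp)

/-- The operator `S` on `W ⊆ Z` lifts the operator `Q` on `V ⊆ Y`, where `p(W) ⊆ V`:
`S (f ∘ p) = (Q f) ∘ p` for the local holomorphic functions `f` on `V`. -/
def IsLift {W : Opens Z} {V : Opens Y} (S : DiffOp EZ W) (Q : DiffOp EY V) : Prop :=
  ∀ (W' : Set.Iic W) (V' : Set.Iic V) (h : ∀ z ∈ W'.1, p z ∈ V'.1) (f : holFun EY V'.1),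
    S.1.1 W' (toSmooth (pullHol hp h f)) = pullFun hp h (Q.1.1 V' (toSmooth f))

variable {hp}

/-- `m' = m · Q`, where `Q` is a differential operator on an open set `V ⊇ p(U)` of `Y`. This is the
right action of `p⁻¹(D_Y)` on `D_Z / (D_Z · Θ_{Z/Y})` that comes from the identification of
`p⁻¹(D_Y)` with the invariants of `Θ_{Z/Y}` in `D_Z / (D_Z · Θ_{Z/Y})`: locally `m = [R]` and
`m' = [R * S]`, where `S` is a lift of `Q`. -/
def IsRightMul {U : Opens Z} {V : Opens Y} (Q : DiffOp EY V) (m m' : Transfer hp U) : Prop :=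
  ∀ z ∈ U, ∃ (W : Opens Z) (h : W ≤ U), z ∈ W ∧
    ∃ S : DiffOp EZ W, IsLift hp S Q ∧ IsRightMulOp S (trRes h m) (trRes h m')

/-! ### The twisted transfer bimodule -/

variable {ι : Type*} (C : LineCocycle EY Y ι) (hp)

/-- `D_{Z,p^*L}(U)` acts on families of local sections of `D_{Z→Y}`, frame by frame. -/
instance (U : Opens Z) : Module (TwDiffOp (C.pullback hp) U)
    (∀ i, Transfer hp (U ⊓ (C.pullback hp).dom i)) where
  smul P m i := P.1 i • m i
  one_smul m := funext fun i => one_smul (DiffOp EZ (U ⊓ (C.pullback hp).dom i)) (m i)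
  mul_smul P Q m := funext fun i => mul_smul (P.1 i) (Q.1 i) (m i)
  smul_zero P := funext fun i => smul_zero (P.1 i)
  smul_add P m n := funext fun i => smul_add (P.1 i) (m i) (n i)
  add_smul P Q m := funext fun i => add_smul (P.1 i) (Q.1 i) (m i)
  zero_smul m := funext fun i => zero_smul (DiffOp EZ (U ⊓ (C.pullback hp).dom i)) (m i)

/-- `D_{Z→Y,L}(U) = (p^*L ⊗ D_{Z→Y} ⊗ p⁻¹L⁻¹)(U)`: in the local frames `e i` of `L`, with
`e j = g i j • e i`, its elements are `e i ⊗ m i ⊗ (e i)⁻¹` with `m i · g i j = g i j • m j`. It is a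
left module over `D_{Z,p^*L}(U)`. -/
def twistedTransfer (U : Opens Z) : Submodule (TwDiffOp (C.pullback hp) U)
    (∀ i, Transfer hp (U ⊓ (C.pullback hp).dom i)) where
  carrier := {m | ∀ i j, IsRightMulOp (mulOp ((C.pullback hp).gOn U i j))
    (trRes (inf_left_le U _ _) (m i))
    (mulOp ((C.pullback hp).gOn U i j) • trRes (inf_right_le U ((C.pullback hp).dom i) _) (m j))}
  add_mem' {m n} hm hn i j := by
    have h := (hm i j).add (hn i j)
    rw [← smul_add] at h
    exact h
  zero_mem' i j := by
    have h : IsRightMulOp (mulOp ((C.pullback hp).gOn U i j)) 0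
        (mulOp ((C.pullback hp).gOn U i j) • (0 : Transfer hp _)) := by
      rw [smul_zero]
      exact isRightMulOp_zero _
    exact h
  smul_mem' P m hm i j := by
    have h := (hm i j).smul (opRes (inf_left_le U _ _) (P.1 i))
    rw [smul_smul, P.2 i j, mul_smul, ← trRes_smul, ← trRes_smul] at h
    exact h

/-- `D_{Z→Y,L}(U)`, as a type. -/
def TwTransfer (U : Opens Z) : Type _ := twistedTransfer hp C U

instance (U : Opens Z) : AddCommGroup (TwTransfer hp C U) :=
  inferInstanceAs (AddCommGroup (twistedTransfer hp C U))

instance (U : Opens Z) : Module (TwDiffOp (C.pullback hp) U) (TwTransfer hp C U) :=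
  inferInstanceAs (Module (TwDiffOp (C.pullback hp) U) (twistedTransfer hp C U))

variable {hp C}

/-- Restriction of sections of `D_{Z→Y,L}`. -/
def twTrRes {W U : Opens Z} (h : W ≤ U) (m : TwTransfer hp C U) : TwTransfer hp C W :=
  ⟨fun i => trRes (inf_le_inf_right _ h) (m.1 i), fun i j =>
    (m.2 i j).res (inf_le_inf_right _ h)⟩

/-- `m' = m · Q` for `Q ∈ D_{Y,L}(p(U))`: in each frame, `m' i = m i · Q i`. -/
def IsTwRightMul {U : Opens Z} (Q : TwDiffOp C (img hp U)) (m m' : TwTransfer hp C U) : Prop :=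
  ∀ i, IsRightMul (Q.1 i) (m.1 i) (m'.1 i)

variable (hp C)

/-- The section `1_{Z→Y,L}` of `D_{Z→Y,L}`, equal to the class of `1` in each frame. -/
def twOne : TwTransfer hp C ⊤ :=
  ⟨fun i => ⟨fun z => germ hp z.1 (1 : DiffOp EZ (⊤ ⊓ (C.pullback hp).dom i)),
    fun _ hz => ⟨_, le_rfl, hz, 1, fun _ _ => rfl⟩⟩, by
    intro i j z hz
    refine ⟨_, le_rfl, hz, 1, fun w hw => ?_, fun w hw => ?_⟩
    · exact (germ_opRes hp w (inf_left_le _ _ _) hw 1).symm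
    · have h₁ := congrArg (fun a => nhdFam w (mulOp ((C.pullback hp).gOn ⊤ i j)) • a)
        (germ_opRes hp w (inf_right_le ⊤ ((C.pullback hp).dom i) ((C.pullback hp).dom j)) hw 1).symm
      refine h₁.trans ((germ_mul hp w hw _ _).symm.trans ?_)
      rw [map_one, mul_one, one_mul]
      rfl⟩

/-! ### The sheaf of homomorphisms -/

/-- Sections over `U` of the internal `Hom` from `p⁻¹(C^∞_{Y,|L|²})` to `C^∞_{Z,|p^*L|²}`:
compatible systems of linear maps from the sections over `p(W)` to the sections over `W`, for
`W ⊆ U` open. -/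
def homSections (U : Opens Z) : Submodule ℂ
    (∀ W : Set.Iic U, NormSqSec C (img hp W.1) →ₗ[ℂ] NormSqSec (C.pullback hp) W.1) where
  carrier := {φ | ∀ (W W' : Set.Iic U) (h : W'.1 ≤ W.1) (s : NormSqSec C (img hp W.1)),
    secRes h (φ W s) = φ W' (secRes (img_mono hp h) s)}
  add_mem' {φ ψ} hφ hψ W W' h s := by
    change secRes h (φ W s + ψ W s) = φ W' _ + ψ W' _
    rw [map_add, hφ W W' h, hψ W W' h]
  zero_mem' W W' h s := map_zero _
  smul_mem' c φ hφ W W' h s := by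
    change secRes h (c • φ W s) = c • φ W' _
    rw [map_smul, hφ W W' h]

/-- Sections over `U` of the internal `Hom` sheaf, as a type. -/
def HomSec (U : Opens Z) : Type _ := homSections hp C U

instance (U : Opens Z) : AddCommGroup (HomSec hp C U) :=
  inferInstanceAs (AddCommGroup (homSections hp C U))

/-- The left action `P ∘ φ` of `D_{Z,p^*L}(U)`. -/
instance (U : Opens Z) : Module (TwDiffOp (C.pullback hp) U) (HomSec hp C U) where
  smul P φ := ⟨fun W => secAct (twOpRes W.2 P) ∘ₗ φ.1 W, fun W W' h s =>
    (secAct_res h (twOpRes W.2 P) (φ.1 W s)).trans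
      (congrArg (secAct (twOpRes W'.2 P)) (φ.2 W W' h s))⟩
  one_smul _ := rfl
  mul_smul _ _ _ := rfl
  smul_zero _ := Subtype.ext (funext fun _ => LinearMap.comp_zero _)
  smul_add _ _ _ := Subtype.ext (funext fun _ => LinearMap.comp_add _ _ _)
  add_smul _ _ _ := rfl
  zero_smul _ := rfl

variable {hp C}

/-- Restriction of sections of the `Hom` sheaf. -/
def homRes {W U : Opens Z} (h : W ≤ U) (φ : HomSec hp C U) : HomSec hp C W :=
  ⟨fun W' => φ.1 ⟨W'.1, W'.2.trans h⟩,
    fun W₁ W₂ h' s => φ.2 ⟨W₁.1, W₁.2.trans h⟩ ⟨W₂.1, W₂.2.trans h⟩ h' s⟩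

/-- The right action `φ ∘ Q` of `D_{Y,L}(p(U))`. -/
def homRightMul {U : Opens Z} (φ : HomSec hp C U) (Q : TwDiffOp C (img hp U)) :
    HomSec hp C U :=
  ⟨fun W => φ.1 W ∘ₗ secAct (twOpRes (img_mono hp W.2) Q), fun W W' h s =>
    (φ.2 W W' h _).trans (congrArg (φ.1 W')
      (secAct_res (img_mono hp h) (twOpRes (img_mono hp W.2) Q) s))⟩

variable (hp C)

/-- The pull-back of smooth sections of `|L|²`, as a global section of the `Hom` sheaf. -/
def pullSec : HomSec hp C ⊤ :=
  ⟨fun W =>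
    { toFun := fun s => ⟨fun i => pullFun hp (W := W.1 ⊓ (C.pullback hp).dom i)
        (V := img hp W.1 ⊓ C.dom i) (fun z hz => ⟨⟨z, hz.1, rfl⟩, hz.2⟩) (s.1 i),
        fun i j z hz hi hj => s.2 i j (p z) ⟨z, hz, rfl⟩ hi hj⟩
      map_add' := fun _ _ => rfl
      map_smul' := fun _ _ => rfl },
    fun _ _ _ _ => rfl⟩

/-- Homomorphisms of sheaves of `(D_{Z,p^*L}, p⁻¹(D_{Y,L}))`-bimodules from `D_{Z→Y,L}` to the `Hom`
sheaf: families of left linear maps that commute with restriction and with the right actions. (The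
sections of `p⁻¹(D_{Y,L})` are locally given by sections of `D_{Y,L}` over the sets `p(U)`.) -/
structure BimoduleHom where
  app : ∀ U : Opens Z, TwTransfer hp C U →ₗ[TwDiffOp (C.pullback hp) U] HomSec hp C U
  app_res : ∀ {W U : Opens Z} (h : W ≤ U) (m : TwTransfer hp C U),
    app W (twTrRes h m) = homRes h (app U m)
  app_right : ∀ {U : Opens Z} (Q : TwDiffOp C (img hp U)) (m m' : TwTransfer hp C U),
    IsTwRightMul Q m m' → app U m' = homRightMul (app U m) Q

end Submersion

end HolDiff
end

noncomputable section

set_option linter.unusedSectionVars false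

namespace HolDiff

/-! ### Hadamard's lemma and Wirtinger derivatives -/

section Calculus

/-! The homomorphism is the evident action: the class of an operator `R` sends `f` to `R (f ∘ p)`,
frame by frame. Everything rests on two facts about a holomorphic operator on `Z`, proved in charts
where `p` is a linear projection with base coordinates `y`. First, the left ideal `D_Z · Θ_{Z/Y}`
kills every smooth function pulled back from `Y` (`vertIdeal_pullFun`). Vertical fields are only
required to kill holomorphic pull-backs, but a holomorphic field is the combination of coordinate
derivatives with coefficients its values on the coordinates. This follows from Hadamard's lemma for
smooth functions in `z` and its conjugate, since a derivation that kills both sets of coordinates is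
zero. For a vertical field the coefficients along the base therefore vanish.

Second, an operator that kills all holomorphic pull-backs lies in that ideal
(`mem_vertIdeal_of_kills`). Modulo vertical fields it is a sum of terms `a_β ∂_y^β`. Applied to `exp
(∑ cᵢ yᵢ)`, this sum multiplies the exponential by the polynomial `∑ a_β(z) c^β`; this vanishes for
all `c`, so every `a_β` is zero.

Hence a section of the transfer module is determined by its action on pulled-back holomorphic
functions, and right multiplication by `Q` becomes precomposition with `Q`. The second fact, applied
to the difference of two lifts, shows that a lift of `Q` tested on holomorphic functions also lifts
it on smooth ones. Local lifts exist in adapted charts, and identities between bimodule sections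
reduce to identities between actions on functions.

For the twist, write `|g|²` as the product of `g` and its conjugate: operators commute with the
conjugate factor, and the frame condition of `D_{Z→Y,L}` accounts for `g`. Injectivity follows by
extending a test function in one frame to a section of `|L|²`. Uniqueness holds because `1_{Z→Y,L}`
generates `D_{Z→Y,L}` locally as a left module. -/

theorem exists_contDiff_eventuallyEq {E : Type*} [NormedAddCommGroup E] [NormedSpace ℝ E]
    [FiniteDimensional ℝ E] {F : Type*} [NormedAddCommGroup F] [NormedSpace ℝ F]
    {f : E → F} {s : Set E} {x₀ : E} (hs : s ∈ 𝓝 x₀) (hf : ContDiffOn ℝ ∞ f s) :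
    ∃ g : E → F, ContDiff ℝ ∞ g ∧ g =ᶠ[𝓝 x₀] f := by
  obtain ⟨r, hr, hrs⟩ := Metric.mem_nhds_iff.1 hs
  -- The support is the closed ball of radius `r / 2`, inside the ball of radius `r` where `f` is
  -- smooth, so extending the product by zero is smooth. A function defined everywhere is wanted
  -- because Hadamard's formula integrates along segments from `x₀`.
  let φ : ContDiffBump x₀ := ⟨r / 4, r / 2, by positivity, by linarith⟩
  refine ⟨fun x => φ x • f x, ?_, ?_⟩
  · rw [contDiff_iff_contDiffAt]
    intro x
    by_cases hx : x ∈ Metric.ball x₀ r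
    · exact φ.contDiff.contDiffAt.smul (hf.contDiffAt
        (Filter.mem_of_superset (Metric.isOpen_ball.mem_nhds hx) hrs))
    · have hx' : x ∉ tsupport φ := by
        rw [φ.tsupport_eq]
        intro h
        have h1 : dist x x₀ ≤ r / 2 := h
        exact hx (Metric.mem_ball.2 (by linarith))
      have : (fun x => φ x • f x) =ᶠ[𝓝 x] fun _ => 0 := by
        filter_upwards [notMem_tsupport_iff_eventuallyEq.1 hx'] with y hy
        rw [hy]
        exact zero_smul ℝ _
      exact contDiffAt_const.congr_of_eventuallyEq this
  · filter_upwards [φ.eventuallyEq_one] with x hx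
    rw [hx]
    exact one_smul ℝ _

/-- Hadamard's lemma. -/
theorem exists_hadamard {E : Type*} [NormedAddCommGroup E] [NormedSpace ℝ E]
    [FiniteDimensional ℝ E] {F : Type*} [NormedAddCommGroup F] [NormedSpace ℝ F] [CompleteSpace F]
    {f : E → F} {s : Set E} {x₀ : E} (hs : s ∈ 𝓝 x₀) (hf : ContDiffOn ℝ ∞ f s) :
    ∃ G : E → E →L[ℝ] F, ContDiff ℝ ∞ G ∧ ∀ᶠ x in 𝓝 x₀, f x = f x₀ + G x (x - x₀) := by
  obtain ⟨g, hg, hgf⟩ := exists_contDiff_eventuallyEq hs hf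
  -- This cut-off equals 1 wherever the integrand below is used; it only gives the kernel compact
  -- support in `t`.
  let φ : ContDiffBump (0 : ℝ) := ⟨2, 3, by norm_num, by norm_num⟩
  let χ : ℝ → ℝ := (Set.Icc (0 : ℝ) 1).indicator fun _ => 1
  let h : E → ℝ → E →L[ℝ] F := fun x t => φ t • fderiv ℝ g (x₀ + (-t) • (x - x₀))
  -- This is the integral over `[0, 1]` of the derivative of `g` along the segment from `x₀` to `x`,
  -- written as a convolution at `0` so that smoothness in `x` comes from the theorem on
  -- convolutions with a parameter. The sign in `-t` compensates the argument `0 - t` of the kernel.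
  let G : E → E →L[ℝ] F := fun x => MeasureTheory.convolution χ (h x)
    (ContinuousLinearMap.lsmul ℝ ℝ) MeasureTheory.volume 0
  have hχ : MeasureTheory.LocallyIntegrable χ :=
    ((MeasureTheory.integrable_indicator_iff measurableSet_Icc).2
      (MeasureTheory.integrableOn_const (by simp))).locallyIntegrable
  have hdg : ContDiff ℝ ∞ (fderiv ℝ g) := hg.fderiv_right (by simp)
  have hG : ContDiff ℝ ∞ G := by
    have := MeasureTheory.contDiffOn_convolution_right_with_param_comp (n := (⊤ : ℕ∞)) (μ := MeasureTheory.volume)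
      (ContinuousLinearMap.lsmul ℝ ℝ) (s := (Set.univ : Set E)) (v := fun _ => (0 : ℝ)) (f := χ)
      (g := h) (k := Metric.closedBall (0 : ℝ) 3) contDiffOn_const isOpen_univ
      (isCompact_closedBall _ _) (fun x t _ ht => ?_) hχ ?_
    · exact contDiffOn_univ.1 this
    · have : φ t = 0 := φ.zero_of_le_dist (le_of_lt (by simpa using ht))
      simp only [h, this, zero_smul]
    · refine ContDiff.contDiffOn ?_
      have h1 : ContDiff ℝ ∞ fun q : E × ℝ => φ q.2 := φ.contDiff.comp contDiff_snd
      refine h1.smul (hdg.comp ?_)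
      fun_prop
  refine ⟨G, hG, ?_⟩
  have key : ∀ x, G x (x - x₀) = g x - g x₀ := by
    intro x
    have hc : Continuous fun t : ℝ => fderiv ℝ g (x₀ + t • (x - x₀)) :=
      hdg.continuous.comp (by fun_prop)
    have h1 : G x = ∫ t in (0 : ℝ)..1, fderiv ℝ g (x₀ + t • (x - x₀)) := by
      rw [intervalIntegral.integral_of_le zero_le_one, ← MeasureTheory.integral_Icc_eq_integral_Ioc,
        ← MeasureTheory.integral_indicator measurableSet_Icc]
      change ∫ t, _ = _
      congr 1
      funext t
      by_cases ht : t ∈ Set.Icc (0 : ℝ) 1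
      · have : φ (0 - t) = 1 := φ.one_of_mem_closedBall (by
          rw [Metric.mem_closedBall, dist_zero_right, zero_sub, norm_neg, Real.norm_eq_abs,
            abs_of_nonneg ht.1]
          exact ht.2.trans (by norm_num [φ]))
        simp only [ContinuousLinearMap.lsmul_apply, χ, h, Set.indicator_of_mem ht, this, one_smul]
        rw [zero_sub, neg_neg]
      · simp only [ContinuousLinearMap.lsmul_apply, χ, Set.indicator_of_notMem ht, zero_smul]
    rw [h1, ContinuousLinearMap.intervalIntegral_apply (hc.intervalIntegrable _ _)]
    have h2 : ∀ t ∈ Set.uIcc (0 : ℝ) 1, HasDerivAt (fun t : ℝ => g (x₀ + t • (x - x₀)))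
        (fderiv ℝ g (x₀ + t • (x - x₀)) (x - x₀)) t := by
      intro t _
      have hl : HasDerivAt (fun t : ℝ => x₀ + t • (x - x₀)) (x - x₀) t := by
        simpa using ((hasDerivAt_id t).smul_const (x - x₀)).const_add x₀
      exact ((hg.differentiable (by simp) _).hasFDerivAt).comp_hasDerivAt t hl
    rw [intervalIntegral.integral_eq_sub_of_hasDerivAt h2
      ((hc.clm_apply continuous_const).intervalIntegrable _ _)]
    simp
  filter_upwards [hgf] with x hx
  rw [key, ← hx, hgf.eq_of_nhds]
  abel

variable {E : Type*} [NormedAddCommGroup E] [NormedSpace ℂ E]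

/-- The derivative of type `(1, 0)` of `F` in the direction `v`. -/
def wirt (v : E) (F : E → ℂ) (u : E) : ℂ :=
  (1 / 2) * (fderiv ℝ F u v - Complex.I * fderiv ℝ F u (Complex.I • v))

theorem _root_.Filter.EventuallyEq.wirt_eq {v : E} {F G : E → ℂ} {u : E} (h : F =ᶠ[𝓝 u] G) :
    wirt v F u = wirt v G u := by
  rw [wirt, wirt, h.fderiv_eq]

theorem wirt_add (v : E) {F G : E → ℂ} {u : E} (hF : DifferentiableAt ℝ F u)
    (hG : DifferentiableAt ℝ G u) : wirt v (F + G) u = wirt v F u + wirt v G u := by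
  simp only [wirt, fderiv_add hF hG, add_apply]
  ring

theorem wirt_const_mul (v : E) (c : ℂ) {F : E → ℂ} {u : E} (hF : DifferentiableAt ℝ F u) :
    wirt v (c • F) u = c * wirt v F u := by
  simp only [wirt, fderiv_const_smul hF, smul_apply, smul_eq_mul]
  ring

theorem wirt_mul (v : E) {F G : E → ℂ} {u : E} (hF : DifferentiableAt ℝ F u)
    (hG : DifferentiableAt ℝ G u) : wirt v (F * G) u = F u * wirt v G u + wirt v F u * G u := by
  simp only [wirt, fderiv_mul hF hG, add_apply,
    smul_apply, smul_eq_mul]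
  ring

/-- Since the derivative is complex linear, the two terms of `wirt` are equal. -/
theorem wirt_of_hol (v : E) {F : E → ℂ} {u : E} (hF : DifferentiableAt ℂ F u) :
    wirt v F u = fderiv ℂ F u v := by
  simp only [wirt, hF.fderiv_restrictScalars ℝ, ContinuousLinearMap.coe_restrictScalars', map_smul,
    smul_eq_mul]
  linear_combination (-1 / 2 * fderiv ℂ F u v) * Complex.I_mul_I

/-- The derivative of the conjugate is conjugate linear, so the two terms of `wirt` cancel. -/
theorem wirt_conj_of_hol (v : E) {F : E → ℂ} {u : E} (hF : DifferentiableAt ℂ F u) :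
    wirt v (fun x => starRingEnd ℂ (F x)) u = 0 := by
  have h : HasFDerivAt (fun x => starRingEnd ℂ (F x))
      ((Complex.conjCLE : ℂ →L[ℝ] ℂ).comp ((fderiv ℂ F u).restrictScalars ℝ)) u :=
    (Complex.conjCLE : ℂ →L[ℝ] ℂ).hasFDerivAt.comp u (hF.hasFDerivAt.restrictScalars ℝ)
  simp only [wirt, h.fderiv, ContinuousLinearMap.comp_apply,
    ContinuousLinearMap.coe_restrictScalars', map_smul, smul_eq_mul]
  simp only [ContinuousLinearEquiv.coe_coe, Complex.conjCLE_apply, map_mul, Complex.conj_I]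
  linear_combination (1 / 2 * (starRingEnd ℂ) (fderiv ℂ F u v)) * Complex.I_mul_I

/-- The chain rule has no `(0, 1)` term because `A` commutes with multiplication by `I`. -/
theorem wirt_comp_clm {E' : Type*} [NormedAddCommGroup E'] [NormedSpace ℂ E'] (A : E' →L[ℂ] E)
    (v : E') {F : E → ℂ} {u : E'} (hF : DifferentiableAt ℝ F (A u)) :
    wirt v (F ∘ A) u = wirt (A v) F (A u) := by
  have h : HasFDerivAt (F ∘ A) ((fderiv ℝ F (A u)).comp (A.restrictScalars ℝ)) u :=
    hF.hasFDerivAt.comp u (A.restrictScalars ℝ).hasFDerivAt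
  simp only [wirt, h.fderiv, ContinuousLinearMap.comp_apply,
    ContinuousLinearMap.coe_restrictScalars', map_smul]

theorem contDiffAt_wirt (v : E) {F : E → ℂ} {u : E} (hF : ContDiffAt ℝ ∞ F u) :
    ContDiffAt ℝ ∞ (wirt v F) u := by
  have h : ContDiffAt ℝ ∞ (fderiv ℝ F) u := hF.fderiv_right (by simp)
  unfold wirt
  fun_prop

theorem contDiffAt_wirt_of_hol (v : E) {F : E → ℂ} {u : E} (hF : ContDiffAt ℂ ω F u) :
    ContDiffAt ℂ ω (wirt v F) u := by
  have h : ContDiffAt ℂ ω (fderiv ℂ F) u := hF.fderiv_right (by simp)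
  refine (h.clm_apply (contDiffAt_const (c := v))).congr_of_eventuallyEq ?_
  filter_upwards [hF.eventually (by simp)] with x hx
  exact wirt_of_hol v (hx.differentiableAt (by simp))

/-- Hadamard's lemma in complex coordinates. -/
theorem exists_complex_hadamard [FiniteDimensional ℂ E] {κ : Type*} [Fintype κ]
    (b : Module.Basis κ ℂ E) {f : E → ℂ} {s : Set E} {x₀ : E} (hs : s ∈ 𝓝 x₀)
    (hf : ContDiffOn ℝ ∞ f s) :
    ∃ g h : κ → E → ℂ, (∀ k, ContDiff ℝ ∞ (g k)) ∧ (∀ k, ContDiff ℝ ∞ (h k)) ∧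
      ∀ᶠ x in 𝓝 x₀, f x = f x₀ + ∑ k, ((b.coord k x - b.coord k x₀) * g k x
        + starRingEnd ℂ (b.coord k x - b.coord k x₀) * h k x) := by
  obtain ⟨G, hG, hfG⟩ := exists_hadamard hs hf
  -- These are the complex linear and conjugate linear components of the real linear map `G x` along
  -- `b k`.
  refine ⟨fun k x => (1 / 2) * (G x (b k) - Complex.I * G x (Complex.I • b k)),
    fun k x => (1 / 2) * (G x (b k) + Complex.I * G x (Complex.I • b k)), fun k => ?_, fun k => ?_, ?_⟩
  · fun_prop
  · fun_prop
  · filter_upwards [hfG] with x hx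
    rw [hx]
    congr 1
    conv_lhs => rw [← b.sum_repr (x - x₀), map_sum]
    refine Finset.sum_congr rfl fun k _ => ?_
    rw [← map_sub, Module.Basis.coord_apply]
    set c := b.repr (x - x₀) k
    -- `G x` is only real linear, so the complex multiple is split into real multiples of `b k` and
    -- `I • b k`.
    have hc : c • b k = c.re • b k + c.im • (Complex.I • b k) := by
      conv_lhs => rw [← Complex.re_add_im c, add_smul, mul_smul]
      simp only [Complex.coe_smul]
    rw [hc, map_add, map_smul, map_smul, Complex.real_smul, Complex.real_smul]
    have h1 : c = c.re + c.im * Complex.I := (Complex.re_add_im c).symm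
    have h2 : starRingEnd ℂ c = c.re - c.im * Complex.I := by
      apply Complex.ext <;> simp
    rw [h2]
    nth_rewrite 3 [h1]
    linear_combination (c.im * G x (Complex.I • b k)) * Complex.I_mul_I

end Calculus

/-! ### Functions in charts -/

section Charts

theorem SmoothFun.ext {E : Type*} [NormedAddCommGroup E] [NormedSpace ℂ E]
    {X : Type*} [TopologicalSpace X] [ChartedSpace E X] {V : Opens X} {f g : SmoothFun E V}
    (h : ∀ x, f.1 x = g.1 x) : f = g :=
  Subtype.ext (funext h)

theorem SmoothFun.add_apply {E : Type*} [NormedAddCommGroup E] [NormedSpace ℂ E]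
    {X : Type*} [TopologicalSpace X] [ChartedSpace E X] {V : Opens X} (f g : SmoothFun E V) (x : V) :
    (f + g).1 x = f.1 x + g.1 x := rfl

theorem SmoothFun.mul_apply {E : Type*} [NormedAddCommGroup E] [NormedSpace ℂ E]
    {X : Type*} [TopologicalSpace X] [ChartedSpace E X] {V : Opens X} (f g : SmoothFun E V) (x : V) :
    (f * g).1 x = f.1 x * g.1 x := rfl

theorem SmoothFun.sum_apply {E : Type*} [NormedAddCommGroup E] [NormedSpace ℂ E]
    {X : Type*} [TopologicalSpace X] [ChartedSpace E X] {V : Opens X} {κ : Type*} (s : Finset κ)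
    (f : κ → SmoothFun E V) (x : V) : (∑ k ∈ s, f k).1 x = ∑ k ∈ s, (f k).1 x := by
  classical
  induction s using Finset.induction_on with
  | empty => rfl
  | insert a s ha ih => rw [Finset.sum_insert ha, Finset.sum_insert ha, ← ih]; rfl

theorem SheafEnd.ext {E : Type*} [NormedAddCommGroup E] [NormedSpace ℂ E]
    {X : Type*} [TopologicalSpace X] [ChartedSpace E X] {V : Opens X} {S T : SheafEnd E V}
    (h : ∀ W f, S.1 W f = T.1 W f) : S = T :=
  Subtype.ext (funext fun W => LinearMap.ext (h W))

theorem SheafEnd.sum_apply {E : Type*} [NormedAddCommGroup E] [NormedSpace ℂ E]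
    {X : Type*} [TopologicalSpace X] [ChartedSpace E X] {V : Opens X} {κ : Type*} (s : Finset κ)
    (T : κ → SheafEnd E V) (W : Set.Iic V) (f : SmoothFun E W.1) :
    (∑ k ∈ s, T k).1 W f = ∑ k ∈ s, (T k).1 W f := by
  classical
  induction s using Finset.induction_on with
  | empty => rfl
  | insert a s ha ih => rw [Finset.sum_insert ha, Finset.sum_insert ha, ← ih]; rfl

variable {E : Type*} [NormedAddCommGroup E] [NormedSpace ℂ E]
  {X : Type*} [TopologicalSpace X] [ChartedSpace E X]

/-- A map that is holomorphic at a point is smooth there. -/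
theorem contMDiffAt_real_of_complex
    {E' : Type*} [NormedAddCommGroup E'] [NormedSpace ℂ E']
    {X' : Type*} [TopologicalSpace X'] [ChartedSpace E' X'] {f : X → X'} {x : X}
    (hf : ContMDiffAt 𝓘(ℂ, E) 𝓘(ℂ, E') ω f x) : ContMDiffAt 𝓘(ℝ, E) 𝓘(ℝ, E') ∞ f x := by
  have h := contMDiffAt_iff.1 hf
  exact contMDiffAt_iff.2 ⟨h.1, (h.2.restrict_scalars ℝ).of_le le_top⟩

open Classical in
/-- Extension by zero. -/
def extFun {V : Opens X} (f : V → ℂ) (x : X) : ℂ := if hx : x ∈ V then f ⟨x, hx⟩ else 0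

theorem extFun_apply {V : Opens X} (f : V → ℂ) {x : X} (hx : x ∈ V) : extFun f x = f ⟨x, hx⟩ :=
  dif_pos hx

theorem extFun_comp_val {V : Opens X} (f : V → ℂ) : (fun x : V => extFun f x.1) = f :=
  funext fun x => extFun_apply f x.2

section
variable {𝕜 : Type*} [NontriviallyNormedField 𝕜] [NormedSpace 𝕜 E] [NormedSpace 𝕜 ℂ] {n : ℕ∞ω}

theorem contMDiffAt_extFun {V : Opens X} {f : V → ℂ} (hf : ContMDiff 𝓘(𝕜, E) 𝓘(𝕜, ℂ) n f) {x : X}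
    (hx : x ∈ V) : ContMDiffAt 𝓘(𝕜, E) 𝓘(𝕜, ℂ) n (extFun f) x := by
  refine (contMDiffAt_subtype_iff (U := V) (x := ⟨x, hx⟩)).1 ?_
  rw [extFun_comp_val]
  exact hf _

theorem contMDiff_restrict {V : Opens X} {f : X → ℂ}
    (hf : ∀ x ∈ V, ContMDiffAt 𝓘(𝕜, E) 𝓘(𝕜, ℂ) n f x) :
    ContMDiff 𝓘(𝕜, E) 𝓘(𝕜, ℂ) n fun x : V => f x.1 :=
  fun x => (contMDiffAt_subtype_iff (U := V) (x := x)).2 (hf x.1 x.2)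

end

/-- The function `f` in the chart `e`. -/
def chartFun (e : OpenPartialHomeomorph X E) {V : Opens X} (f : V → ℂ) : E → ℂ :=
  extFun f ∘ e.symm

theorem chartFun_apply {e : OpenPartialHomeomorph X E} {V : Opens X} (f : V → ℂ) {x : X}
    (hx : x ∈ V) (hxe : x ∈ e.source) : chartFun e f (e x) = f ⟨x, hx⟩ := by
  rw [chartFun, Function.comp_apply, e.left_inv hxe, extFun_apply f hx]

/-- A chart is a local homeomorphism, so identities checked at points of the manifold hold near `e
x`. Derivatives in the chart depend only on such germs. -/
theorem eventually_chart {e : OpenPartialHomeomorph X E} {V : Opens X} {x : X} (hx : x ∈ V)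
    (hxe : x ∈ e.source) {q : E → Prop} (h : ∀ y ∈ V, y ∈ e.source → q (e y)) :
    ∀ᶠ u in 𝓝 (e x), q u := by
  have h1 : ∀ᶠ u in 𝓝 (e x), e.symm u ∈ V :=
    (e.continuousAt_symm (e.map_source hxe)).eventually_mem
      (by rw [e.left_inv hxe]; exact V.2.mem_nhds hx)
  filter_upwards [h1, e.open_target.mem_nhds (e.map_source hxe)] with u hu hu'
  rw [← e.right_inv hu']
  exact h _ hu (e.map_target hu')

theorem chartFun_eventuallyEq {e : OpenPartialHomeomorph X E} {V W : Opens X} {f : V → ℂ}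
    {g : E → ℂ} {x : X} (hx : x ∈ W) (hxe : x ∈ e.source) (hW : W ≤ V)
    (h : ∀ y (hy : y ∈ W), y ∈ e.source → f ⟨y, hW hy⟩ = g (e y)) :
    chartFun e f =ᶠ[𝓝 (e x)] g :=
  eventually_chart hx hxe fun y hy hye => by rw [chartFun_apply f (hW hy) hye, h y hy hye]

variable {e : OpenPartialHomeomorph X E}
  (he : e ∈ IsManifold.maximalAtlas 𝓘(ℂ, E) ω X)

include he in
theorem contDiffAt_chartFun {V : Opens X} (f : SmoothFun E V) {x : X} (hx : x ∈ V)
    (hxe : x ∈ e.source) : ContDiffAt ℝ ∞ (chartFun e f.1) (e x) := by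
  have h1 := contMDiffAt_real_of_complex
    (contMDiffAt_symm_of_mem_maximalAtlas he (e.map_source hxe))
  have h2 : ContMDiffAt 𝓘(ℝ, E) 𝓘(ℝ, ℂ) ∞ (extFun f.1) (e.symm (e x)) := by
    rw [e.left_inv hxe]
    exact contMDiffAt_extFun f.2 hx
  exact (h2.comp _ h1).contDiffAt

include he in
theorem contDiffAt_chartFun_of_hol {V : Opens X} (f : holFun E V) {x : X} (hx : x ∈ V)
    (hxe : x ∈ e.source) : ContDiffAt ℂ ω (chartFun e f.1) (e x) := by
  have h1 := contMDiffAt_symm_of_mem_maximalAtlas he (e.map_source hxe)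
  have h2 : ContMDiffAt 𝓘(ℂ, E) 𝓘(ℂ, ℂ) ω (extFun f.1) (e.symm (e x)) := by
    rw [e.left_inv hxe]
    exact contMDiffAt_extFun f.2 hx
  exact (h2.comp _ h1).contDiffAt

/-! ### Coordinate functions and coordinate derivatives of a chart -/

variable {W : Opens X} (hW : (W : Set X) ⊆ e.source)

/-- The function `g ∘ e`, for a holomorphic function `g` of the coordinates. -/
def chartHol {g : E → ℂ} (hg : ContDiff ℂ ω g) : holFun E W :=
  ⟨fun x => g (e x.1), contMDiff_restrict fun _ hx =>
    hg.contMDiff.contMDiffAt.comp _ (contMDiffAt_of_mem_maximalAtlas he (hW hx))⟩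

/-- The function `g ∘ e`, for a smooth function `g` of the coordinates. -/
def chartSmooth {g : E → ℂ} (hg : ContDiff ℝ ∞ g) : SmoothFun E W :=
  ⟨fun x => g (e x.1), contMDiff_restrict fun _ hx =>
    hg.contMDiff.contMDiffAt.comp _
      (contMDiffAt_real_of_complex (contMDiffAt_of_mem_maximalAtlas he (hW hx)))⟩

/-- The derivative of type `(1, 0)` in the direction `v`, in the chart `e`. -/
def pdEnd (v : E) : SheafEnd E W :=
  ⟨fun W' =>
    { toFun := fun f => ⟨fun x => wirt v (chartFun e f.1) (e x.1), contMDiff_restrict fun x hx =>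
        (contDiffAt_wirt v (contDiffAt_chartFun he f hx (hW (W'.2 hx)))).contMDiffAt.comp x
          (contMDiffAt_real_of_complex (contMDiffAt_of_mem_maximalAtlas he (hW (W'.2 hx))))⟩
      map_add' := fun f g => SmoothFun.ext fun x => by
        have hx := hW (W'.2 x.2)
        have h : chartFun e (f + g).1 =ᶠ[𝓝 (e x.1)] chartFun e f.1 + chartFun e g.1 :=
          chartFun_eventuallyEq x.2 hx le_rfl fun y hy hye => by
            rw [Pi.add_apply, chartFun_apply _ hy hye, chartFun_apply _ hy hye]; rfl
        exact h.wirt_eq.trans (wirt_add v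
          ((contDiffAt_chartFun he f x.2 hx).differentiableAt (by simp))
          ((contDiffAt_chartFun he g x.2 hx).differentiableAt (by simp)))
      map_smul' := fun c f => SmoothFun.ext fun x => by
        have hx := hW (W'.2 x.2)
        have h : chartFun e (c • f).1 =ᶠ[𝓝 (e x.1)] c • chartFun e f.1 :=
          chartFun_eventuallyEq x.2 hx le_rfl fun y hy hye => by
            rw [Pi.smul_apply, chartFun_apply _ hy hye]; rfl
        exact h.wirt_eq.trans (wirt_const_mul v c
          ((contDiffAt_chartFun he f x.2 hx).differentiableAt (by simp))) },
    fun W₁ W₂ h f => SmoothFun.ext fun x => by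
      have hx := hW (W₂.2 x.2)
      have h : chartFun e f.1 =ᶠ[𝓝 (e x.1)] chartFun e (res h f).1 :=
        chartFun_eventuallyEq x.2 hx h fun y hy hye => by
          rw [chartFun_apply _ hy hye]; rfl
      exact h.wirt_eq⟩

theorem pdEnd_apply (v : E) (W' : Set.Iic W) (f : SmoothFun E W'.1) (x : W'.1) :
    ((pdEnd he hW v).1 W' f).1 x = wirt v (chartFun e f.1) (e x.1) := rfl

theorem pdEnd_hol_apply (v : E) (W' : Set.Iic W) (f : holFun E W'.1) (x : W'.1) :
    ((pdEnd he hW v).1 W' (toSmooth f)).1 x = fderiv ℂ (chartFun e f.1) (e x.1) v :=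
  wirt_of_hol v
    ((contDiffAt_chartFun_of_hol he f x.2 (hW (W'.2 x.2))).differentiableAt (by simp))

theorem pdEnd_chartHol (v : E) {g : E → ℂ} (hg : ContDiff ℂ ω g) (x : W) :
    ((pdEnd he hW v).1 ⟨W, Set.self_mem_Iic⟩ (toSmooth (chartHol he hW hg))).1 x = fderiv ℂ g (e x.1) v := by
  rw [pdEnd_hol_apply]
  have h : chartFun e (chartHol he hW hg).1 =ᶠ[𝓝 (e x.1)] g :=
    chartFun_eventuallyEq x.2 (hW x.2) le_rfl fun _ _ _ => rfl
  rw [h.fderiv_eq]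

/-- The three conditions are the product rule for `wirt`, its agreement with the complex derivative
on holomorphic functions, and its vanishing on their conjugates. -/
theorem pdEnd_mem (v : E) : pdEnd he hW v ∈ holVectorField E W := by
  refine ⟨fun W' f g => SmoothFun.ext fun x => ?_, fun W' f => ?_, fun W' f => SmoothFun.ext
    fun x => ?_⟩
  · have hx := hW (W'.2 x.2)
    have h : chartFun e (f * g).1 =ᶠ[𝓝 (e x.1)] chartFun e f.1 * chartFun e g.1 :=
      chartFun_eventuallyEq x.2 hx le_rfl fun y hy hye => by
        rw [Pi.mul_apply, chartFun_apply _ hy hye, chartFun_apply _ hy hye]; rfl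
    refine (h.wirt_eq.trans (wirt_mul v
          ((contDiffAt_chartFun he f x.2 hx).differentiableAt (by simp))
          ((contDiffAt_chartFun he g x.2 hx).differentiableAt (by simp)))).trans ?_
    rw [chartFun_apply _ x.2 hx, chartFun_apply _ x.2 hx]
    rfl
  · exact contMDiff_restrict fun x hx =>
      (contDiffAt_wirt_of_hol v (contDiffAt_chartFun_of_hol he f hx (hW (W'.2 hx)))).contMDiffAt.comp
        x (contMDiffAt_of_mem_maximalAtlas he (hW (W'.2 hx)))
  · have hx := hW (W'.2 x.2)
    have h : chartFun e (conjFun (toSmooth f)).1 =ᶠ[𝓝 (e x.1)]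
        fun u => starRingEnd ℂ (chartFun e f.1 u) :=
      chartFun_eventuallyEq x.2 hx le_rfl fun y hy hye => by
        rw [chartFun_apply _ hy hye]; rfl
    exact h.wirt_eq.trans (wirt_conj_of_hol v
      ((contDiffAt_chartFun_of_hol he f x.2 hx).differentiableAt (by simp)))

/-! ### The coordinate expression of a vector field -/

variable [FiniteDimensional ℂ E] {κ : Type*} [Fintype κ] (b : Module.Basis κ ℂ E)

theorem contDiff_coord (k : κ) : ContDiff ℂ ω fun u => b.coord k u :=
  (LinearMap.toContinuousLinearMap (b.coord k)).contDiff

/-- The coordinate functions of the chart `e`, with respect to the basis `b`. -/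
def coordFun (k : κ) : holFun E W := chartHol he hW (contDiff_coord b k)

theorem pdEnd_coordFun [DecidableEq κ] (k l : κ) :
    (pdEnd he hW (b k)).1 ⟨W, Set.self_mem_Iic⟩ (toSmooth (coordFun he hW b l)) = if k = l then 1 else 0 := by
  refine SmoothFun.ext fun x => ?_
  rw [coordFun, pdEnd_chartHol]
  have : fderiv ℂ (fun u => b.coord l u) (e x.1) = LinearMap.toContinuousLinearMap (b.coord l) :=
    (LinearMap.toContinuousLinearMap (b.coord l)).fderiv
  rw [this, LinearMap.coe_toContinuousLinearMap', b.coord_apply, b.repr_self,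
    Finsupp.single_apply]
  split_ifs <;> rfl

theorem map_algebraMap_eq_zero_of_leibniz {A : Type*} [CommRing A] [Algebra ℂ A]
    {D : A →ₗ[ℂ] A} (hD : ∀ f g, D (f * g) = f * D g + D f * g) (c : ℂ) :
    D (algebraMap ℂ A c) = 0 := by
  have h : D 1 = 0 := by simpa using hD 1 1
  rw [Algebra.algebraMap_eq_smul_one, map_smul, h, smul_zero]

/-- Hadamard's lemma transported to the manifold, with every factor an element of the algebra of
smooth functions on a neighbourhood, so that a derivation can be applied term by term. -/
theorem exists_hadamard_expansion {V : Opens X} (hV : V ≤ W) (f : SmoothFun E V) {x : X}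
    (hx : x ∈ V) : ∃ (V' : Opens X) (h : V' ≤ V), x ∈ V' ∧ ∃ g h' : κ → SmoothFun E V',
      res h f = algebraMap ℂ _ (f.1 ⟨x, hx⟩) + ∑ k,
        ((res (h.trans hV) (toSmooth (coordFun he hW b k)) - algebraMap ℂ _ (b.coord k (e x))) * g k
        + (res (h.trans hV) (conjFun (toSmooth (coordFun he hW b k)))
            - algebraMap ℂ _ (starRingEnd ℂ (b.coord k (e x)))) * h' k) := by
  have hxe : x ∈ e.source := hW (hV hx)
  have hs : {u | u ∈ e.target ∧ e.symm u ∈ V} ∈ 𝓝 (e x) :=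
    eventually_chart hx hxe fun y hy hye =>
      ⟨e.map_source hye, by rw [e.left_inv hye]; exact hy⟩
  have hf : ContDiffOn ℝ ∞ (chartFun e f.1) {u | u ∈ e.target ∧ e.symm u ∈ V} := fun u hu => by
    have h := contDiffAt_chartFun he f hu.2 (e.map_target hu.1)
    rw [e.right_inv hu.1] at h
    exact h.contDiffWithinAt
  obtain ⟨g, h', hg, hh', heq⟩ := exists_complex_hadamard b hs hf
  have hnhds : ∀ᶠ y in 𝓝 x, y ∈ V ∧ chartFun e f.1 (e y) = chartFun e f.1 (e x) + ∑ k,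
      ((b.coord k (e y) - b.coord k (e x)) * g k (e y)
        + starRingEnd ℂ (b.coord k (e y) - b.coord k (e x)) * h' k (e y)) :=
    (V.2.eventually_mem hx).and ((e.continuousAt hxe).eventually heq)
  obtain ⟨t, ht, hto, hxt⟩ := eventually_nhds_iff.1 hnhds
  have hle : (⟨t, hto⟩ : Opens X) ≤ V := fun y hy => (ht y hy).1
  refine ⟨⟨t, hto⟩, hle, hxt, fun k => chartSmooth he (fun _ hy => hW (hV (hle hy))) (hg k),
    fun k => chartSmooth he (fun _ hy => hW (hV (hle hy))) (hh' k), SmoothFun.ext fun y => ?_⟩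
  have h := (ht y.1 y.2).2
  rw [chartFun_apply _ (hle y.2) (hW (hV (hle y.2))), chartFun_apply _ hx hxe] at h
  refine h.trans ?_
  rw [SmoothFun.add_apply, SmoothFun.sum_apply]
  simp only [map_sub]
  rfl

/-- Apply `δ` to the Hadamard expansion around `x` and evaluate at `x`. In each product the first
factor vanishes at `x`, and its image under `δ` is zero by hypothesis. The conjugate coordinates are
needed because `δ` acts on all smooth functions. -/
theorem eq_zero_of_leibniz_of_coord {δ : SheafEnd E W}
    (hδ : ∀ (W' : Set.Iic W) (f g : SmoothFun E W'.1),
      δ.1 W' (f * g) = f * δ.1 W' g + δ.1 W' f * g)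
    (h₁ : ∀ k, δ.1 ⟨W, Set.self_mem_Iic⟩ (toSmooth (coordFun he hW b k)) = 0)
    (h₂ : ∀ k, δ.1 ⟨W, Set.self_mem_Iic⟩ (conjFun (toSmooth (coordFun he hW b k))) = 0) : δ = 0 := by
  refine SheafEnd.ext fun W' f => SmoothFun.ext fun x => ?_
  obtain ⟨V', h, hx, g, h', heq⟩ := exists_hadamard_expansion he hW b W'.2 f x.2
  have hres : (δ.1 W' f).1 x = (δ.1 ⟨V', h.trans W'.2⟩ (res h f)).1 ⟨x.1, hx⟩ :=
    congrFun (congrArg Subtype.val (δ.2 W' ⟨V', h.trans W'.2⟩ h f)) ⟨x.1, hx⟩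
  have hc := map_algebraMap_eq_zero_of_leibniz (hδ ⟨V', h.trans W'.2⟩)
  have r₁ : ∀ k, δ.1 ⟨V', h.trans W'.2⟩ (res (h.trans W'.2) (toSmooth (coordFun he hW b k))) = 0 :=
    fun k => by rw [← δ.2 ⟨W, Set.self_mem_Iic⟩ ⟨V', h.trans W'.2⟩ (h.trans W'.2), h₁, map_zero]
  have r₂ : ∀ k, δ.1 ⟨V', h.trans W'.2⟩
      (res (h.trans W'.2) (conjFun (toSmooth (coordFun he hW b k)))) = 0 :=
    fun k => by rw [← δ.2 ⟨W, Set.self_mem_Iic⟩ ⟨V', h.trans W'.2⟩ (h.trans W'.2), h₂, map_zero]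
  rw [hres, heq, map_add, hc, zero_add, map_sum, SmoothFun.sum_apply]
  refine Finset.sum_eq_zero fun k _ => ?_
  rw [map_add, hδ, hδ, map_sub, map_sub, hc, hc, r₁, r₂, sub_zero, zero_mul, zero_mul, add_zero,
    add_zero, SmoothFun.add_apply, SmoothFun.mul_apply, SmoothFun.mul_apply]
  have e₁ : (res (h.trans W'.2) (toSmooth (coordFun he hW b k))
      - algebraMap ℂ (SmoothFun E V') (b.coord k (e x.1))).1 ⟨x.1, hx⟩ = 0 := sub_self _
  have e₂ : (res (h.trans W'.2) (conjFun (toSmooth (coordFun he hW b k)))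
      - algebraMap ℂ (SmoothFun E V') (starRingEnd ℂ (b.coord k (e x.1)))).1 ⟨x.1, hx⟩ = 0 :=
    sub_self _
  rw [e₁, e₂, zero_mul, zero_mul, add_zero]

/-- A holomorphic vector field is a combination of the coordinate vector fields. -/
theorem holVectorField_eq_sum {ξ : SheafEnd E W} (hξ : ξ ∈ holVectorField E W) :
    ξ = ∑ k, mulEnd (ξ.1 ⟨W, Set.self_mem_Iic⟩ (toSmooth (coordFun he hW b k))) * pdEnd he hW (b k) := by
  classical
  rw [← sub_eq_zero]
  have happ : ∀ (W' : Set.Iic W) (f : SmoothFun E W'.1),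
      (ξ - ∑ k, mulEnd (ξ.1 ⟨W, Set.self_mem_Iic⟩ (toSmooth (coordFun he hW b k))) * pdEnd he hW (b k)).1 W' f
        = ξ.1 W' f - ∑ k, res W'.2 (ξ.1 ⟨W, Set.self_mem_Iic⟩ (toSmooth (coordFun he hW b k)))
          * (pdEnd he hW (b k)).1 W' f := fun W' f =>
    congrArg (ξ.1 W' f - ·) (SheafEnd.sum_apply _ _ W' f)
  -- The difference is a derivation; it kills the coordinates because the coordinate derivatives are
  -- dual to them, and the conjugate coordinates because both fields do.
  refine eq_zero_of_leibniz_of_coord he hW b (fun W' f g => ?_) (fun l => ?_) (fun l => ?_)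
  · rw [happ, happ, happ, hξ.1, mul_sub, sub_mul, Finset.mul_sum, Finset.sum_mul]
    simp only [(pdEnd_mem he hW _).1, mul_add, Finset.sum_add_distrib]
    simp only [mul_left_comm, mul_assoc]
    ring
  · have hs : ∑ k, (ξ.1 ⟨W, Set.self_mem_Iic⟩ (toSmooth (coordFun he hW b k)) : SmoothFun E W) *
        (if k = l then 1 else 0) = ξ.1 ⟨W, Set.self_mem_Iic⟩ (toSmooth (coordFun he hW b l)) := by
      simp only [mul_ite, mul_one, mul_zero, Finset.sum_ite_eq', Finset.mem_univ, if_true]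
    refine (happ ⟨W, Set.self_mem_Iic⟩ _).trans (sub_eq_zero.2 (Eq.trans ?_ hs).symm)
    exact Finset.sum_congr rfl fun k _ => congrArg (_ * ·) (pdEnd_coordFun he hW b k l)
  · rw [happ, hξ.2.2]
    simp only [(pdEnd_mem he hW _).2.2, mul_zero, Finset.sum_const_zero, sub_zero]

end Charts

/-! ### Differential operators in charts -/

section ChartOperators

variable {E : Type*} [NormedAddCommGroup E] [NormedSpace ℂ E]
  {X : Type*} [TopologicalSpace X] [ChartedSpace E X]

theorem SheafEnd.apply_res {V : Opens X} (T : SheafEnd E V) {W W' : Set.Iic V} (h : W'.1 ≤ W.1)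
    (f : SmoothFun E W.1) {x : X} (hx : x ∈ W'.1) :
    (T.1 W f).1 ⟨x, h hx⟩ = (T.1 W' (res h f)).1 ⟨x, hx⟩ :=
  congrFun (congrArg Subtype.val (T.2 W W' h f)) ⟨x, hx⟩

theorem DiffOp.ext {V : Opens X} {P Q : DiffOp E V} (h : ∀ W f, P.1.1 W f = Q.1.1 W f) : P = Q :=
  Subtype.ext (SheafEnd.ext h)

theorem DiffOp.val_sum {V : Opens X} {κ : Type*} (s : Finset κ) (T : κ → DiffOp E V) :
    (∑ k ∈ s, T k).1 = ∑ k ∈ s, (T k).1 := by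
  classical
  induction s using Finset.induction_on with
  | empty => rfl
  | insert a s ha ih => rw [Finset.sum_insert ha, Finset.sum_insert ha, ← ih]; rfl

theorem DiffOp.sum_apply {V : Opens X} {κ : Type*} (s : Finset κ) (T : κ → DiffOp E V)
    (W : Set.Iic V) (f : SmoothFun E W.1) :
    (∑ k ∈ s, T k).1.1 W f = ∑ k ∈ s, (T k).1.1 W f := by
  rw [DiffOp.val_sum, SheafEnd.sum_apply]

theorem genAlg_le_diffOpAlg (V : Opens X) : genAlg E V ≤ diffOpAlg E V :=
  fun _ hP _ hx => ⟨V, le_rfl, hx, hP⟩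

theorem holVectorField_subset_diffOpAlg {V : Opens X} {ξ : SheafEnd E V}
    (hξ : ξ ∈ holVectorField E V) : ξ ∈ diffOpAlg E V :=
  genAlg_le_diffOpAlg V (Algebra.subset_adjoin (Or.inr hξ))

theorem endRes_mem_holVectorField {W V : Opens X} (h : W ≤ V) {ξ : SheafEnd E V}
    (hξ : ξ ∈ holVectorField E V) : endRes h ξ ∈ holVectorField E W :=
  ⟨fun W' => hξ.1 ⟨W'.1, W'.2.trans h⟩, fun W' => hξ.2.1 ⟨W'.1, W'.2.trans h⟩,
    fun W' => hξ.2.2 ⟨W'.1, W'.2.trans h⟩⟩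

theorem mulOp_add {V : Opens X} (f g : holFun E V) : mulOp (f + g) = mulOp f + mulOp g :=
  DiffOp.ext fun W s => add_mul (res W.2 (toSmooth f)) (res W.2 (toSmooth g)) s

theorem mulOp_mul {V : Opens X} (f g : holFun E V) : mulOp (f * g) = mulOp f * mulOp g :=
  DiffOp.ext fun W s => mul_assoc (res W.2 (toSmooth f)) (res W.2 (toSmooth g)) s

theorem mulOp_zero {V : Opens X} : mulOp (0 : holFun E V) = 0 :=
  DiffOp.ext fun _ s => zero_mul s

theorem mulOp_one {V : Opens X} : mulOp (1 : holFun E V) = 1 :=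
  DiffOp.ext fun _ s => one_mul s

variable {e : OpenPartialHomeomorph X E}
  (he : e ∈ IsManifold.maximalAtlas 𝓘(ℂ, E) ω X) {W : Opens X} (hW : (W : Set X) ⊆ e.source)

/-- The derivative in the direction `v` in the chart `e`, as a differential operator. -/
def pdOp (v : E) : DiffOp E W :=
  ⟨pdEnd he hW v, holVectorField_subset_diffOpAlg (pdEnd_mem he hW v)⟩

/-- The derivative of a holomorphic function in the direction `v` in the chart `e`. -/
def pdHol (v : E) (f : holFun E W) : holFun E W :=
  ⟨_, (pdEnd_mem he hW v).2.1 ⟨W, Set.self_mem_Iic⟩ f⟩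

/-- The Leibniz rule as a commutation relation; it moves coefficients to the left of derivatives. -/
theorem pdOp_mul_mulOp (v : E) (f : holFun E W) :
    pdOp he hW v * mulOp f = mulOp f * pdOp he hW v + mulOp (pdHol he hW v f) := by
  refine DiffOp.ext fun W' s => ?_
  have h1 := (pdEnd_mem he hW v).1 W' (res W'.2 (toSmooth f)) s
  have h2 := (pdEnd he hW v).2 ⟨W, Set.self_mem_Iic⟩ W' W'.2 (toSmooth f)
  rw [← h2] at h1
  exact h1

variable [FiniteDimensional ℂ E] {κ : Type*} [Fintype κ] (b : Module.Basis κ ℂ E)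

/-- The commutator is again a derivation. It kills the coordinates, whose first derivatives are
constant, and the conjugate coordinates, so it is zero. -/
theorem pdOp_commute (k l : κ) : Commute (pdOp he hW (b k)) (pdOp he hW (b l)) := by
  classical
  have h : pdEnd he hW (b k) * pdEnd he hW (b l) - pdEnd he hW (b l) * pdEnd he hW (b k) = 0 := by
    refine eq_zero_of_leibniz_of_coord he hW b (fun W' f g => ?_) (fun j => ?_) (fun j => ?_)
    · have hk := (pdEnd_mem he hW (b k)).1 W'
      have hl := (pdEnd_mem he hW (b l)).1 W'
      change (pdEnd he hW (b k)).1 W' ((pdEnd he hW (b l)).1 W' (f * g))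
          - (pdEnd he hW (b l)).1 W' ((pdEnd he hW (b k)).1 W' (f * g))
        = f * ((pdEnd he hW (b k)).1 W' ((pdEnd he hW (b l)).1 W' g)
          - (pdEnd he hW (b l)).1 W' ((pdEnd he hW (b k)).1 W' g))
        + ((pdEnd he hW (b k)).1 W' ((pdEnd he hW (b l)).1 W' f)
          - (pdEnd he hW (b l)).1 W' ((pdEnd he hW (b k)).1 W' f)) * g
      rw [hk, hl, map_add, map_add, hk, hk, hl, hl]
      ring
    · have hk := map_algebraMap_eq_zero_of_leibniz
        ((pdEnd_mem he hW (b k)).1 ⟨W, Set.self_mem_Iic⟩)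
      have hl := map_algebraMap_eq_zero_of_leibniz
        ((pdEnd_mem he hW (b l)).1 ⟨W, Set.self_mem_Iic⟩)
      change (pdEnd he hW (b k)).1 ⟨W, Set.self_mem_Iic⟩ ((pdEnd he hW (b l)).1 ⟨W, Set.self_mem_Iic⟩ _)
          - (pdEnd he hW (b l)).1 ⟨W, Set.self_mem_Iic⟩ ((pdEnd he hW (b k)).1 ⟨W, Set.self_mem_Iic⟩ _) = 0
      have hi : ∀ i, (pdEnd he hW (b i)).1 ⟨W, Set.self_mem_Iic⟩ (toSmooth (coordFun he hW b j))
          = algebraMap ℂ (SmoothFun E W) (if i = j then 1 else 0) := fun i => by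
        rw [pdEnd_coordFun]
        split_ifs <;> simp
      rw [hi, hi]
      exact (congrArg₂ (· - ·) (hk _) (hl _)).trans (sub_self _)
    · change (pdEnd he hW (b k)).1 ⟨W, Set.self_mem_Iic⟩ ((pdEnd he hW (b l)).1 ⟨W, Set.self_mem_Iic⟩ _)
          - (pdEnd he hW (b l)).1 ⟨W, Set.self_mem_Iic⟩ ((pdEnd he hW (b k)).1 ⟨W, Set.self_mem_Iic⟩ _) = 0
      rw [(pdEnd_mem he hW (b k)).2.2, (pdEnd_mem he hW (b l)).2.2, map_zero, map_zero, sub_self]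
  exact Subtype.ext (sub_eq_zero.1 h)

/-- The coefficients of a holomorphic vector field. -/
def vfCoeff {ξ : SheafEnd E W} (hξ : ξ ∈ holVectorField E W) (k : κ) : holFun E W :=
  ⟨_, hξ.2.1 ⟨W, Set.self_mem_Iic⟩ (coordFun he hW b k)⟩

theorem vectorField_eq_sum {ξ : SheafEnd E W} (hξ : ξ ∈ holVectorField E W)
    (hξ' : ξ ∈ diffOpAlg E W) :
    (⟨ξ, hξ'⟩ : DiffOp E W) = ∑ k, mulOp (vfCoeff he hW b hξ k) * pdOp he hW (b k) :=
  Subtype.ext ((holVectorField_eq_sum he hW b hξ).trans (DiffOp.val_sum Finset.univ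
    fun k => mulOp (vfCoeff he hW b hξ k) * pdOp he hW (b k)).symm)

end ChartOperators

/-- The subalgebra generated by commuting elements is commutative, so polynomials can be evaluated
there and the result included in `A`. Monomials in the base derivatives are taken through such a
`θ`. -/
theorem exists_aeval_of_commute {A : Type*} [Ring A] [Algebra ℂ A] {ι : Type*} {D : ι → A}
    (hD : ∀ i j, Commute (D i) (D j)) :
    ∃ θ : MvPolynomial ι ℂ →ₐ[ℂ] A, ∀ i, θ (MvPolynomial.X i) = D i := by
  have hc : IsMulCommutative (Algebra.adjoin ℂ (Set.range D)) :=
    Algebra.isMulCommutative_adjoin ℂ (by rintro _ ⟨i, rfl⟩ _ ⟨j, rfl⟩; exact hD i j)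
  let _ : CommRing (Algebra.adjoin ℂ (Set.range D)) :=
    { (inferInstance : Ring (Algebra.adjoin ℂ (Set.range D))) with mul_comm := hc.1.1 }
  refine ⟨(Algebra.adjoin ℂ (Set.range D)).val.comp
    (MvPolynomial.aeval fun i => ⟨D i, Algebra.subset_adjoin ⟨i, rfl⟩⟩), fun i => ?_⟩
  simp

/-! ### Charts adapted to a submersion -/

section AdaptedCharts

variable {EZ : Type*} [NormedAddCommGroup EZ] [NormedSpace ℂ EZ]
  {EY : Type*} [NormedAddCommGroup EY] [NormedSpace ℂ EY]
  {F : Type*} [NormedAddCommGroup F] [NormedSpace ℂ F]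
  {Z : Type*} [TopologicalSpace Z] [ChartedSpace EZ Z]
  {Y : Type*} [TopologicalSpace Y] [ChartedSpace EY Y]
  {p : Z → Y} (hp : IsSubmersion 𝓘(ℂ, EZ) 𝓘(ℂ, EY) ω p)
  {eZ : OpenPartialHomeomorph Z EZ} (heZ : eZ ∈ IsManifold.maximalAtlas 𝓘(ℂ, EZ) ω Z)
  {eY : OpenPartialHomeomorph Y EY} (heY : eY ∈ IsManifold.maximalAtlas 𝓘(ℂ, EY) ω Y)
  {A : EZ ≃L[ℂ] EY × F} (hA : ∀ z ∈ eZ.source, p z ∈ eY.source ∧ (A (eZ z)).1 = eY (p z))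
  {W : Opens Z} (hW : (W : Set Z) ⊆ eZ.source)

-- In adapted charts `p` is the linear map `B`, the first component of `A`. The chart expression of
-- `f ∘ p` is that of `f` composed with `B`, and the chain rule for complex linear maps applies.
include heY hA in
theorem pdEnd_pullFun_apply (v : EZ) (W' : Set.Iic W) {V : Opens Y} (h : ∀ z ∈ W'.1, p z ∈ V)
    (f : SmoothFun EY V) (z : W'.1) :
    ((pdEnd heZ hW v).1 W' (pullFun hp h f)).1 z = wirt (A v).1 (chartFun eY f.1) (eY (p z.1)) := by
  have hz := hW (W'.2 z.2)
  let B : EZ →L[ℂ] EY := (ContinuousLinearMap.fst ℂ EY F).comp (A : EZ →L[ℂ] EY × F)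
  have hB : ∀ w ∈ eZ.source, B (eZ w) = eY (p w) := fun w hw => (hA w hw).2
  have h1 : chartFun eZ (pullFun hp h f).1 =ᶠ[𝓝 (eZ z.1)] chartFun eY f.1 ∘ B :=
    chartFun_eventuallyEq z.2 hz le_rfl fun w hw hwe => by
      rw [Function.comp_apply, hB w hwe, chartFun_apply f.1 (h w hw) (hA w hwe).1]
      rfl
  rw [pdEnd_apply, h1.wirt_eq, wirt_comp_clm, hB z.1 hz]
  · rfl
  · rw [hB z.1 hz]
    exact (contDiffAt_chartFun heY f (h z.1 z.2) (hA z.1 hz).1).differentiableAt (by simp)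

include hA in
theorem pdEnd_pullFun (v : EZ) (W' : Set.Iic W) {V : Opens Y} (hV : (V : Set Y) ⊆ eY.source)
    (V' : Set.Iic V) (h : ∀ z ∈ W'.1, p z ∈ V'.1) (f : SmoothFun EY V'.1) :
    (pdEnd heZ hW v).1 W' (pullFun hp h f)
      = pullFun hp h ((pdEnd heY hV (A v).1).1 V' f) :=
  SmoothFun.ext fun z => pdEnd_pullFun_apply hp heZ heY hA hW v W' h f z

include heY hA in
theorem pdEnd_pullFun_eq_zero {v : EZ} (hv : (A v).1 = 0) (W' : Set.Iic W) {V : Opens Y}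
    (h : ∀ z ∈ W'.1, p z ∈ V) (f : SmoothFun EY V) :
    (pdEnd heZ hW v).1 W' (pullFun hp h f) = 0 :=
  SmoothFun.ext fun z => (pdEnd_pullFun_apply hp heZ heY hA hW v W' h f z).trans (by
    rw [hv, wirt, smul_zero, map_zero, mul_zero, sub_zero, mul_zero]
    rfl)

include heY hA in
theorem pdOp_mem_vertical {v : EZ} (hv : (A v).1 = 0) : pdOp heZ hW v ∈ vertical hp W :=
  ⟨pdEnd_mem heZ hW v, fun W' _ h f => pdEnd_pullFun_eq_zero hp heZ heY hA hW hv W' h (toSmooth f)⟩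

variable {ι κ : Type*} [Fintype ι] [Fintype κ] (bY : Module.Basis ι ℂ EY) (bF : Module.Basis κ ℂ F)
  (A)

/-- The basis of `EZ` that corresponds to bases of `EY` and of the complement. -/
def adaptedBasis : Module.Basis (ι ⊕ κ) ℂ EZ := (bY.prod bF).map A.symm.toLinearEquiv

theorem adaptedBasis_inl (i : ι) : (A (adaptedBasis A bY bF (Sum.inl i))).1 = bY i := by
  simp [adaptedBasis]

theorem adaptedBasis_inr (k : κ) : (A (adaptedBasis A bY bF (Sum.inr k))).1 = 0 := by
  simp [adaptedBasis]

theorem adaptedBasis_coord_inl (i : ι) (u : EZ) :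
    (adaptedBasis A bY bF).coord (Sum.inl i) u = bY.coord i (A u).1 := by
  simp [adaptedBasis]

variable {A} [FiniteDimensional ℂ EZ] [FiniteDimensional ℂ EY]

-- The base coordinates on `Z` are pulled back from holomorphic functions on `Y`, so vertical fields
-- kill them by definition.
include hA in
theorem coordFun_inl_eq_pullHol {V : Opens Y} (hV : (V : Set Y) ⊆ eY.source)
    (h : ∀ z ∈ W, p z ∈ V) (i : ι) :
    coordFun heZ hW (adaptedBasis A bY bF) (Sum.inl i) = pullHol hp h (coordFun heY hV bY i) := by
  refine Subtype.ext (funext fun z => ?_)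
  change (adaptedBasis A bY bF).coord (Sum.inl i) (eZ z.1) = bY.coord i (eY (p z.1))
  rw [adaptedBasis_coord_inl, (hA z.1 (hW z.2)).2]

-- This passes from holomorphic to smooth functions on `Y`. The coefficient of a base derivative in
-- `ξ` is the value of `ξ` on a base coordinate, hence zero; the derivatives that remain are along
-- the fibres and kill every pull-back.
include heZ heY hA hW bY bF in
theorem vertical_pullFun_of_chart {ξ : DiffOp EZ W} (hξ : ξ ∈ vertical hp W) (W' : Set.Iic W)
    {V : Opens Y} (h : ∀ z ∈ W'.1, p z ∈ V) (f : SmoothFun EY V) :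
    ξ.1.1 W' (pullFun hp h f) = 0 := by
  have h1 := holVectorField_eq_sum heZ hW (adaptedBasis A bY bF) hξ.1
  rw [h1, SheafEnd.sum_apply]
  refine Finset.sum_eq_zero fun k _ => ?_
  rcases k with i | k
  · have h2 : ξ.1.1 ⟨W, Set.self_mem_Iic⟩
        (toSmooth (coordFun heZ hW (adaptedBasis A bY bF) (Sum.inl i))) = 0 := by
      rw [coordFun_inl_eq_pullHol hp heZ heY hA hW bY bF (V := ⟨eY.source, eY.open_source⟩)
        subset_rfl (fun z hz => (hA z (hW hz)).1)]
      exact hξ.2 ⟨W, Set.self_mem_Iic⟩ _ _ _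
    rw [h2]
    change res W'.2 (0 : SmoothFun EZ W) * _ = 0
    rw [map_zero, zero_mul]
  · change res W'.2 _ * (pdEnd heZ hW _).1 W' (pullFun hp h f) = 0
    rw [pdEnd_pullFun_eq_zero hp heZ heY hA hW (adaptedBasis_inr A bY bF k), mul_zero]

/-! ### Operators that kill the functions pulled back from the base -/

theorem contDiff_exp_coord (c : ι → ℂ) :
    ContDiff ℂ ω fun u : EY => Complex.exp (∑ i, c i * bY.coord i u) :=
  (ContDiff.sum fun i _ => contDiff_const.mul (contDiff_coord bY i)).cexp

/-- The exponential function `exp (∑ cᵢ yᵢ)` of the coordinates on `Y`. -/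
def expFun (c : ι → ℂ) : holFun EY (⟨eY.source, eY.open_source⟩ : Opens Y) :=
  chartHol heY subset_rfl (contDiff_exp_coord bY c)

/-- The exponentials are simultaneous eigenfunctions of the base derivatives, with freely chosen
eigenvalues; they serve to read off symbols. -/
theorem pdEnd_expFun (c : ι → ℂ) (i : ι) :
    (pdEnd heY subset_rfl (bY i)).1 ⟨_, Set.self_mem_Iic⟩ (toSmooth (expFun heY bY c))
      = c i • toSmooth (expFun heY bY c) := by
  classical
  refine SmoothFun.ext fun y => ?_
  rw [expFun, pdEnd_chartHol]
  have h1 : HasFDerivAt (fun u : EY => ∑ j, c j * bY.coord j u)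
      (∑ j, c j • LinearMap.toContinuousLinearMap (bY.coord j)) (eY y.1) :=
    HasFDerivAt.fun_sum fun j _ =>
      ((LinearMap.toContinuousLinearMap (bY.coord j)).hasFDerivAt).const_mul (c j)
  rw [h1.cexp.fderiv]
  have h2 : (∑ j, c j • LinearMap.toContinuousLinearMap (bY.coord j)) (bY i) = c i := by
    simp [Finsupp.single_apply]
  rw [smul_apply, h2, smul_eq_mul, mul_comm]
  rfl

end AdaptedCharts

/-! ### Normal forms of differential operators modulo vertical vector fields -/

section NormalForm

variable {EZ : Type*} [NormedAddCommGroup EZ] [NormedSpace ℂ EZ]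
  {EY : Type*} [NormedAddCommGroup EY] [NormedSpace ℂ EY]
  {F : Type*} [NormedAddCommGroup F] [NormedSpace ℂ F]
  {Z : Type*} [TopologicalSpace Z] [ChartedSpace EZ Z]
  {Y : Type*} [TopologicalSpace Y] [ChartedSpace EY Y]
  {p : Z → Y} (hp : IsSubmersion 𝓘(ℂ, EZ) 𝓘(ℂ, EY) ω p)
  {W : Opens Z} {ι : Type*}

/-- An element of the algebra generated by functions and vector fields, as a differential
operator. -/
def genOp {T : SheafEnd EZ W} (hT : T ∈ genAlg EZ W) : DiffOp EZ W := ⟨T, genAlg_le_diffOpAlg W hT⟩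

/-- `∑ a_β θ(X^β)`, for a family of holomorphic coefficients `a_β`. -/
def symbolOp (θ : MvPolynomial ι ℂ →ₐ[ℂ] DiffOp EZ W) :
    ((ι →₀ ℕ) →₀ holFun EZ W) →+ DiffOp EZ W :=
  Finsupp.liftAddHom fun β =>
    { toFun := fun a => mulOp a * θ (MvPolynomial.monomial β 1)
      map_zero' := by rw [mulOp_zero, zero_mul]
      map_add' := fun a a' => by rw [mulOp_add, add_mul] }

theorem symbolOp_single (θ : MvPolynomial ι ℂ →ₐ[ℂ] DiffOp EZ W) (β : ι →₀ ℕ) (a : holFun EZ W) :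
    symbolOp θ (Finsupp.single β a) = mulOp a * θ (MvPolynomial.monomial β 1) :=
  Finsupp.liftAddHom_apply_single _ _ _

/-- The operators of the form `∑ a_β θ(X^β)`, modulo the vertical vector fields. -/
def normalForms (θ : MvPolynomial ι ℂ →ₐ[ℂ] DiffOp EZ W) : AddSubmonoid (DiffOp EZ W) :=
  AddMonoidHom.mrange (symbolOp θ) ⊔ (Ideal.span (vertical hp W)).toAddSubmonoid

/-- Left multiplication preserves the left ideal of vertical fields and is additive, so only single
terms `a θ(X^β)` need checking. -/
theorem mul_mem_normalForms {θ : MvPolynomial ι ℂ →ₐ[ℂ] DiffOp EZ W} {T : DiffOp EZ W}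
    (hT : ∀ β a, T * symbolOp θ (Finsupp.single β a) ∈ normalForms hp θ) {n : DiffOp EZ W}
    (hn : n ∈ normalForms hp θ) : T * n ∈ normalForms hp θ := by
  obtain ⟨_, ⟨Q, rfl⟩, v, hv, rfl⟩ := AddSubmonoid.mem_sup.1 hn
  rw [mul_add]
  refine add_mem ?_ (AddSubmonoid.mem_sup_right (Ideal.mul_mem_left (Ideal.span (vertical hp W)) T hv))
  induction Q using Finsupp.induction_linear with
  | zero => rw [map_zero, mul_zero]; exact zero_mem _
  | add Q Q' hQ hQ' =>
    rw [map_add, mul_add]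
    exact add_mem (hQ (add_mem (AddSubmonoid.mem_sup_left ⟨Q, rfl⟩) (AddSubmonoid.mem_sup_right hv)))
      (hQ' (add_mem (AddSubmonoid.mem_sup_left ⟨Q', rfl⟩) (AddSubmonoid.mem_sup_right hv)))
  | single β a => exact hT β a

theorem mulOp_mul_mem_normalForms {θ : MvPolynomial ι ℂ →ₐ[ℂ] DiffOp EZ W} (f : holFun EZ W)
    {n : DiffOp EZ W} (hn : n ∈ normalForms hp θ) : mulOp f * n ∈ normalForms hp θ := by
  refine mul_mem_normalForms hp (fun β a => AddSubmonoid.mem_sup_left ⟨Finsupp.single β (f * a), ?_⟩) hn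
  rw [symbolOp_single, symbolOp_single, mulOp_mul, mul_assoc]

variable {eZ : OpenPartialHomeomorph Z EZ} (heZ : eZ ∈ IsManifold.maximalAtlas 𝓘(ℂ, EZ) ω Z)
  {eY : OpenPartialHomeomorph Y EY} (heY : eY ∈ IsManifold.maximalAtlas 𝓘(ℂ, EY) ω Y)
  {A : EZ ≃L[ℂ] EY × F} (hA : ∀ z ∈ eZ.source, p z ∈ eY.source ∧ (A (eZ z)).1 = eY (p z))
  (hW : (W : Set Z) ⊆ eZ.source)
  {κ : Type*} [Fintype ι] [Fintype κ] (bY : Module.Basis ι ℂ EY) (bF : Module.Basis κ ℂ F)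
  [FiniteDimensional ℂ EZ] [FiniteDimensional ℂ EY]

-- Move the derivative past the coefficient `a`: this leaves `∂(a)` in front of the same monomial,
-- and `a` times the derivative of that monomial. A base derivative raises the exponent by one; a
-- fibre derivative moves to the right end, into the ideal.
include heY hA in
theorem pdOp_mul_mem_normalForms {θ : MvPolynomial ι ℂ →ₐ[ℂ] DiffOp EZ W}
    (hθ : ∀ i, θ (MvPolynomial.X i) = pdOp heZ hW (adaptedBasis A bY bF (Sum.inl i)))
    (k : ι ⊕ κ) {n : DiffOp EZ W} (hn : n ∈ normalForms hp θ) :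
    pdOp heZ hW (adaptedBasis A bY bF k) * n ∈ normalForms hp θ := by
  refine mul_mem_normalForms hp (fun β a => ?_) hn
  rw [symbolOp_single, ← mul_assoc, pdOp_mul_mulOp, add_mul, mul_assoc]
  refine add_mem (mulOp_mul_mem_normalForms hp a ?_)
    (AddSubmonoid.mem_sup_left ⟨Finsupp.single β _, symbolOp_single θ β _⟩)
  rcases k with i | k
  · refine AddSubmonoid.mem_sup_left ⟨Finsupp.single (Finsupp.single i 1 + β) 1, ?_⟩
    rw [symbolOp_single, mulOp_one, one_mul, ← hθ, ← map_mul, MvPolynomial.X,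
      MvPolynomial.monomial_mul, one_mul]
  -- Only a left ideal is available, so the fibre derivative must become the rightmost factor; it
  -- commutes with all constant-coefficient polynomials in the base derivatives.
  · have hc : ∀ q, Commute (pdOp heZ hW (adaptedBasis A bY bF (Sum.inr k))) (θ q) := by
      intro q
      induction q using MvPolynomial.induction_on with
      | C c =>
        rw [← MvPolynomial.algebraMap_eq, AlgHom.commutes]
        exact (Algebra.commutes c _).symm
      | add q q' h h' => rw [map_add]; exact h.add_right h'
      | mul_X q i h =>
        rw [map_mul, hθ]
        exact h.mul_right (pdOp_commute heZ hW _ _ _)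
    rw [(hc _).eq]
    exact AddSubmonoid.mem_sup_right (Ideal.mul_mem_left (Ideal.span (vertical hp W)) _
      (Ideal.subset_span (pdOp_mem_vertical hp heZ heY hA hW (adaptedBasis_inr A bY bF k))))

-- The operators that preserve normal forms under left multiplication are closed under sums and
-- products and contain functions, vector fields and scalars, hence all of `genAlg`. Apply this to
-- the normal form `1`.
include heY hA in
theorem mem_normalForms_of_mem_genAlg {θ : MvPolynomial ι ℂ →ₐ[ℂ] DiffOp EZ W}
    (hθ : ∀ i, θ (MvPolynomial.X i) = pdOp heZ hW (adaptedBasis A bY bF (Sum.inl i)))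
    {P : DiffOp EZ W} (hP : P.1 ∈ genAlg EZ W) : P ∈ normalForms hp θ := by
  have key : ∀ (T : SheafEnd EZ W) (hT : T ∈ genAlg EZ W), ∀ n ∈ normalForms hp θ,
      genOp hT * n ∈ normalForms hp θ := by
    intro T hT
    refine Algebra.adjoin_induction (p := fun T hT => ∀ n ∈ normalForms hp θ,
      genOp hT * n ∈ normalForms hp θ) ?_ ?_ ?_ ?_ hT
    · rintro T (⟨f, rfl⟩ | hT) n hn
      · exact mulOp_mul_mem_normalForms hp f hn
      · have h : genOp (Algebra.subset_adjoin (Or.inr hT)) = _ := vectorField_eq_sum heZ hW (adaptedBasis A bY bF) hT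
          (holVectorField_subset_diffOpAlg hT)
        rw [h, Finset.sum_mul]
        refine sum_mem fun k _ => ?_
        rw [mul_assoc]
        exact mulOp_mul_mem_normalForms hp _
          (pdOp_mul_mem_normalForms hp heZ heY hA hW bY bF hθ k hn)
    · intro c n hn
      exact mulOp_mul_mem_normalForms hp (algebraMap ℂ (holFun EZ W) c) hn
    · intro S T hS hT ihS ihT n hn
      have := add_mem (ihS n hn) (ihT n hn)
      rw [← add_mul] at this
      exact this
    · intro S T hS hT ihS ihT n hn
      have := ihS _ (ihT n hn)
      rw [← mul_assoc] at this
      exact this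
  have h1 : (1 : DiffOp EZ W) ∈ normalForms hp θ := by
    refine AddSubmonoid.mem_sup_left ⟨Finsupp.single 0 1, ?_⟩
    rw [symbolOp_single, mulOp_one, one_mul]
    exact map_one θ
  have := key P.1 hP 1 h1
  rw [mul_one] at this
  exact this

/-- The exponential function `exp (∑ cᵢ yᵢ)` of the coordinates on `Y`, on `W ⊆ Z`. -/
def pullExp (c : ι → ℂ) : SmoothFun EZ W :=
  toSmooth (pullHol hp (fun z hz => (hA z (hW hz)).1) (expFun heY bY c))

/-- The exponential is an eigenfunction of each generator, so a polynomial in the generators acts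
through its value at `c`. -/
theorem apply_pullExp {θ : MvPolynomial ι ℂ →ₐ[ℂ] DiffOp EZ W}
    (hθ : ∀ i, θ (MvPolynomial.X i) = pdOp heZ hW (adaptedBasis A bY bF (Sum.inl i)))
    (c : ι → ℂ) (q : MvPolynomial ι ℂ) :
    opAct (θ q) (pullExp hp heY hA hW bY c) = MvPolynomial.eval c q • pullExp hp heY hA hW bY c := by
  induction q using MvPolynomial.induction_on with
  | C a =>
    rw [← MvPolynomial.algebraMap_eq, AlgHom.commutes, MvPolynomial.algebraMap_eq,
      MvPolynomial.eval_C]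
    rfl
  | add q q' h h' =>
    rw [map_add, map_add, add_smul, ← h, ← h']
    rfl
  | mul_X q i h =>
    rw [map_mul, map_mul, MvPolynomial.eval_X, hθ]
    have h1 : opAct (pdOp heZ hW (adaptedBasis A bY bF (Sum.inl i))) (pullExp hp heY hA hW bY c)
        = c i • pullExp hp heY hA hW bY c := by
      have h2 := pdEnd_pullFun hp heZ heY hA hW (adaptedBasis A bY bF (Sum.inl i))
        ⟨W, Set.self_mem_Iic⟩ (V := ⟨eY.source, eY.open_source⟩) subset_rfl ⟨_, Set.self_mem_Iic⟩
        (fun z hz => (hA z (hW hz)).1) (toSmooth (expFun heY bY c))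
      rw [adaptedBasis_inl, pdEnd_expFun, map_smul] at h2
      exact h2
    change opAct (θ q) (opAct (pdOp heZ hW (adaptedBasis A bY bF (Sum.inl i)))
      (pullExp hp heY hA hW bY c)) = _
    rw [h1, map_smul, h, smul_smul, mul_comm]

-- The source of injectivity. Write `P` as a symbol `Q` plus an element of the ideal. That element
-- and `P` both kill the pulled-back exponentials, so `Q` does too; letting `c` vary forces all its
-- coefficients to vanish.
include heZ heY hA hW bY bF in
theorem mem_span_vertical_of_chart {P : DiffOp EZ W} (hP : P.1 ∈ genAlg EZ W)
    (hkill : ∀ (V : Opens Y) (h : ∀ z ∈ W, p z ∈ V) (f : holFun EY V),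
      opAct P (toSmooth (pullHol hp h f)) = 0) : P ∈ Ideal.span (vertical hp W) := by
  obtain ⟨θ, hθ⟩ := exists_aeval_of_commute (fun i j =>
    pdOp_commute heZ hW (adaptedBasis A bY bF) (Sum.inl i) (Sum.inl j))
  obtain ⟨_, ⟨Q, rfl⟩, v, hv, rfl⟩ := AddSubmonoid.mem_sup.1
    (mem_normalForms_of_mem_genAlg hp heZ heY hA hW bY bF hθ hP)
  suffices hQ : Q = 0 by
    rw [hQ, map_zero, zero_add]
    exact hv
  have hvk : ∀ c, opAct v (pullExp hp heY hA hW bY c) = 0 := by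
    intro c
    refine Submodule.span_induction (p := fun v _ => opAct v (pullExp hp heY hA hW bY c) = 0)
      ?_ rfl ?_ ?_ hv
    · intro ξ hξ
      exact hξ.2 ⟨W, Set.self_mem_Iic⟩ _ _ _
    · intro x y _ _ hx hy
      change opAct x _ + opAct y _ = 0
      rw [hx, hy, add_zero]
    · intro a x _ hx
      change opAct a (opAct x _) = 0
      rw [hx, map_zero]
  have hs : ∀ c, opAct (symbolOp θ Q) (pullExp hp heY hA hW bY c) = 0 := by
    intro c
    have h1 : opAct (symbolOp θ Q) (pullExp hp heY hA hW bY c)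
        + opAct v (pullExp hp heY hA hW bY c) = 0 := hkill _ _ (expFun heY bY c)
    rwa [hvk, add_zero] at h1
  have hsum : ∀ (c : ι → ℂ) (z : W), ∑ β ∈ Q.support, (Q β).1 z
      * MvPolynomial.eval c (MvPolynomial.monomial β 1) = 0 := by
    intro c z
    have h1 : symbolOp θ Q = ∑ β ∈ Q.support, mulOp (Q β) * θ (MvPolynomial.monomial β 1) := rfl
    have h2 := congrArg (fun f : SmoothFun EZ W => f.1 z) (hs c)
    simp only [h1] at h2
    have h3 : opAct (∑ β ∈ Q.support, mulOp (Q β) * θ (MvPolynomial.monomial β 1))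
        (pullExp hp heY hA hW bY c) = ∑ β ∈ Q.support, toSmooth (Q β)
          * (MvPolynomial.eval c (MvPolynomial.monomial β 1) • pullExp hp heY hA hW bY c) := by
      refine (DiffOp.sum_apply _ _ _ _).trans (Finset.sum_congr rfl fun β _ => ?_)
      rw [← apply_pullExp hp heZ heY hA hW bY bF hθ]
      rfl
    rw [h3, SmoothFun.sum_apply] at h2
    -- The exponential has no zero, so it can be cancelled and only the polynomial in `c` is left.
    have h4 : (pullExp hp heY hA hW bY c).1 z ≠ 0 := Complex.exp_ne_zero _
    refine mul_right_cancel₀ h4 ?_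
    rw [Finset.sum_mul, zero_mul]
    refine Eq.trans (Finset.sum_congr rfl fun β _ => ?_) h2
    exact mul_assoc _ _ _
  refine Finsupp.ext fun β => ?_
  refine Finsupp.notMem_support_iff.1 fun hβ => Finsupp.mem_support_iff.1 hβ ?_
  refine Subtype.ext (funext fun z => ?_)
  -- For fixed `z`, a polynomial over the infinite field `ℂ` that vanishes at every `c` is zero, and
  -- its coefficients are the values at `z`.
  have hpoly : (∑ β ∈ Q.support, MvPolynomial.C ((Q β).1 z) * MvPolynomial.monomial β (1 : ℂ)) = 0 :=
    MvPolynomial.funext fun c => by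
      rw [map_sum, map_zero, ← hsum c z]
      exact Finset.sum_congr rfl fun β _ => by rw [map_mul, MvPolynomial.eval_C]
  have := congrArg (MvPolynomial.coeff β) hpoly
  classical
  simp only [MvPolynomial.coeff_sum, MvPolynomial.coeff_C_mul, MvPolynomial.coeff_monomial,
    mul_ite, mul_one, mul_zero, Finset.sum_ite_eq', if_pos hβ, MvPolynomial.coeff_zero] at this
  exact this

end NormalForm

/-! ### Operators on the source of a submersion -/

section SubmersionOperators

variable {EZ : Type*} [NormedAddCommGroup EZ] [NormedSpace ℂ EZ]
  {EY : Type*} [NormedAddCommGroup EY] [NormedSpace ℂ EY]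
  {Z : Type*} [TopologicalSpace Z] [ChartedSpace EZ Z]
  {Y : Type*} [TopologicalSpace Y] [ChartedSpace EY Y]
  {p : Z → Y}

theorem submersion_in_charts {z : Z} (h : IsSubmersionAt 𝓘(ℂ, EZ) 𝓘(ℂ, EY) ω p z) :
    ∀ w ∈ h.domChart.source,
      p w ∈ h.codChart.source ∧ (h.equiv (h.domChart w)).1 = h.codChart (p w) := by
  intro w hw
  refine ⟨h.source_subset_preimage_source hw, ?_⟩
  have hw' : h.domChart w ∈ (h.domChart.extend 𝓘(ℂ, EZ)).target := by
    simpa using h.domChart.map_source hw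
  simpa [hw] using (h.writtenInCharts hw').symm

theorem finiteDimensional_complement [FiniteDimensional ℂ EZ] {z : Z}
    (h : IsSubmersionAt 𝓘(ℂ, EZ) 𝓘(ℂ, EY) ω p z) : FiniteDimensional ℂ h.complement :=
  Module.Finite.of_surjective ((LinearMap.snd ℂ EY h.complement).comp
    (h.equiv.toLinearEquiv : EZ →ₗ[ℂ] EY × h.complement))
    (Prod.snd_surjective.comp h.equiv.surjective)

variable (hp : IsSubmersion 𝓘(ℂ, EZ) 𝓘(ℂ, EY) ω p)
variable [FiniteDimensional ℂ EZ] [FiniteDimensional ℂ EY]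

theorem vertical_pullFun {U : Opens Z} {ξ : DiffOp EZ U} (hξ : ξ ∈ vertical hp U) (W : Set.Iic U)
    {V : Opens Y} (h : ∀ z ∈ W.1, p z ∈ V) (f : SmoothFun EY V) :
    ξ.1.1 W (pullFun hp h f) = 0 := by
  refine SmoothFun.ext fun z => ?_
  have hz := hp.isSubmersionAt z.1
  have := finiteDimensional_complement hz
  let W₁ : Opens Z := W.1 ⊓ ⟨hz.domChart.source, hz.domChart.open_source⟩
  have hW₁ : W₁ ≤ U := inf_le_left.trans W.2
  have hξ₁ : opRes hW₁ ξ ∈ vertical hp W₁ :=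
    ⟨endRes_mem_holVectorField hW₁ hξ.1, fun W' => hξ.2 ⟨W'.1, W'.2.trans hW₁⟩⟩
  have key := vertical_pullFun_of_chart hp hz.domChart_mem_maximalAtlas
    hz.codChart_mem_maximalAtlas (submersion_in_charts hz) (W := W₁) (fun _ hw => hw.2)
    (Module.finBasis ℂ EY) (Module.finBasis ℂ hz.complement) hξ₁ ⟨W₁, Set.self_mem_Iic⟩
    (fun w hw => h w hw.1) f
  have h₁ := ξ.1.apply_res (W := W) (W' := ⟨W₁, hW₁⟩) inf_le_left (pullFun hp h f)
    (x := z.1) ⟨z.2, hz.mem_domChart_source⟩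
  exact h₁.trans (congrFun (congrArg Subtype.val key) ⟨z.1, z.2, hz.mem_domChart_source⟩)

/-- The elements of `D_Z · Θ_{Z/Y}` kill the functions that come from `Y`. -/
theorem vertIdeal_pullFun {U : Opens Z} {P : DiffOp EZ U} (hP : P ∈ vertIdeal hp U)
    (W : Set.Iic U) {V : Opens Y} (h : ∀ z ∈ W.1, p z ∈ V) (f : SmoothFun EY V) :
    P.1.1 W (pullFun hp h f) = 0 := by
  refine SmoothFun.ext fun z => ?_
  obtain ⟨W₀, h₀, hz₀, hP₀⟩ := hP z.1 (W.2 z.2)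
  let W₁ : Set.Iic W₀ := ⟨W.1 ⊓ W₀, Set.mem_Iic.2 inf_le_right⟩
  have hW₁ : ∀ w ∈ W₁.1, p w ∈ V := fun w hw => h w hw.1
  have key : ∀ T ∈ Ideal.span (vertical hp W₀),
      T.1.1 W₁ (pullFun hp hW₁ f) = 0 := by
    intro T hT
    refine Submodule.span_induction (p := fun T _ =>
      T.1.1 W₁ (pullFun hp hW₁ f) = 0) ?_ rfl ?_ ?_ hT
    · exact fun ξ hξ => vertical_pullFun hp hξ W₁ _ f
    · intro S T _ _ hS hT
      change S.1.1 W₁ _ + T.1.1 W₁ _ = 0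
      rw [hS, hT, add_zero]
    · intro S T _ hT
      change S.1.1 W₁ (T.1.1 W₁ _) = 0
      rw [hT, map_zero]
  have h₁ := P.1.apply_res (W := W) (W' := ⟨W.1 ⊓ W₀, Set.mem_Iic.2 (inf_le_left.trans W.2)⟩) inf_le_left
    (pullFun hp h f) (x := z.1) ⟨z.2, hz₀⟩
  exact h₁.trans (congrFun (congrArg Subtype.val (key _ hP₀)) ⟨z.1, z.2, hz₀⟩)

/-- An operator that kills the holomorphic functions that come from `Y` belongs to
`D_Z · Θ_{Z/Y}`. -/
theorem mem_vertIdeal_of_kills {U : Opens Z} {V : Opens Y} (hUV : ∀ z ∈ U, p z ∈ V)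
    {P : DiffOp EZ U} (hP : ∀ (W : Set.Iic U) (V' : Opens Y), V' ≤ V →
      ∀ (h : ∀ z ∈ W.1, p z ∈ V') (f : holFun EY V'), P.1.1 W (toSmooth (pullHol hp h f)) = 0) :
    P ∈ vertIdeal hp U := by
  intro z hz
  obtain ⟨W₀, h₀, hz₀, hP₀⟩ := P.2 z hz
  have hs := hp.isSubmersionAt z
  have := finiteDimensional_complement hs
  let W : Opens Z := W₀ ⊓ ⟨hs.domChart.source, hs.domChart.open_source⟩
  have hW : W ≤ U := inf_le_left.trans h₀
  refine ⟨W, hW, ⟨hz₀, hs.mem_domChart_source⟩, ?_⟩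
  refine mem_span_vertical_of_chart (W := W) hp hs.domChart_mem_maximalAtlas
    hs.codChart_mem_maximalAtlas (submersion_in_charts hs) (fun _ hw => hw.2)
    (Module.finBasis ℂ EY) (Module.finBasis ℂ hs.complement)
    (endRes_mem_genAlg (inf_le_left : W ≤ W₀) hP₀) (fun V' h f => ?_)
  -- The hypothesis tests only open sets inside `V`. Cutting `V'` down to `V` does not change the
  -- pull-back to `W`.
  exact hP ⟨W, hW⟩ (V' ⊓ V) inf_le_right (fun w hw => ⟨h w hw, hUV w (hW hw)⟩)
    (holRes inf_le_left f)

/-- `S (f ∘ p) = (Q f) ∘ p` for the local smooth functions `f` on `V`. -/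
def IsSmoothLift {W : Opens Z} {V : Opens Y} (S : DiffOp EZ W) (Q : DiffOp EY V) : Prop :=
  ∀ (W' : Set.Iic W) (V' : Set.Iic V) (h : ∀ z ∈ W'.1, p z ∈ V'.1) (f : SmoothFun EY V'.1),
    S.1.1 W' (pullFun hp h f) = pullFun hp h (Q.1.1 V' f)

variable {hp} in
theorem IsSmoothLift.isLift {W : Opens Z} {V : Opens Y} {S : DiffOp EZ W} {Q : DiffOp EY V}
    (h : IsSmoothLift hp S Q) : IsLift hp S Q := fun W' V' h' f => h W' V' h' (toSmooth f)

variable {hp} in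
theorem IsSmoothLift.mono {W W₁ : Opens Z} {V : Opens Y} {S : DiffOp EZ W} {Q : DiffOp EY V}
    (h : IsSmoothLift hp S Q) (h₁ : W₁ ≤ W) : IsSmoothLift hp (opRes h₁ S) Q :=
  fun W' => h ⟨W'.1, W'.2.trans h₁⟩

/-- A differential operator on `Y` lifts locally to `Z`. -/
theorem exists_isSmoothLift {V : Opens Y} (Q : DiffOp EY V) {z : Z} (hz : p z ∈ V) :
    ∃ W : Opens Z, z ∈ W ∧ (∀ w ∈ W, p w ∈ V) ∧ ∃ S : DiffOp EZ W, IsSmoothLift hp S Q := by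
  obtain ⟨V₁, h₁, hz₁, hQ₁⟩ := Q.2 (p z) hz
  have hs := hp.isSubmersionAt z
  have := finiteDimensional_complement hs
  have heZ := hs.domChart_mem_maximalAtlas
  have heY := hs.codChart_mem_maximalAtlas
  have hA := submersion_in_charts hs
  let V₂ : Opens Y := V₁ ⊓ ⟨hs.codChart.source, hs.codChart.open_source⟩
  let W : Opens Z := preimg hp V₂ ⊓ ⟨hs.domChart.source, hs.domChart.open_source⟩
  have hWV : ∀ w ∈ W, p w ∈ V₂ := fun w hw => hw.1
  have hV₂ : (V₂ : Set Y) ⊆ hs.codChart.source := fun _ hy => hy.2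
  have hW : (W : Set Z) ⊆ hs.domChart.source := fun _ hy => hy.2
  let bY := Module.finBasis ℂ EY
  let bF := Module.finBasis ℂ hs.complement
  -- Liftable operators are closed under sums and products. A function lifts to its pull-back, and a
  -- coordinate derivative to the derivative along the corresponding adapted basis vector.
  have key : ∀ T ∈ genAlg EY V₂, ∃ S : DiffOp EZ W, ∀ (W' : Set.Iic W) (V' : Set.Iic V₂)
      (h : ∀ z ∈ W'.1, p z ∈ V'.1) (f : SmoothFun EY V'.1),
      S.1.1 W' (pullFun hp h f) = pullFun hp h (T.1 V' f) := by
    intro T hT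
    refine Algebra.adjoin_induction (p := fun T _ => ∃ S : DiffOp EZ W,
      ∀ (W' : Set.Iic W) (V' : Set.Iic V₂) (h : ∀ z ∈ W'.1, p z ∈ V'.1) (f : SmoothFun EY V'.1),
      S.1.1 W' (pullFun hp h f) = pullFun hp h (T.1 V' f)) ?_ ?_ ?_ ?_ hT
    · rintro T (⟨g, rfl⟩ | hT)
      · exact ⟨mulOp (pullHol hp hWV g), fun W' V' h f => rfl⟩
      · refine ⟨∑ i, mulOp (pullHol hp hWV (vfCoeff heY hV₂ bY hT i))
          * pdOp heZ hW (adaptedBasis hs.equiv bY bF (Sum.inl i)), fun W' V' h f => ?_⟩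
        rw [DiffOp.sum_apply]
        have h₂ : T.1 V' f = ∑ i, res V'.2 (toSmooth (vfCoeff heY hV₂ bY hT i))
            * (pdEnd heY hV₂ (bY i)).1 V' f :=
          (congrArg (fun T : SheafEnd EY V₂ => T.1 V' f)
            (holVectorField_eq_sum heY hV₂ bY hT)).trans (SheafEnd.sum_apply _ _ V' f)
        rw [h₂, map_sum]
        refine Finset.sum_congr rfl fun i _ => ?_
        have h₃ := pdEnd_pullFun hp heZ heY hA hW (adaptedBasis hs.equiv bY bF (Sum.inl i)) W' hV₂
          V' h f
        rw [adaptedBasis_inl] at h₃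
        rw [map_mul]
        exact congrArg (res W'.2 (toSmooth (pullHol hp hWV (vfCoeff heY hV₂ bY hT i))) * ·) h₃
    · exact fun c => ⟨algebraMap ℂ _ c, fun W' V' h f => rfl⟩
    · rintro T T' _ _ ⟨S, hS⟩ ⟨S', hS'⟩
      refine ⟨S + S', fun W' V' h f => ?_⟩
      change S.1.1 W' _ + S'.1.1 W' _ = pullFun hp h (T.1 V' f + T'.1 V' f)
      rw [hS, hS', map_add]
    · rintro T T' _ _ ⟨S, hS⟩ ⟨S', hS'⟩
      refine ⟨S * S', fun W' V' h f => ?_⟩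
      change S.1.1 W' (S'.1.1 W' _) = pullFun hp h (T.1 V' (T'.1 V' f))
      rw [hS', hS]
  obtain ⟨S, hS⟩ := key _ (endRes_mem_genAlg (inf_le_left : V₂ ≤ V₁) hQ₁)
  refine ⟨W, ⟨⟨hz₁, hs.mem_codChart_source⟩, hs.mem_domChart_source⟩, fun w hw => h₁ hw.1.1, S,
    fun W' V' h f => ?_⟩
  -- The lift was built only over subsets of `V₂`. As `p` maps `W` into `V₂`, `V'` may be replaced
  -- by its intersection with `V₂`.
  have h' : ∀ w ∈ W'.1, p w ∈ V'.1 ⊓ V₂ := fun w hw => ⟨h w hw, hWV w (W'.2 hw)⟩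
  have h₂ := hS W' ⟨V'.1 ⊓ V₂, Set.mem_Iic.2 inf_le_right⟩ h' (res inf_le_left f)
  have h₃ := Q.1.2 V' ⟨V'.1 ⊓ V₂, Set.mem_Iic.2 (inf_le_left.trans V'.2)⟩ inf_le_left f
  exact h₂.trans (congrArg (pullFun hp h') h₃.symm)

/-- A lift of a differential operator on `Y` also lifts its action on smooth functions. -/
theorem IsLift.isSmoothLift {W : Opens Z} {V : Opens Y} {S : DiffOp EZ W} {Q : DiffOp EY V}
    (hS : IsLift hp S Q) : IsSmoothLift hp S Q := by
  intro W' V' h f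
  refine SmoothFun.ext fun z => ?_
  obtain ⟨W₁, hz₁, hW₁, S₁, hS₁⟩ := exists_isSmoothLift hp Q (V'.2 (h z.1 z.2))
  let W₂ : Opens Z := W'.1 ⊓ W₁
  have hW₂ : W₂ ≤ W := inf_le_left.trans W'.2
  have hW₂' : W₂ ≤ W₁ := inf_le_right
  -- Two lifts agree on holomorphic pull-backs, so they differ by an element of the ideal, which
  -- kills smooth pull-backs as well. The chart lift `S₁` is already known to lift the action on
  -- smooth functions.
  have hmem : opRes hW₂ S - opRes hW₂' S₁ ∈ vertIdeal hp W₂ := by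
    refine mem_vertIdeal_of_kills (U := W₂) hp (V := V) (fun w hw => hW₁ w hw.2) fun W₃ V'' hV'' h' g => ?_
    exact sub_eq_zero.2 ((hS ⟨W₃.1, W₃.2.trans hW₂⟩ ⟨V'', hV''⟩ h' g).trans
      (hS₁ ⟨W₃.1, W₃.2.trans hW₂'⟩ ⟨V'', hV''⟩ h' (toSmooth g)).symm)
  have h₁ := S.1.apply_res (W := W') (W' := ⟨W₂, hW₂⟩) inf_le_left (pullFun hp h f)
    (x := z.1) ⟨z.2, hz₁⟩
  have h₂ := sub_eq_zero.1 (vertIdeal_pullFun hp hmem ⟨W₂, Set.self_mem_Iic⟩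
    (fun w hw => h w hw.1) f)
  have h₃ := hS₁ ⟨W₂, hW₂'⟩ V' (fun w hw => h w hw.1) f
  exact h₁.trans (congrFun (congrArg Subtype.val (h₂.trans h₃)) ⟨z.1, z.2, hz₁⟩)

end SubmersionOperators

/-! ### The action of the transfer module on smooth functions -/

section TransferAction

variable {EZ : Type*} [NormedAddCommGroup EZ] [NormedSpace ℂ EZ]
  {EY : Type*} [NormedAddCommGroup EY] [NormedSpace ℂ EY]
  {Z : Type*} [TopologicalSpace Z] [ChartedSpace EZ Z]
  {Y : Type*} [TopologicalSpace Y] [ChartedSpace EY Y]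
  {p : Z → Y} (hp : IsSubmersion 𝓘(ℂ, EZ) 𝓘(ℂ, EY) ω p)

/-- Membership in `vertIdeal` is local, so it passes from `W` to every smaller neighbourhood of `z`.
-/
theorem germ_eq_of_sub_mem (z : Z) {W W₁ W₂ : Opens Z} (hz : z ∈ W) (h₁ : W ≤ W₁) (h₂ : W ≤ W₂)
    {P₁ : DiffOp EZ W₁} {P₂ : DiffOp EZ W₂} (h : opRes h₁ P₁ - opRes h₂ P₂ ∈ vertIdeal hp W) :
    germ hp z P₁ = germ hp z P₂ := by
  refine (Submodule.Quotient.eq _).2 ⟨W, hz, fun W' hW' w hw => ?_⟩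
  obtain ⟨W₃, h₃, hw₃, hP⟩ := h w (hW' hw)
  refine ⟨W'.1 ⊓ W₃, inf_le_left, ⟨hw, hw₃⟩, ?_⟩
  have : opRes (inf_le_left : W'.1 ⊓ W₃ ≤ W'.1) ((nhdFam z P₁ - nhdFam z P₂) W')
      = opRes (inf_le_right : W'.1 ⊓ W₃ ≤ W₃) (opRes h₃ (opRes h₁ P₁ - opRes h₂ P₂)) := by
    simp only [Pi.sub_apply, nhdFam, dif_pos (hW'.trans h₁), dif_pos (hW'.trans h₂)]
    rfl
  rw [this]
  exact opRes_mem_span hp _ hP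

theorem exists_sub_mem_of_germ_eq (z : Z) {W₁ W₂ : Opens Z} (hz₁ : z ∈ W₁) (hz₂ : z ∈ W₂)
    {P₁ : DiffOp EZ W₁} {P₂ : DiffOp EZ W₂} (h : germ hp z P₁ = germ hp z P₂) :
    ∃ (W : Opens Z) (h₁ : W ≤ W₁) (h₂ : W ≤ W₂), z ∈ W ∧
      opRes h₁ P₁ - opRes h₂ P₂ ∈ vertIdeal hp W := by
  obtain ⟨W₀, hz₀, hW₀⟩ := (Submodule.Quotient.eq _).1 h
  have h₁ : W₀ ⊓ (W₁ ⊓ W₂) ≤ W₁ := inf_le_right.trans inf_le_left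
  have h₂ : W₀ ⊓ (W₁ ⊓ W₂) ≤ W₂ := inf_le_right.trans inf_le_right
  -- Evaluating inside both domains avoids the default value `0` of `nhdFam`, so both components are
  -- true restrictions.
  have := hW₀ ⟨W₀ ⊓ (W₁ ⊓ W₂), ⟨hz₀, hz₁, hz₂⟩⟩ inf_le_left
  simp only [Pi.sub_apply, nhdFam, dif_pos h₁, dif_pos h₂] at this
  exact ⟨_, h₁, h₂, ⟨hz₀, hz₁, hz₂⟩, this⟩

/-! ### Well-definedness and faithfulness of the action -/

variable {hp}
variable [FiniteDimensional ℂ EZ] [FiniteDimensional ℂ EY]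

/-- Representatives of one germ differ near `z` by an element of the ideal, which kills pull-backs.
-/
theorem apply_eq_of_germ_eq {z : Z} {W₁ W₂ : Opens Z} (hz₁ : z ∈ W₁) (hz₂ : z ∈ W₂)
    {P₁ : DiffOp EZ W₁} {P₂ : DiffOp EZ W₂} (h : germ hp z P₁ = germ hp z P₂) {V : Opens Y}
    (h₁ : ∀ w ∈ W₁, p w ∈ V) (h₂ : ∀ w ∈ W₂, p w ∈ V) (f : SmoothFun EY V) :
    (opAct P₁ (pullFun hp h₁ f)).1 ⟨z, hz₁⟩ = (opAct P₂ (pullFun hp h₂ f)).1 ⟨z, hz₂⟩ := by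
  obtain ⟨W, hW₁, hW₂, hz, hW⟩ := exists_sub_mem_of_germ_eq hp z hz₁ hz₂ h
  have h₃ := vertIdeal_pullFun hp hW ⟨W, Set.self_mem_Iic⟩ (fun w hw => h₁ w (hW₁ hw)) f
  have h₄ : res hW₁ (opAct P₁ (pullFun hp h₁ f)) = res hW₂ (opAct P₂ (pullFun hp h₂ f)) := by
    rw [opAct_res, opAct_res]
    exact sub_eq_zero.1 h₃
  exact congrFun (congrArg Subtype.val h₄) ⟨z, hz⟩

/-- A local representative of a section of the transfer module. -/
theorem Transfer.exists_rep {U : Opens Z} (m : Transfer hp U) {z : Z} (hz : z ∈ U) :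
    ∃ (W : Opens Z) (h : W ≤ U), z ∈ W ∧ ∃ R : DiffOp EZ W, Represents hp h R m.1 := m.2 z hz

/-- The value at `z` of the action of a section of the transfer module on a smooth function. -/
def trActVal {U : Opens Z} {V : Opens Y} (m : Transfer hp U) (h : ∀ z ∈ U, p z ∈ V)
    (f : SmoothFun EY V) (z : U) : ℂ :=
  (opAct (m.exists_rep z.2).choose_spec.choose_spec.2.choose
    (pullFun hp (fun w hw => h w ((m.exists_rep z.2).choose_spec.choose hw)) f)).1
    ⟨z.1, (m.exists_rep z.2).choose_spec.choose_spec.1⟩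

/-- The representative chosen in `trActVal` does not matter, so any convenient one computes the
action. -/
theorem trActVal_eq {U : Opens Z} {V : Opens Y} {m : Transfer hp U} (h : ∀ z ∈ U, p z ∈ V)
    (f : SmoothFun EY V) {W : Opens Z} {hW : W ≤ U} {R : DiffOp EZ W}
    (hR : Represents hp hW R m.1) {z : Z} (hz : z ∈ W) :
    trActVal m h f ⟨z, hW hz⟩ = (opAct R (pullFun hp (fun w hw => h w (hW hw)) f)).1 ⟨z, hz⟩ := by
  have hs := (m.exists_rep (hW hz)).choose_spec.choose_spec
  refine apply_eq_of_germ_eq hs.1 hz ?_ _ _ f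
  rw [← hR z hz, ← hs.2.choose_spec z hs.1]

/-- The action of a section `[R]` of the transfer module: `f ↦ R (f ∘ p)`. -/
def trAct {U : Opens Z} {V : Opens Y} (m : Transfer hp U) (h : ∀ z ∈ U, p z ∈ V) :
    SmoothFun EY V →ₗ[ℂ] SmoothFun EZ U where
  toFun f := ⟨trActVal m h f, by
    intro z
    obtain ⟨W, hW, hz, R, hR⟩ := m.exists_rep z.2
    have h₁ : ContMDiffAt 𝓘(ℝ, EZ) 𝓘(ℝ, ℂ) ∞ (extFun (trActVal m h f)) z.1 := by
      refine (contMDiffAt_extFun (opAct R (pullFun hp (fun w hw => h w (hW hw)) f)).2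
        hz).congr_of_eventuallyEq ?_
      filter_upwards [W.2.mem_nhds hz] with w hw
      rw [extFun_apply _ hw, extFun_apply _ (hW hw), trActVal_eq h f hR hw]
    have h₂ := (contMDiffAt_subtype_iff (U := U) (x := z)).2 h₁
    rwa [extFun_comp_val] at h₂⟩
  map_add' f g := SmoothFun.ext fun z => by
    obtain ⟨W, hW, hz, R, hR⟩ := m.exists_rep z.2
    change trActVal m h (f + g) ⟨z.1, hW hz⟩
      = trActVal m h f ⟨z.1, hW hz⟩ + trActVal m h g ⟨z.1, hW hz⟩
    rw [trActVal_eq h _ hR hz, trActVal_eq h _ hR hz, trActVal_eq h _ hR hz, map_add, map_add]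
    rfl
  map_smul' c f := SmoothFun.ext fun z => by
    obtain ⟨W, hW, hz, R, hR⟩ := m.exists_rep z.2
    change trActVal m h (c • f) ⟨z.1, hW hz⟩ = c * trActVal m h f ⟨z.1, hW hz⟩
    rw [trActVal_eq h _ hR hz, trActVal_eq h _ hR hz, map_smul, map_smul]
    rfl

theorem trAct_apply {U : Opens Z} {V : Opens Y} {m : Transfer hp U} (h : ∀ z ∈ U, p z ∈ V)
    (f : SmoothFun EY V) {W : Opens Z} {hW : W ≤ U} {R : DiffOp EZ W}
    (hR : Represents hp hW R m.1) {z : Z} (hz : z ∈ W) :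
    (trAct m h f).1 ⟨z, hW hz⟩ = (opAct R (pullFun hp (fun w hw => h w (hW hw)) f)).1 ⟨z, hz⟩ :=
  trActVal_eq h f hR hz

theorem trAct_of_represents {U : Opens Z} {V : Opens Y} {m : Transfer hp U} (h : ∀ z ∈ U, p z ∈ V)
    (f : SmoothFun EY V) {R : DiffOp EZ U} (hR : Represents hp le_rfl R m.1) :
    trAct m h f = opAct R (pullFun hp h f) :=
  SmoothFun.ext fun z => trAct_apply h f hR z.2

theorem res_trAct {U W : Opens Z} {V : Opens Y} (m : Transfer hp U) (h : ∀ z ∈ U, p z ∈ V)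
    (hW : W ≤ U) (f : SmoothFun EY V) :
    res hW (trAct m h f) = trAct (trRes hW m) (fun z hz => h z (hW hz)) f := by
  refine SmoothFun.ext fun z => ?_
  obtain ⟨W₁, hW₁, hz, R, hR⟩ := m.exists_rep (hW z.2)
  have hR' : Represents hp (inf_le_left : W ⊓ W₁ ≤ W) (opRes inf_le_right R) (trRes hW m).1 :=
    fun w hw => hR.mono (inf_le_right : W ⊓ W₁ ≤ W₁) w hw
  refine (trAct_apply h f (hR.mono (inf_le_right : W ⊓ W₁ ≤ W₁)) ⟨z.2, hz⟩).trans
    (trAct_apply _ f hR' ⟨z.2, hz⟩).symm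

theorem trAct_res {U : Opens Z} {V V' : Opens Y} (m : Transfer hp U) (h : ∀ z ∈ U, p z ∈ V)
    (h' : ∀ z ∈ U, p z ∈ V') (hV : V' ≤ V) (f : SmoothFun EY V) :
    trAct m h' (res hV f) = trAct m h f := by
  refine SmoothFun.ext fun z => ?_
  obtain ⟨W₁, hW₁, hz, R, hR⟩ := m.exists_rep z.2
  exact (trAct_apply h' (res hV f) hR hz).trans (trAct_apply h f hR hz).symm

theorem trAct_add_left {U : Opens Z} {V : Opens Y} (m n : Transfer hp U) (h : ∀ z ∈ U, p z ∈ V)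
    (f : SmoothFun EY V) : trAct (m + n) h f = trAct m h f + trAct n h f := by
  refine SmoothFun.ext fun z => ?_
  obtain ⟨W₁, h₁, hz₁, R₁, hR₁⟩ := m.exists_rep z.2
  obtain ⟨W₂, h₂, hz₂, R₂, hR₂⟩ := n.exists_rep z.2
  have r₁ := hR₁.mono (inf_le_left : W₁ ⊓ W₂ ≤ W₁)
  have r₂ := hR₂.mono (inf_le_right : W₁ ⊓ W₂ ≤ W₂)
  have r₃ : Represents hp _ _ (m + n).1 := r₁.add r₂
  refine (trAct_apply h f r₃ ⟨hz₁, hz₂⟩).trans ?_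
  exact congrArg₂ (· + ·) (trAct_apply h f r₁ ⟨hz₁, hz₂⟩).symm (trAct_apply h f r₂ ⟨hz₁, hz₂⟩).symm

theorem trAct_smul_left {U : Opens Z} {V : Opens Y} (P : DiffOp EZ U) (m : Transfer hp U)
    (h : ∀ z ∈ U, p z ∈ V) (f : SmoothFun EY V) :
    trAct (P • m) h f = opAct P (trAct m h f) := by
  refine SmoothFun.ext fun z => ?_
  obtain ⟨W, hW, hz, R, hR⟩ := m.exists_rep z.2
  have r : Represents hp hW _ (P • m).1 := hR.smul P
  refine (trAct_apply h f r hz).trans ?_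
  have h₁ : res hW (trAct m h f) = opAct R (pullFun hp (fun w hw => h w (hW hw)) f) :=
    SmoothFun.ext fun w => trAct_apply h f hR w.2
  have h₂ : res hW (opAct P (trAct m h f)) = opAct (opRes hW P)
      (opAct R (pullFun hp (fun w hw => h w (hW hw)) f)) := by rw [opAct_res, h₁]
  exact (congrFun (congrArg Subtype.val h₂) ⟨z.1, hz⟩).symm

/-- Local representatives are holomorphic operators and commute with antiholomorphic functions. This
handles the conjugate factor of `|g|²`. -/
theorem trAct_conj_mul {U : Opens Z} {V : Opens Y} (m : Transfer hp U) (h : ∀ z ∈ U, p z ∈ V)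
    (g : holFun EY V) (f : SmoothFun EY V) :
    trAct m h (conjFun (toSmooth g) * f)
      = conjFun (toSmooth (pullHol hp h g)) * trAct m h f := by
  refine SmoothFun.ext fun z => ?_
  obtain ⟨W, hW, hz, R, hR⟩ := m.exists_rep z.2
  refine (trAct_apply h _ hR hz).trans ?_
  rw [map_mul]
  have h₁ := opAct_conj_mul R (pullHol hp (fun w hw => h w (hW hw)) g)
    (pullFun hp (fun w hw => h w (hW hw)) f)
  refine (congrFun (congrArg Subtype.val h₁) ⟨z.1, hz⟩).trans ?_
  exact congrArg (_ * ·) (trAct_apply h f hR hz).symm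

/-- The difference between `R` and a local representative of `m` kills holomorphic pull-backs, so it
lies in the ideal. -/
theorem represents_of_trAct {U W : Opens Z} {V : Opens Y} {m : Transfer hp U}
    (hUV : ∀ z ∈ W, p z ∈ V) (hW : W ≤ U) {R : DiffOp EZ W}
    (h : ∀ (W' : Set.Iic W) (V' : Set.Iic V) (h : ∀ z ∈ W'.1, p z ∈ V'.1) (f : holFun EY V'.1),
      trAct (trRes (W'.2.trans hW) m) h (toSmooth f) = R.1.1 W' (pullFun hp h (toSmooth f))) :
    Represents hp hW R m.1 := by
  intro z hz
  obtain ⟨W₁, hW₁, hz₁, R₁, hR₁⟩ := m.exists_rep (hW hz)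
  rw [hR₁ z hz₁]
  refine germ_eq_of_sub_mem hp z (W := W₁ ⊓ W) ⟨hz₁, hz⟩ inf_le_left inf_le_right
    (mem_vertIdeal_of_kills (U := W₁ ⊓ W) hp (V := V) (fun w hw => hUV w hw.2) fun W₂ V' hV' h' f => ?_)
  have hW₂ : W₂.1 ≤ W₁ := W₂.2.trans inf_le_left
  have hr : Represents hp le_rfl (opRes hW₂ R₁) (trRes (hW₂.trans hW₁) m).1 :=
    fun w hw => hR₁.mono hW₂ w hw
  have h₁ := trAct_of_represents h' (toSmooth f) hr
  have h₂ := h ⟨W₂.1, Set.mem_Iic.2 (W₂.2.trans inf_le_right)⟩ ⟨V', hV'⟩ h' f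
  exact sub_eq_zero.2 (h₁.symm.trans h₂)

/-- Faithfulness of the action: by `represents_of_trAct`, a local representative of `n` also
represents `m`. Holomorphic test functions suffice. -/
theorem Transfer.ext_of_trAct {U : Opens Z} {V : Opens Y} (hUV : ∀ z ∈ U, p z ∈ V)
    {m n : Transfer hp U} (h : ∀ (W : Set.Iic U) (V' : Set.Iic V) (h : ∀ z ∈ W.1, p z ∈ V'.1)
      (f : holFun EY V'.1), trAct (trRes W.2 m) h (toSmooth f) = trAct (trRes W.2 n) h (toSmooth f)) :
    m = n := by
  refine Subtype.ext (funext fun z => ?_)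
  obtain ⟨W, hW, hz, R, hR⟩ := n.exists_rep z.2
  have hm : Represents hp hW R m.1 := by
    refine represents_of_trAct (fun w hw => hUV w (hW hw)) hW fun W' V' h' f => ?_
    rw [h ⟨W'.1, W'.2.trans hW⟩ V' h' f]
    exact trAct_of_represents h' (toSmooth f) (R := opRes W'.2 R) fun w hw => hR.mono W'.2 w hw
  exact (hm z.1 hz).trans (hR z.1 hz).symm

/-- A family of maps that is locally of the form `f ↦ R (f ∘ p)` is the action of a section of the
transfer module. -/
theorem Transfer.exists_of_local {U : Opens Z} {V : Opens Y} (hUV : ∀ z ∈ U, p z ∈ V)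
    (φ : ∀ (W : Set.Iic U) (V' : Set.Iic V), (∀ z ∈ W.1, p z ∈ V'.1) →
      SmoothFun EY V'.1 → SmoothFun EZ W.1)
    (hφ : ∀ z ∈ U, ∃ (W : Opens Z) (hW : W ≤ U), z ∈ W ∧ ∃ R : DiffOp EZ W,
      ∀ (W' : Set.Iic W) (V' : Set.Iic V) (h : ∀ z ∈ W'.1, p z ∈ V'.1) (f : SmoothFun EY V'.1),
        φ ⟨W'.1, W'.2.trans hW⟩ V' h f = R.1.1 W' (pullFun hp h f)) :
    ∃ m : Transfer hp U, ∀ z ∈ U, ∃ (W : Opens Z) (hW : W ≤ U), z ∈ W ∧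
      ∃ R : DiffOp EZ W, Represents hp hW R m.1 ∧
      ∀ (W' : Set.Iic W) (V' : Set.Iic V) (h : ∀ z ∈ W'.1, p z ∈ V'.1) (f : SmoothFun EY V'.1),
        φ ⟨W'.1, W'.2.trans hW⟩ V' h f = R.1.1 W' (pullFun hp h f) := by
  choose W hW hz R hR using hφ
  -- The local operators glue: on an overlap both induce `φ`, so their difference kills holomorphic
  -- pull-backs and lies in the ideal.
  have hrep : ∀ (z : Z) (hz' : z ∈ U), Represents hp (hW z hz') (R z hz')
      (fun w : U => germ hp w.1 (R w.1 w.2)) := by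
    intro z hz' w hw
    refine germ_eq_of_sub_mem hp w (W := W w (hW z hz' hw) ⊓ W z hz') ⟨hz _ _, hw⟩ inf_le_left
      inf_le_right (mem_vertIdeal_of_kills (U := W w (hW z hz' hw) ⊓ W z hz') hp (V := V)
        (fun w hw => hUV w (hW z hz' hw.2))
        fun W₂ V' hV' h' f => ?_)
    exact sub_eq_zero.2 ((hR _ _ ⟨W₂.1, Set.mem_Iic.2 (W₂.2.trans inf_le_left)⟩ ⟨V', hV'⟩ h' (toSmooth f)).symm.trans
      (hR z hz' ⟨W₂.1, Set.mem_Iic.2 (W₂.2.trans inf_le_right)⟩ ⟨V', hV'⟩ h' (toSmooth f)))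
  exact ⟨⟨fun w => germ hp w.1 (R w.1 w.2), fun z hz' => ⟨_, hW z hz', hz z hz', _, hrep z hz'⟩⟩,
    fun z hz' => ⟨_, hW z hz', hz z hz', R z hz', hrep z hz', hR z hz'⟩⟩

/-- Forwards, `R S (f ∘ p) = R ((Q f) ∘ p)`. Backwards, if `R` represents `m`, then `R S` acts as
`m'` does and so represents it by faithfulness. -/
theorem isRightMulOp_iff {U : Opens Z} {V : Opens Y} (hUV : ∀ z ∈ U, p z ∈ V) {S : DiffOp EZ U}
    {Q : DiffOp EY V} (hS : IsSmoothLift hp S Q) (m m' : Transfer hp U) :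
    IsRightMulOp S m m' ↔ ∀ (W : Set.Iic U) (V' : Set.Iic V) (h : ∀ z ∈ W.1, p z ∈ V'.1)
      (f : SmoothFun EY V'.1), trAct (trRes W.2 m') h f = trAct (trRes W.2 m) h (Q.1.1 V' f) := by
  constructor
  · intro hm W V' h f
    refine SmoothFun.ext fun z => ?_
    obtain ⟨W₁, hW₁, hz, R, hR, hR'⟩ := hm z.1 (W.2 z.2)
    have r : Represents hp (inf_le_left : W.1 ⊓ W₁ ≤ W.1) (opRes inf_le_right R)
      (trRes W.2 m).1 := fun w hw => hR.mono (inf_le_right : W.1 ⊓ W₁ ≤ W₁) w hw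
    have r' : Represents hp (inf_le_left : W.1 ⊓ W₁ ≤ W.1)
      (opRes inf_le_right (R * opRes hW₁ S)) (trRes W.2 m').1 :=
      fun w hw => hR'.mono (inf_le_right : W.1 ⊓ W₁ ≤ W₁) w hw
    refine (trAct_apply h f r' ⟨z.2, hz⟩).trans
      (Eq.trans ?_ (trAct_apply h _ r ⟨z.2, hz⟩).symm)
    have h₁ := hS ⟨W.1 ⊓ W₁, Set.mem_Iic.2 (inf_le_left.trans W.2)⟩ V' (fun w hw => h w hw.1) f
    exact congrArg (fun g => (opAct (opRes (inf_le_right : W.1 ⊓ W₁ ≤ W₁) R) g).1 ⟨z.1, z.2, hz⟩) h₁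
  · intro H z hz
    obtain ⟨W, hW, hz, R, hR⟩ := m.exists_rep hz
    refine ⟨W, hW, hz, R, hR, represents_of_trAct (fun w hw => hUV w (hW hw)) hW
      fun W' V' h f => ?_⟩
    rw [H ⟨W'.1, W'.2.trans hW⟩ V' h (toSmooth f)]
    have hr : Represents hp le_rfl (opRes W'.2 R) (trRes (W'.2.trans hW) m).1 :=
      fun w hw => hR.mono W'.2 w hw
    refine (trAct_of_represents h _ hr).trans ?_
    exact congrArg (R.1.1 W') (hS ⟨W'.1, W'.2.trans hW⟩ V' h (toSmooth f)).symm

/-- Localize to where a lift exists. The right-hand side mentions only `Q`, so the product is unique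
and independent of the lifts. -/
theorem isRightMul_iff {U : Opens Z} {V : Opens Y} (hUV : ∀ z ∈ U, p z ∈ V)
    (Q : DiffOp EY V) (m m' : Transfer hp U) :
    IsRightMul Q m m' ↔ ∀ (W : Set.Iic U) (V' : Set.Iic V) (h : ∀ z ∈ W.1, p z ∈ V'.1)
      (f : SmoothFun EY V'.1), trAct (trRes W.2 m') h f = trAct (trRes W.2 m) h (Q.1.1 V' f) := by
  constructor
  · intro hm W V' h f
    refine SmoothFun.ext fun z => ?_
    obtain ⟨W₁, hW₁, hz, S, hS, hm₁⟩ := hm z.1 (W.2 z.2)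
    have h₁ := (isRightMulOp_iff (fun w hw => hUV w (hW₁ hw)) (IsLift.isSmoothLift hp hS) _ _).1 hm₁
      ⟨W.1 ⊓ W₁, Set.mem_Iic.2 inf_le_right⟩ V' (fun w hw => h w hw.1) f
    have h₂ : res (inf_le_left : W.1 ⊓ W₁ ≤ W.1) (trAct (trRes W.2 m') h f)
        = res (inf_le_left : W.1 ⊓ W₁ ≤ W.1) (trAct (trRes W.2 m) h (Q.1.1 V' f)) := by
      rw [res_trAct, res_trAct]
      exact h₁
    exact congrFun (congrArg Subtype.val h₂) ⟨z.1, z.2, hz⟩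
  · intro H z hz
    obtain ⟨W, hzW, hWV, S, hS⟩ := exists_isSmoothLift hp Q (hUV z hz)
    have hS' := hS.mono (inf_le_right : U ⊓ W ≤ W)
    refine ⟨U ⊓ W, inf_le_left, ⟨hz, hzW⟩, opRes inf_le_right S, hS'.isLift,
      (isRightMulOp_iff (U := U ⊓ W) (fun w hw => hWV w hw.2) hS' _ _).2 fun W' V' h f =>
        H ⟨W'.1, Set.mem_Iic.2 (W'.2.trans inf_le_left)⟩ V' h f⟩

/-- The family `f ↦ m (Q f)` is locally the action of `R S`, for a representative `R` and a lift
`S`, so it glues to a section. -/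
theorem exists_isRightMul {U : Opens Z} {V : Opens Y} (hUV : ∀ z ∈ U, p z ∈ V)
    (Q : DiffOp EY V) (m : Transfer hp U) : ∃ m', IsRightMul Q m m' := by
  obtain ⟨m', hm'⟩ := Transfer.exists_of_local hUV
    (fun W V' h f => trAct (trRes W.2 m) h (Q.1.1 V' f)) (by
      intro z hz
      obtain ⟨W₁, hz₁, hWV, S, hS⟩ := exists_isSmoothLift hp Q (hUV z hz)
      obtain ⟨W₂, hW₂, hz₂, R, hR⟩ := m.exists_rep hz
      refine ⟨W₁ ⊓ W₂, inf_le_right.trans hW₂, ⟨hz₁, hz₂⟩,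
        opRes inf_le_right R * opRes inf_le_left S, fun W' V' h f => ?_⟩
      have hr : Represents hp le_rfl (opRes (W'.2.trans inf_le_right) R)
          (trRes ((W'.2.trans inf_le_right).trans hW₂) m).1 :=
        fun w hw => hR.mono (W'.2.trans inf_le_right) w hw
      refine (trAct_of_represents h _ hr).trans ?_
      exact congrArg (R.1.1 ⟨W'.1, Set.mem_Iic.2 (W'.2.trans inf_le_right)⟩)
        (hS ⟨W'.1, Set.mem_Iic.2 (W'.2.trans inf_le_left)⟩ V' h f).symm)
  refine ⟨m', (isRightMul_iff hUV Q m m').2 fun W V' h f => SmoothFun.ext fun z => ?_⟩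
  obtain ⟨W₁, hW₁, hz, R, hR, hR'⟩ := hm' z.1 (W.2 z.2)
  have r : Represents hp (inf_le_left : W.1 ⊓ W₁ ≤ W.1) (opRes inf_le_right R)
      (trRes W.2 m').1 := fun w hw => hR.mono (inf_le_right : W.1 ⊓ W₁ ≤ W₁) w hw
  refine (trAct_apply h f r ⟨z.2, hz⟩).trans ?_
  have h₁ := hR' ⟨W.1 ⊓ W₁, Set.mem_Iic.2 inf_le_right⟩ V' (fun w hw => h w hw.1) f
  have h₂ := (res_trAct (trRes W.2 m) h (inf_le_left : W.1 ⊓ W₁ ≤ W.1) (Q.1.1 V' f)).trans h₁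
  exact (congrFun (congrArg Subtype.val h₂) ⟨z.1, z.2, hz⟩).symm

theorem isSmoothLift_mulOp {U : Opens Z} {V : Opens Y} (hUV : ∀ z ∈ U, p z ∈ V)
    (g : holFun EY V) : IsSmoothLift hp (mulOp (pullHol hp hUV g)) (mulOp g) :=
  fun _ _ _ _ => rfl

end TransferAction

/-! ### Frames of line bundles -/

section Frames

variable {E : Type*} [NormedAddCommGroup E] [NormedSpace ℂ E]
  {X : Type*} [TopologicalSpace X] [ChartedSpace E X] {ι : Type*} (C : LineCocycle E X ι)

theorem LineCocycle.g_self (i : ι) {x : X} (hx : x ∈ C.dom i) : (C.g i i).1 ⟨x, hx, hx⟩ = 1 := by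
  have h := C.g_mul i i i x hx hx hx
  exact (mul_eq_left₀ (C.g_ne_zero i i _)).1 h.symm

theorem LineCocycle.g_mul_g (i j : ι) {x : X} (hi : x ∈ C.dom i) (hj : x ∈ C.dom j) :
    (C.g i j).1 ⟨x, hi, hj⟩ * (C.g j i).1 ⟨x, hj, hi⟩ = 1 := by
  rw [← C.g_mul i j i x hi hj hi, C.g_self i hi]

theorem conj_mul_self_mul (a b : ℂ) : starRingEnd ℂ a * (a * b) = ((‖a‖ ^ 2 : ℝ) : ℂ) * b := by
  rw [← mul_assoc, ← Complex.normSq_eq_conj_mul_self, Complex.normSq_eq_norm_sq]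

/-- The coordinate of a section of `|L|²` in the frame `i`. -/
def NormSqSec.comp {C : LineCocycle E X ι} {V : Opens X} (s : NormSqSec C V) (i : ι) :
    SmoothFun E (V ⊓ C.dom i) := s.1 i

theorem NormSqSec.ext {C : LineCocycle E X ι} {V : Opens X} {s t : NormSqSec C V}
    (h : ∀ i, s.comp i = t.comp i) : s = t := Subtype.ext (funext h)

theorem LineCocycle.inf_dom_le {V : Opens X} {i : ι} (hV : V ≤ C.dom i) (j : ι) :
    V ⊓ C.dom j ≤ C.dom j ⊓ C.dom i := fun _ hx => ⟨hx.2, hV hx.1⟩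

theorem LineCocycle.inf_dom_le_symm {V : Opens X} {i : ι} (hV : V ≤ C.dom i) (j : ι) :
    V ⊓ C.dom j ≤ C.dom i ⊓ C.dom j := fun _ hx => ⟨hV hx.1, hx.2⟩

/-- The section of `|L|²` with coordinate `f` in the frame `i`. -/
def secOfFun {V : Opens X} {i : ι} (hV : V ≤ C.dom i) (f : SmoothFun E V) : NormSqSec C V :=
  -- The coordinate is `|g j i|² f`, split into conjugate and holomorphic factors so that its
  -- smoothness is visible.
  ⟨fun j => conjFun (toSmooth (holRes (C.inf_dom_le hV j) (C.g j i)))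
      * (toSmooth (holRes (C.inf_dom_le hV j) (C.g j i)) * res inf_le_left f), by
    intro j k x hx hj hk
    change starRingEnd ℂ ((C.g j i).1 ⟨x, hj, hV hx⟩) * ((C.g j i).1 ⟨x, hj, hV hx⟩ * f.1 ⟨x, hx⟩)
      = _ * (starRingEnd ℂ ((C.g k i).1 ⟨x, hk, hV hx⟩)
        * ((C.g k i).1 ⟨x, hk, hV hx⟩ * f.1 ⟨x, hx⟩))
    rw [conj_mul_self_mul, conj_mul_self_mul, C.g_mul j k i x hj hk (hV hx), norm_mul, mul_pow,
      Complex.ofReal_mul, mul_assoc]⟩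

theorem secOfFun_self {V : Opens X} {i : ι} (hV : V ≤ C.dom i) (f : SmoothFun E V) :
    (secOfFun C hV f).comp i = res inf_le_left f := by
  refine SmoothFun.ext fun x => ?_
  change starRingEnd ℂ ((C.g i i).1 ⟨x.1, x.2.2, hV x.2.1⟩) * ((C.g i i).1 ⟨x.1, x.2.2, hV x.2.1⟩
    * f.1 ⟨x.1, x.2.1⟩) = f.1 ⟨x.1, x.2.1⟩
  rw [C.g_self i x.2.2, map_one, one_mul, one_mul]

/-- The twisted differential operator that is given by `R` in the frame `i`. -/
def twOpOfFrame {V : Opens X} {i : ι} (hV : V ≤ C.dom i) (R : DiffOp E V) : TwDiffOp C V :=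
  -- The compatibility condition forces `P j = g j i * R * (g j i)⁻¹`, and the inverse of `g j i` is
  -- `g i j`.
  ⟨fun j => mulOp (holRes (C.inf_dom_le hV j) (C.g j i)) * opRes inf_le_left R
      * mulOp (holRes (C.inf_dom_le_symm hV j) (C.g i j)), by
    intro j k
    have hj := inf_left_le V (C.dom j) (C.dom k)
    have hk := inf_right_le V (C.dom j) (C.dom k)
    let gji := holRes (hj.trans (C.inf_dom_le hV j)) (C.g j i)
    let gij := holRes (hj.trans (C.inf_dom_le_symm hV j)) (C.g i j)
    let gki := holRes (hk.trans (C.inf_dom_le hV k)) (C.g k i)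
    let gik := holRes (hk.trans (C.inf_dom_le_symm hV k)) (C.g i k)
    let gjk := C.gOn V j k
    have h₁ : gij * gjk = gik := Subtype.ext (funext fun x =>
      (C.g_mul i j k x.1 (hV x.2.1) x.2.2.1 x.2.2.2).symm)
    have h₂ : gjk * gki = gji := Subtype.ext (funext fun x =>
      (C.g_mul j k i x.1 x.2.2.1 x.2.2.2 (hV x.2.1)).symm)
    change mulOp gji * opRes inf_le_left R * mulOp gij * mulOp gjk
      = mulOp gjk * (mulOp gki * opRes inf_le_left R * mulOp gik)
    rw [mul_assoc, ← mulOp_mul, h₁, ← h₂, mulOp_mul, mul_assoc, mul_assoc, mul_assoc]⟩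

end Frames

/-! ### The bimodule homomorphism -/

section Bimodule

variable {EZ : Type*} [NormedAddCommGroup EZ] [NormedSpace ℂ EZ]
  {EY : Type*} [NormedAddCommGroup EY] [NormedSpace ℂ EY]
  {Z : Type*} [TopologicalSpace Z] [ChartedSpace EZ Z]
  {Y : Type*} [TopologicalSpace Y] [ChartedSpace EY Y]
  {p : Z → Y} {hp : IsSubmersion 𝓘(ℂ, EZ) 𝓘(ℂ, EY) ω p}
  [FiniteDimensional ℂ EZ] [FiniteDimensional ℂ EY]
  {ι : Type*} {C : LineCocycle EY Y ι}

variable (C) in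
theorem map_frame (U : Opens Z) (i : ι) :
    ∀ z ∈ U ⊓ (C.pullback hp).dom i, p z ∈ img hp U ⊓ C.dom i :=
  fun z hz => ⟨⟨z, hz.1, rfl⟩, hz.2⟩

/-- The coefficient of a section of `D_{Z→Y,L}` in the frame `i`. -/
def TwTransfer.comp {U : Opens Z} (m : TwTransfer hp C U) (i : ι) :
    Transfer hp (U ⊓ (C.pullback hp).dom i) := m.1 i

theorem TwTransfer.ext {U : Opens Z} {m n : TwTransfer hp C U} (h : ∀ i, m.comp i = n.comp i) :
    m = n := Subtype.ext (funext h)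

theorem HomSec.ext {U : Opens Z} {φ ψ : HomSec hp C U} (h : ∀ W s, φ.1 W s = ψ.1 W s) : φ = ψ :=
  Subtype.ext (funext fun W => LinearMap.ext (h W))

/-- The condition that relates the coefficients of a section of `D_{Z→Y,L}` in two frames, through
the action on smooth functions. -/
theorem isRightMulOp_gOn_iff {U : Opens Z} {i j : ι} (mi : Transfer hp (U ⊓ (C.pullback hp).dom i))
    (mj : Transfer hp (U ⊓ (C.pullback hp).dom j)) :
    IsRightMulOp (mulOp ((C.pullback hp).gOn U i j)) (trRes (inf_left_le U _ _) mi)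
      (mulOp ((C.pullback hp).gOn U i j) • trRes (inf_right_le U ((C.pullback hp).dom i) _) mj) ↔
    ∀ (W : Opens Z) (hW : W ≤ U ⊓ ((C.pullback hp).dom i ⊓ (C.pullback hp).dom j))
      (V : Opens Y) (hV : V ≤ img hp U ⊓ (C.dom i ⊓ C.dom j)) (h : ∀ z ∈ W, p z ∈ V)
      (f : SmoothFun EY V),
      trAct (trRes (hW.trans (inf_left_le U _ _)) mi) h (res hV (toSmooth (C.gOn (img hp U) i j)) * f)
        = res hW (toSmooth ((C.pullback hp).gOn U i j))
          * trAct (trRes (hW.trans (inf_right_le U _ _)) mj) h f := by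
  have hUV : ∀ z ∈ U ⊓ ((C.pullback hp).dom i ⊓ (C.pullback hp).dom j),
      p z ∈ img hp U ⊓ (C.dom i ⊓ C.dom j) := fun z hz => ⟨⟨z, hz.1, rfl⟩, hz.2⟩
  have key : ∀ (W : Opens Z) (hW : W ≤ U ⊓ ((C.pullback hp).dom i ⊓ (C.pullback hp).dom j))
      (V : Opens Y) (h : ∀ z ∈ W, p z ∈ V) (f : SmoothFun EY V),
      trAct (trRes hW (mulOp ((C.pullback hp).gOn U i j)
        • trRes (inf_right_le U ((C.pullback hp).dom i) _) mj)) h f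
      = res hW (toSmooth ((C.pullback hp).gOn U i j))
          * trAct (trRes (hW.trans (inf_right_le U _ _)) mj) h f := fun W hW V h f =>
    (congrArg (fun m => trAct m h f) (trRes_smul hW (mulOp ((C.pullback hp).gOn U i j)) _)).trans
      (trAct_smul_left (opRes hW (mulOp ((C.pullback hp).gOn U i j))) _ h f)
  refine (isRightMulOp_iff hUV (isSmoothLift_mulOp hUV (C.gOn (img hp U) i j)) _ _).trans
    ⟨fun H W hW V hV h f => ?_, fun H W V h f => ?_⟩
  · exact (H ⟨W, hW⟩ ⟨V, hV⟩ h f).symm.trans (key W hW V h f)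
  · exact (key W.1 W.2 V.1 h f).trans (H W.1 W.2 V.1 V.2 h f).symm

theorem TwTransfer.trAct_frame {U : Opens Z} (m : TwTransfer hp C U) (i j : ι)
    {W : Opens Z} (hW : W ≤ U ⊓ ((C.pullback hp).dom i ⊓ (C.pullback hp).dom j))
    {V : Opens Y} (hV : V ≤ img hp U ⊓ (C.dom i ⊓ C.dom j)) (h : ∀ z ∈ W, p z ∈ V)
    (f : SmoothFun EY V) :
    trAct (trRes (hW.trans (inf_left_le U _ _)) (m.comp i)) h
        (res hV (toSmooth (C.gOn (img hp U) i j)) * f)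
      = res hW (toSmooth ((C.pullback hp).gOn U i j))
        * trAct (trRes (hW.trans (inf_right_le U _ _)) (m.comp j)) h f :=
  (isRightMulOp_gOn_iff (m.comp i) (m.comp j)).1 (m.2 i j) W hW V hV h f

/-- The right action of `p⁻¹(D_{Y,L})` on `D_{Z→Y,L}` is well defined. -/
theorem existsUnique_isTwRightMul {U : Opens Z} (Q : TwDiffOp C (img hp U))
    (m : TwTransfer hp C U) : ∃! m', IsTwRightMul Q m m' := by
  choose m' hm' using fun i => exists_isRightMul (map_frame C U i) (Q.1 i) (m.comp i)
  have hact := fun i => (isRightMul_iff (map_frame C U i) (Q.1 i) (m.comp i) (m' i)).1 (hm' i)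
  refine ⟨⟨m', fun i j => (isRightMulOp_gOn_iff (m' i) (m' j)).2 fun W hW V hV h f => ?_⟩, hm',
    fun n hn => ?_⟩
  -- With `g = g i j`, the chain is `m' i (g f) = m i (Q i (g f)) = m i (g Q j f) = g m j (Q j f) =
  -- g m' j f`.
  · have h₁ := hact i ⟨W, hW.trans (inf_left_le U _ _)⟩ ⟨V, hV.trans (inf_left_le _ _ _)⟩ h
      (res hV (toSmooth (C.gOn (img hp U) i j)) * f)
    have h₂ := hact j ⟨W, hW.trans (inf_right_le U _ _)⟩ ⟨V, hV.trans (inf_right_le _ _ _)⟩ h f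
    have h₃ : (Q.1 i).1.1 ⟨V, hV.trans (inf_left_le _ _ _)⟩
        (res hV (toSmooth (C.gOn (img hp U) i j)) * f)
        = res hV (toSmooth (C.gOn (img hp U) i j))
          * (Q.1 j).1.1 ⟨V, hV.trans (inf_right_le _ _ _)⟩ f :=
      congrArg (fun T : DiffOp EY (img hp U ⊓ (C.dom i ⊓ C.dom j)) => T.1.1 ⟨V, hV⟩ f) (Q.2 i j)
    have h₄ := m.trAct_frame i j hW hV h ((Q.1 j).1.1 ⟨V, hV.trans (inf_right_le _ _ _)⟩ f)
    refine h₁.trans ((congrArg (trAct (trRes (hW.trans (inf_left_le U _ _)) (m.comp i)) h) h₃).trans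
      (h₄.trans ?_))
    exact congrArg (res hW (toSmooth ((C.pullback hp).gOn U i j)) * ·) h₂.symm
  · refine TwTransfer.ext fun i => Transfer.ext_of_trAct (map_frame C U i) fun W V' h f => ?_
    exact ((isRightMul_iff (map_frame C U i) (Q.1 i) (m.comp i) (n.comp i)).1 (hn i) W V' h
      (toSmooth f)).trans (hact i W V' h (toSmooth f)).symm

/-- The two coordinates of `s` differ by the conjugate of `g` times `g`. The conjugate passes
through the holomorphic operator, and `g` passes by the frame condition while exchanging `m i` for
`m j`. -/
theorem TwTransfer.trAct_normSq {U : Opens Z} (m : TwTransfer hp C U)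
    (s : NormSqSec C (img hp U)) (i j : ι) :
    res (inf_left_le U ((C.pullback hp).dom i) ((C.pullback hp).dom j))
        (trAct (m.comp i) (map_frame C U i) (s.comp i))
      = conjFun (toSmooth ((C.pullback hp).gOn U i j)) * (toSmooth ((C.pullback hp).gOn U i j)
        * res (inf_right_le U ((C.pullback hp).dom i) ((C.pullback hp).dom j))
          (trAct (m.comp j) (map_frame C U j) (s.comp j))) := by
  have h : ∀ w ∈ U ⊓ ((C.pullback hp).dom i ⊓ (C.pullback hp).dom j),
    p w ∈ img hp U ⊓ (C.dom i ⊓ C.dom j) := fun w hw => ⟨⟨w, hw.1, rfl⟩, hw.2⟩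
  have h₁ : res (inf_left_le (img hp U) (C.dom i) (C.dom j)) (s.comp i)
      = conjFun (toSmooth (C.gOn (img hp U) i j)) * (toSmooth (C.gOn (img hp U) i j)
        * res (inf_right_le (img hp U) (C.dom i) (C.dom j)) (s.comp j)) :=
    SmoothFun.ext fun y => (s.2 i j y.1 y.2.1 y.2.2.1 y.2.2.2).trans (conj_mul_self_mul _ _).symm
  rw [res_trAct, res_trAct, ← trAct_res _ _ h (inf_left_le (img hp U) (C.dom i) (C.dom j)), h₁,
    trAct_conj_mul, ← trAct_res _ _ h (inf_right_le (img hp U) (C.dom i) (C.dom j))]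
  exact congrArg (conjFun (toSmooth ((C.pullback hp).gOn U i j)) * ·)
    (m.trAct_frame i j le_rfl le_rfl h (res (inf_right_le (img hp U) (C.dom i) (C.dom j)) (s.comp j)))

/-- The action of a section of `D_{Z→Y,L}` over `U` on the smooth sections of `|L|²` over `p(U)`. -/
def twTrAct {U : Opens Z} (m : TwTransfer hp C U) :
    NormSqSec C (img hp U) →ₗ[ℂ] NormSqSec (C.pullback hp) U where
  toFun s := ⟨fun i => trAct (m.comp i) (map_frame C U i) (s.comp i),
    fun i j z hz hi hj => (congrFun (congrArg Subtype.val (m.trAct_normSq s i j))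
      ⟨z, hz, hi, hj⟩).trans (conj_mul_self_mul _ _)⟩
  map_add' s t := NormSqSec.ext fun i => map_add (trAct (m.comp i) _) (s.comp i) (t.comp i)
  map_smul' c s := NormSqSec.ext fun i => map_smul (trAct (m.comp i) _) c (s.comp i)

theorem twTrAct_comp {U : Opens Z} (m : TwTransfer hp C U) (s : NormSqSec C (img hp U)) (i : ι) :
    (twTrAct m s).comp i = trAct (m.comp i) (map_frame C U i) (s.comp i) := rfl

theorem twTrAct_res {W U : Opens Z} (h : W ≤ U) (m : TwTransfer hp C U)
    (s : NormSqSec C (img hp U)) :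
    secRes h (twTrAct m s) = twTrAct (twTrRes h m) (secRes (img_mono hp h) s) :=
  NormSqSec.ext fun i => (res_trAct (m.comp i) (map_frame C U i)
    (inf_le_inf_right _ h) (s.comp i)).trans (trAct_res _ _ (map_frame C W i)
      (inf_le_inf_right _ (img_mono hp h)) (s.comp i)).symm

theorem twTrRes_smul {W U : Opens Z} (h : W ≤ U) (P : TwDiffOp (C.pullback hp) U)
    (m : TwTransfer hp C U) : twTrRes h (P • m) = twOpRes h P • twTrRes h m :=
  TwTransfer.ext fun i => trRes_smul (inf_le_inf_right _ h) (P.1 i) (m.comp i)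

theorem twTrAct_add {U : Opens Z} (m n : TwTransfer hp C U) (s : NormSqSec C (img hp U)) :
    twTrAct (m + n) s = twTrAct m s + twTrAct n s :=
  NormSqSec.ext fun i => trAct_add_left (m.comp i) (n.comp i) _ (s.comp i)

theorem twTrAct_smul {U : Opens Z} (P : TwDiffOp (C.pullback hp) U) (m : TwTransfer hp C U)
    (s : NormSqSec C (img hp U)) : twTrAct (P • m) s = secAct P (twTrAct m s) :=
  NormSqSec.ext fun i => trAct_smul_left (P.1 i) (m.comp i) _ (s.comp i)

/-- A section of `D_{Z→Y,L}`, as a section of the `Hom` sheaf. -/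
def toHomSec {U : Opens Z} (m : TwTransfer hp C U) : HomSec hp C U :=
  ⟨fun W => twTrAct (twTrRes W.2 m), fun W _ h s => twTrAct_res h (twTrRes W.2 m) s⟩

theorem toHomSec_add {U : Opens Z} (m n : TwTransfer hp C U) :
    toHomSec (m + n) = toHomSec m + toHomSec n :=
  HomSec.ext fun W s => twTrAct_add (twTrRes W.2 m) (twTrRes W.2 n) s

theorem toHomSec_smul {U : Opens Z} (P : TwDiffOp (C.pullback hp) U) (m : TwTransfer hp C U) :
    toHomSec (P • m) = P • toHomSec m :=
  HomSec.ext fun W s => (congrArg (fun n => twTrAct n s) (twTrRes_smul W.2 P m)).trans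
    (twTrAct_smul (twOpRes W.2 P) (twTrRes W.2 m) s)

theorem toHomSec_right {U : Opens Z} {Q : TwDiffOp C (img hp U)} {m m' : TwTransfer hp C U}
    (hm : IsTwRightMul Q m m') : toHomSec m' = homRightMul (toHomSec m) Q :=
  HomSec.ext fun W s => NormSqSec.ext fun i =>
    (isRightMul_iff (map_frame C U i) (Q.1 i) (m.comp i) (m'.comp i)).1 (hm i)
      ⟨W.1 ⊓ (C.pullback hp).dom i, Set.mem_Iic.2 (inf_le_inf_right _ W.2)⟩
      ⟨img hp W.1 ⊓ C.dom i, Set.mem_Iic.2 (inf_le_inf_right _ (img_mono hp W.2))⟩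
      (map_frame C W.1 i) (s.comp i)

/-! ### The homomorphism, its injectivity and its uniqueness -/

variable (hp C)

/-- The homomorphism from `D_{Z→Y,L}` to the `Hom` sheaf that is given by the action on smooth
sections. -/
def transferHom : BimoduleHom hp C where
  app _ :=
    { toFun := toHomSec
      map_add' := toHomSec_add
      map_smul' := toHomSec_smul }
  app_res _ _ := rfl
  app_right _ _ _ hm := toHomSec_right hm

theorem transferHom_twOne : (transferHom hp C).app ⊤ (twOne hp C) = pullSec hp C :=
  HomSec.ext fun W s => NormSqSec.ext fun i => by
    have hr : Represents hp le_rfl (1 : DiffOp EZ (W.1 ⊓ (C.pullback hp).dom i))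
        ((twTrRes W.2 (twOne hp C)).comp i).1 := fun w hw =>
      (germ_opRes hp w (inf_le_inf_right _ W.2) hw 1).symm
    exact trAct_of_represents (map_frame C W.1 i) (s.comp i) hr

/-- By faithfulness it suffices to recover the action of each coefficient on holomorphic functions.
Over an open set inside one frame, any test function is the coordinate of a section of `|L|²`. -/
theorem transferHom_injective (U : Opens Z) : Function.Injective ((transferHom hp C).app U) := by
  intro m n hmn
  refine TwTransfer.ext fun i => Transfer.ext_of_trAct (map_frame C U i) fun W V' h f => ?_
  have hWU : W.1 ≤ U := W.2.trans inf_le_left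
  have hWi : W.1 ≤ (C.pullback hp).dom i := W.2.trans inf_le_right
  have himg : img hp W.1 ≤ V'.1 := by
    rintro _ ⟨w, hw, rfl⟩
    exact h w hw
  have hi : img hp W.1 ≤ C.dom i := (himg.trans V'.2).trans inf_le_right
  -- `Hom` sections over `W` take sections over `p(W)`, so the test function is first restricted
  -- from `V'`; its pull-back to `W` is unchanged.
  let s : NormSqSec C (img hp W.1) := secOfFun C hi (res himg (toSmooth f))
  have hs : ∀ k : TwTransfer hp C U, res (le_inf le_rfl hWi) ((twTrAct (twTrRes hWU k) s).comp i)
      = trAct (trRes W.2 (k.comp i)) h (toSmooth f) := by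
    intro k
    rw [twTrAct_comp, secOfFun_self, res_trAct]
    exact trAct_res _ h _ (inf_le_left.trans himg) (toSmooth f)
  have hmn' : twTrAct (twTrRes hWU m) s = twTrAct (twTrRes hWU n) s :=
    congrArg (fun φ : HomSec hp C U => φ.1 ⟨W.1, hWU⟩ s) hmn
  exact (hs m).symm.trans ((congrArg (fun t : NormSqSec (C.pullback hp) W.1 =>
    res (le_inf le_rfl hWi) (t.comp i)) hmn').trans (hs n))

variable {hp C}

/-- In a frame, a section of `D_{Z→Y,L}` is the image of `1_{Z→Y,L}` under a twisted differential
operator. -/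
theorem twTrRes_eq_smul_twOne {U W : Opens Z} (hW : W ≤ U) {i : ι} (hi : W ≤ (C.pullback hp).dom i)
    {R : DiffOp EZ W} {m : TwTransfer hp C U} (hR : Represents hp (le_inf hW hi) R (m.comp i).1) :
    twTrRes hW m = twOpOfFrame (C.pullback hp) hi R • twTrRes le_top (twOne hp C) := by
  refine TwTransfer.ext fun j => Transfer.ext_of_trAct (map_frame C W j) fun W' V' h f => ?_
  have hWi' : W'.1 ≤ U ⊓ ((C.pullback hp).dom j ⊓ (C.pullback hp).dom i) := fun w hw =>
    ⟨hW (W'.2 hw).1, (W'.2 hw).2, hi (W'.2 hw).1⟩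
  have hVi : V'.1 ≤ img hp U ⊓ (C.dom j ⊓ C.dom i) := by
    intro y hy
    obtain ⟨⟨w, hw, rfl⟩, hj⟩ := V'.2 hy
    exact ⟨⟨w, hW hw, rfl⟩, hj, hi hw⟩
  have hVij : V'.1 ≤ C.dom i ⊓ C.dom j := fun _ hy => ⟨(hVi hy).2.2, (hVi hy).2.1⟩
  -- Since `g j i * g i j = 1`, one has `m j (f) = m j (g j i * (g i j * f)) = g j i * m i (g i j *
  -- f)`. As `m i` is represented by `R`, this is the frame-`j` component of the twisted operator
  -- applied to `1`.
  let gij : SmoothFun EY V'.1 := toSmooth (holRes hVij (C.g i j))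
  have h₁ := m.trAct_frame j i hWi' hVi h (gij * toSmooth f)
  have h₂ : res hVi (toSmooth (C.gOn (img hp U) j i)) * (gij * toSmooth f) = toSmooth f := by
    rw [← mul_assoc]
    have : res hVi (toSmooth (C.gOn (img hp U) j i)) * gij = 1 :=
      SmoothFun.ext fun y => C.g_mul_g j i (hVi y.2).2.1 (hVi y.2).2.2
    rw [this, one_mul]
  rw [h₂] at h₁
  have hW' : W'.1 ≤ W := W'.2.trans inf_le_left
  have hr : Represents hp le_rfl (opRes hW' R) (trRes (hW'.trans (le_inf hW hi)) (m.comp i)).1 :=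
    fun w hw => hR.mono hW' w hw
  have h₃ := trAct_of_represents h (gij * toSmooth f) hr
  have hr₁ : Represents hp le_rfl (1 : DiffOp EZ W'.1)
      (trRes W'.2 ((twTrRes (le_top : W ≤ ⊤) (twOne hp C)).comp j)).1 := fun w hw =>
    (germ_opRes hp w (W'.2.trans (inf_le_inf_right _ le_top)) hw 1).symm
  have h₄ := (congrArg (fun n => trAct n h (toSmooth f))
    (trRes_smul W'.2 ((twOpOfFrame (C.pullback hp) hi R).1 j)
      ((twTrRes (le_top : W ≤ ⊤) (twOne hp C)).comp j))).trans ((trAct_smul_left _ _ _ _).trans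
      (congrArg (opAct (opRes W'.2 ((twOpOfFrame (C.pullback hp) hi R).1 j)))
        (trAct_of_represents h (toSmooth f) hr₁)))
  exact (h₁.trans (congrArg (res hWi' (toSmooth ((C.pullback hp).gOn U j i)) * ·) h₃)).trans h₄.symm

/-- Near each point a section is a twisted operator times `1_{Z→Y,L}`. Left linearity and
compatibility with restriction then determine its image locally, hence everywhere. -/
theorem BimoduleHom.eq_of_app_twOne_eq {Φ Ψ : BimoduleHom hp C}
    (h : Φ.app ⊤ (twOne hp C) = Ψ.app ⊤ (twOne hp C)) : Φ = Ψ := by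
  have key : ∀ (U : Opens Z) (m : TwTransfer hp C U), Φ.app U m = Ψ.app U m := by
    intro U m
    refine HomSec.ext fun W s => NormSqSec.ext fun j => SmoothFun.ext fun z => ?_
    obtain ⟨i, hi⟩ := (C.pullback hp).covers z.1
    obtain ⟨W₁, hW₁, hz₁, R, hR⟩ := (m.comp i).exists_rep (z := z.1) ⟨W.2 z.2.1, hi⟩
    let W₂ : Opens Z := W.1 ⊓ W₁
    have hW₂ : W₂ ≤ U := inf_le_left.trans W.2
    have hi₂ : W₂ ≤ (C.pullback hp).dom i := inf_le_right.trans (hW₁.trans inf_le_right)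
    have hm := twTrRes_eq_smul_twOne hW₂ hi₂ (R := opRes inf_le_right R) (m := m)
      (hR.mono (inf_le_right : W.1 ⊓ W₁ ≤ W₁))
    -- On the small set `W₂` the section is a multiple of the restricted generator, on which both
    -- homomorphisms agree.
    have hres : homRes hW₂ (Φ.app U m) = homRes hW₂ (Ψ.app U m) := by
      rw [← Φ.app_res, ← Ψ.app_res, hm, map_smul, map_smul, Φ.app_res, Ψ.app_res, h]
    have h₁ : (Φ.app U m).1 ⟨W₂, hW₂⟩ = (Ψ.app U m).1 ⟨W₂, hW₂⟩ :=
      congrArg (fun φ : HomSec hp C W₂ => φ.1 ⟨W₂, Set.self_mem_Iic⟩) hres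
    have h₂ : secRes (inf_le_left : W₂ ≤ W.1) ((Φ.app U m).1 W s)
        = secRes (inf_le_left : W₂ ≤ W.1) ((Ψ.app U m).1 W s) := by
      rw [(Φ.app U m).2 W ⟨W₂, hW₂⟩ inf_le_left, (Ψ.app U m).2 W ⟨W₂, hW₂⟩ inf_le_left, h₁]
    exact congrArg (fun t : NormSqSec (C.pullback hp) W₂ => (t.1 j).1 ⟨z.1, ⟨z.2.1, hz₁⟩, z.2.2⟩) h₂
  obtain ⟨φ, _, _⟩ := Φ
  obtain ⟨ψ, _, _⟩ := Ψ
  have : φ = ψ := funext fun U => LinearMap.ext (key U)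
  subst this
  rfl

end Bimodule

end HolDiff

end

theorem proposition3p4
    {EZ : Type*} [NormedAddCommGroup EZ] [NormedSpace ℂ EZ] [FiniteDimensional ℂ EZ]
    {EY : Type*} [NormedAddCommGroup EY] [NormedSpace ℂ EY] [FiniteDimensional ℂ EY]
    {Z : Type*} [TopologicalSpace Z] [ChartedSpace EZ Z] [IsManifold 𝓘(ℂ, EZ) ω Z]
    {Y : Type*} [TopologicalSpace Y] [ChartedSpace EY Y] [IsManifold 𝓘(ℂ, EY) ω Y]
    {p : Z → Y} (hp : IsSubmersion 𝓘(ℂ, EZ) 𝓘(ℂ, EY) ω p)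
    (L : Y → Type*) [∀ y, AddCommGroup (L y)] [∀ y, Module ℂ (L y)]
    [∀ y, TopologicalSpace (L y)] [TopologicalSpace (TotalSpace ℂ L)]
    [FiberBundle ℂ L] [VectorBundle ℂ ℂ L] [ContMDiffVectorBundle ω ℂ L 𝓘(ℂ, EY)] :
    -- the right action of `p⁻¹(D_{Y,L})` on `D_{Z→Y,L}` is well defined
    (∀ (U : Opens Z) (Q : HolDiff.TwDiffOp (HolDiff.lineCocycle (E := EY) L) (HolDiff.img hp U))
      (m : HolDiff.TwTransfer hp (HolDiff.lineCocycle L) U), ∃! m', HolDiff.IsTwRightMul Q m m') ∧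
    -- the bimodule homomorphism exists, is injective and is unique
    ∃ Φ : HolDiff.BimoduleHom hp (HolDiff.lineCocycle L),
      (∀ U, Function.Injective (Φ.app U)) ∧
      Φ.app ⊤ (HolDiff.twOne hp (HolDiff.lineCocycle L))
        = HolDiff.pullSec hp (HolDiff.lineCocycle L) ∧
      ∀ Ψ : HolDiff.BimoduleHom hp (HolDiff.lineCocycle L),
        Ψ.app ⊤ (HolDiff.twOne hp (HolDiff.lineCocycle L))
          = HolDiff.pullSec hp (HolDiff.lineCocycle L) → Ψ = Φ :=
  ⟨fun _ Q m => HolDiff.existsUnique_isTwRightMul Q m,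
    HolDiff.transferHom hp (HolDiff.lineCocycle L), HolDiff.transferHom_injective hp _,
    HolDiff.transferHom_twOne hp _, fun _ hΨ =>
      HolDiff.BimoduleHom.eq_of_app_twOne_eq (hΨ.trans (HolDiff.transferHom_twOne hp _).symm)⟩
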